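/- Let $(G_n)_{n\in\mathbb N}$ be a directed system of connected complex affine algebraic groups whose transition maps are homomorphic (closed) embeddings, let $G=\varinjlim G_n$, $\mathfrak g_n=\mathrm{Lie}(G_n)$, $\mathfrak g=\varinjlim\mathfrak g_n$, and let $\mathfrak g^*=\varprojlim\mathfrak g_n^*$ be the dual space, regarded as a provariety (inverse limit topology; regular functions are locally pulled back from regular functions on some $\mathfrak g_n^*$), so that $T_\mu(\mathfrak g^*)=(\mathfrak m_\mu/\mathfrak m_\mu^2)^*$ and $T^*_\mu(\mathfrak g^*)=\mathfrak m_\mu/\mathfrak m_\mu^2\cong\mathfrak g$. Let $\pi$ be the bivector of the Lie–Poisson structure, $\pi_\mu(x,y)=\mu([x,y])$ for $x,y\in\mathfrak g\cong T_\mu^*(\mathfrak g^*)$, let $\tilde\pi_\mu:T^*_\mu(\mathfrak g^*)\to T_\mu(\mathfrak g^*)$, $\tilde\pi_\mu(\alpha)(\beta)=\pi_\mu(\alpha,\beta)$, be the anchor map, and let $\mathfrak X(\mathfrak g^*)_\mu=\operatorname{Im}\tilde\pi_\mu$ be the characteristic distribution. Let $\lambda\in\mathfrak g^*$ with components $\lambda_n\in\mathfrak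 g_n^*$, and let $G\cdot\lambda\subset\mathfrak g^*$ be its coadjoint orbit. Give $G_n\cdot\lambda\subset\mathfrak g^*$ the structure of the homogeneous space $G_n/G_n^\lambda$ and $G\cdot\lambda=\varinjlim G_n\cdot\lambda$ the direct limit structure, with tangent spaces $T_\mu(G\cdot\lambda)=\varinjlim_l T_\mu(G_l\cdot\lambda)$. Let $p_n:G_n\cdot\lambda\to G_n\cdot\lambda_n\cong G_n/G_n^{\lambda_n}$ be the projection, let $\omega_n$ be the Kostant–Kirillov form on the coadjoint orbit $G_n\cdot\lambda_n\subset\mathfrak g_n^*$, $\omega_{n,m}(X+\mathfrak g_n^m,Y+\mathfrak g_n^m)=m([X,Y])$ for $m\in G_n\cdot\lambda_n$, and let $\omega_\infty=\varprojlim p_n^*\omega_n$ be the 2-form on $G\cdot\lambda$ whose pullback to each $G_n\cdot\lambda$ is $p_n^*\omega_n$. Then: 1. $G\cdot\lambda$ is an irreducible ind-variety (the $G_n\cdot\lambda$ are quasi-affine varieties, the inclusions $G_m\cdot\lambda\hookrightarrow G_n\cdot\lambda$, $m\le n$, are locally closed embeddings, and the direct limit topology is irreducible), and the natural inclusion $i:G\cdot\lambda\hookrightarrow\mathfrak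 g^*$ is an injective immersion into the provariety $\mathfrak g^*$: $i$ is an injective morphism and $(di)_\mu:T_\mu(G\cdot\lambda)\to T_\mu(\mathfrak g^*)$ is injective for all $\mu\in G\cdot\lambda$. 2. The orbit is tangent to the characteristic distribution: $(di)_\mu(T_\mu(G\cdot\lambda))=\mathfrak X(\mathfrak g^*)_\mu$ for all $\mu\in G\cdot\lambda$, in particular for $\mu=\lambda$. 3. The form $\omega_\infty$ exists and is unique. It is a weak symplectic form: alternating, closed (its pullback to every $G_n\cdot\lambda$ is a closed regular 2-form), and for every $\mu\in G\cdot\lambda$ the map $T_\mu(G\cdot\lambda)\to T_\mu(G\cdot\lambda)^*$, $Y\mapsto\omega_{\infty,\mu}(Y,\cdot)$, is injective and regular. It is consistent with the Poisson structure of $\mathfrak g^*$: for all $\mu\in G\cdot\lambda$ and $Y,Z\in T_\mu(G\cdot\lambda)$, $$\omega_{\infty,\mu}(Y,Z)=\pi_\mu\bigl([\tilde\pi_\mu]^{-1}(di)_\mu Y,\ [\tilde\pi_\mu]^{-1}(di)_\mu Z\bigr),$$ where $[\tilde\pi_\mu]:T^*_\mu(\mathfrak g^*)/\operatorname{Ker}\tilde\pi_\mu\to\mathfrak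 X(\mathfrak g^*)_\mu$ is the linear isomorphism induced by the anchor map and $\pi_\mu$ is regarded as a form on $T^*_\mu(\mathfrak g^*)/\operatorname{Ker}\tilde\pi_\mu$. Since $\lambda\in\mathfrak g^*$ is arbitrary, the coadjoint orbits form a weak symplectic foliation of $\mathfrak g^*$ tangent to its characteristic distribution. -/

import Mathlib

open Filter Topology Module

universe u v w

/-- A space with functions over `ℂ`: a topological space with a sheaf of `ℂ`-algebras of
`ℂ`-valued functions.  The sheaf is recorded through its germs: `IsRegAt x f` says that `f` is
regular on some neighbourhood of `x`; the sections over an open set `U` are the functions that are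
regular at every point of `U`. -/
structure SpaceWithFunctions (X : Type u) where
  top : TopologicalSpace X
  IsRegAt : X → (X → ℂ) → Prop
  congr_germ : ∀ (x : X) (f g : X → ℂ), (∀ᶠ y in @nhds X top x, f y = g y) →
    IsRegAt x f → IsRegAt x g
  regular_near : ∀ (x : X) (f : X → ℂ), IsRegAt x f → ∀ᶠ y in @nhds X top x, IsRegAt y f
  const_mem : ∀ (x : X) (c : ℂ), IsRegAt x (fun _ => c)
  add_mem : ∀ (x : X) (f g : X → ℂ), IsRegAt x f → IsRegAt x g → IsRegAt x (f + g)
  mul_mem : ∀ (x : X) (f g : X → ℂ), IsRegAt x f → IsRegAt x g → IsRegAt x (f * g)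

namespace SpaceWithFunctions

variable {X : Type u} {Y : Type v} {Z : Type w}

/-- The neighbourhood filter of a point. -/
def nbhd (S : SpaceWithFunctions X) (x : X) : Filter X := @nhds X S.top x

theorem self_of_nbhd (S : SpaceWithFunctions X) {x : X} {p : X → Prop}
    (h : ∀ᶠ y in S.nbhd x, p y) : p x :=
  @Filter.Eventually.self_of_nhds X S.top x p h

/-! ### Stalks, cotangent spaces and tangent spaces -/

/-- The functions that are regular near `x`. -/
def regFns (S : SpaceWithFunctions X) (x : X) : Subalgebra ℂ (X → ℂ) where
  carrier := {f | S.IsRegAt x f}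
  mul_mem' := fun {f g} hf hg => S.mul_mem x f g hf hg
  add_mem' := fun {f g} hf hg => S.add_mem x f g hf hg
  algebraMap_mem' := fun c => S.const_mem x c

/-- The functions that vanish near `x`. -/
def nullIdeal (S : SpaceWithFunctions X) (x : X) : Ideal (S.regFns x) where
  carrier := {f | ∀ᶠ y in S.nbhd x, f.1 y = 0}
  add_mem' := by
    intro f g hf hg
    filter_upwards [hf, hg] with y h1 h2
    simp [h1, h2]
  zero_mem' := by simp
  smul_mem' := by
    intro c f hf
    filter_upwards [hf] with y h1
    simp [h1]

/-- The stalk of the structure sheaf at `x`: germs of regular functions. -/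
def stalk (S : SpaceWithFunctions X) (x : X) : Type u := S.regFns x ⧸ S.nullIdeal x

instance (S : SpaceWithFunctions X) (x : X) : CommRing (S.stalk x) :=
  inferInstanceAs (CommRing (S.regFns x ⧸ S.nullIdeal x))

instance (S : SpaceWithFunctions X) (x : X) : Algebra ℂ (S.stalk x) :=
  inferInstanceAs (Algebra ℂ (S.regFns x ⧸ S.nullIdeal x))

/-- The germ at `x` of a function that is regular near `x`. -/
def germ (S : SpaceWithFunctions X) (x : X) : S.regFns x →ₐ[ℂ] S.stalk x :=
  Ideal.Quotient.mkₐ ℂ (S.nullIdeal x)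

theorem germ_surjective (S : SpaceWithFunctions X) (x : X) : Function.Surjective (S.germ x) :=
  Ideal.Quotient.mk_surjective

/-- The evaluation of germs at `x`. -/
def evalGerm (S : SpaceWithFunctions X) (x : X) : S.stalk x →ₐ[ℂ] ℂ :=
  Ideal.Quotient.liftₐ (S.nullIdeal x)
    ((Pi.evalAlgHom ℂ (fun _ : X => ℂ) x).comp (S.regFns x).val)
    (fun _ hf => S.self_of_nbhd hf)

/-- The ideal of germs that vanish at `x`; for a locally ringed space it is the maximal ideal of
the local ring at `x`. -/
def maxIdeal (S : SpaceWithFunctions X) (x : X) : Ideal (S.stalk x) :=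
  RingHom.ker (S.evalGerm x)

/-- The cotangent space `𝔪ₓ / 𝔪ₓ²`. -/
def Cotangent (S : SpaceWithFunctions X) (x : X) : Type u := (S.maxIdeal x).Cotangent

instance (S : SpaceWithFunctions X) (x : X) : AddCommGroup (S.Cotangent x) :=
  inferInstanceAs (AddCommGroup (S.maxIdeal x).Cotangent)

instance (S : SpaceWithFunctions X) (x : X) : Module ℂ (S.Cotangent x) :=
  inferInstanceAs (Module ℂ (S.maxIdeal x).Cotangent)

/-- The class in `𝔪ₓ / 𝔪ₓ²` of a germ that vanishes at `x`. -/
def toCotangent (S : SpaceWithFunctions X) (x : X) :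
    ((S.maxIdeal x).restrictScalars ℂ) →ₗ[ℂ] S.Cotangent x :=
  (S.maxIdeal x).toCotangent.restrictScalars ℂ

theorem toCotangent_surjective (S : SpaceWithFunctions X) (x : X) :
    Function.Surjective (S.toCotangent x) :=
  (S.maxIdeal x).toCotangent_surjective

/-- The Zariski tangent space `(𝔪ₓ / 𝔪ₓ²)*`. -/
abbrev Tangent (S : SpaceWithFunctions X) (x : X) : Type u := Dual ℂ (S.Cotangent x)

open Classical in
/-- The differential at `x` of a function that is regular at `x`, that is, the class of
`f - f x` (and `0` for other functions). -/
noncomputable def diff (S : SpaceWithFunctions X) (x : X) (f : X → ℂ) : S.Cotangent x :=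
  if h : S.IsRegAt x f then
    S.toCotangent x
      ⟨S.germ x ⟨f, h⟩ - algebraMap ℂ (S.stalk x) (f x), by
        change S.evalGerm x _ = 0
        rw [map_sub, AlgHom.commutes]
        exact sub_self (f x)⟩
  else 0

/-! ### Morphisms and their differentials -/

/-- Morphisms of spaces with functions: continuous maps that pull regular functions back to
regular functions (equivalently, morphisms of ringed spaces that are given by pulling functions
back; on stalks they are automatically local). -/
structure IsMorphism (S : SpaceWithFunctions X) (T : SpaceWithFunctions Y) (φ : X → Y) : Prop where
  continuous : @Continuous X Y S.top T.top φ
  pullback : ∀ (x : X) (g : Y → ℂ), T.IsRegAt (φ x) g → S.IsRegAt x (g ∘ φ)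

theorem IsMorphism.tendsto {S : SpaceWithFunctions X} {T : SpaceWithFunctions Y} {φ : X → Y}
    (hφ : IsMorphism S T φ) (x : X) : Tendsto φ (S.nbhd x) (T.nbhd (φ x)) :=
  @Continuous.tendsto X Y S.top T.top φ hφ.continuous x

theorem IsMorphism.comp {S : SpaceWithFunctions X} {T : SpaceWithFunctions Y}
    {R : SpaceWithFunctions Z} {ψ : Y → Z} {φ : X → Y} (hψ : IsMorphism T R ψ)
    (hφ : IsMorphism S T φ) : IsMorphism S R (ψ ∘ φ) :=
  ⟨@Continuous.comp X Y Z S.top T.top R.top φ ψ hψ.continuous hφ.continuous,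
    fun x g hg => hφ.pullback x (g ∘ ψ) (hψ.pullback (φ x) g hg)⟩

/-- Pulling back functions along a morphism. -/
def IsMorphism.regMap {S : SpaceWithFunctions X} {T : SpaceWithFunctions Y} {φ : X → Y}
    (hφ : IsMorphism S T φ) {x : X} {y : Y} (h : φ x = y) : T.regFns y →ₐ[ℂ] S.regFns x where
  toFun g := ⟨g.1 ∘ φ, hφ.pullback x g.1 (by rw [h]; exact g.2)⟩
  map_one' := rfl
  map_mul' _ _ := rfl
  map_zero' := rfl
  map_add' _ _ := rfl
  commutes' _ := rfl

/-- Pulling back germs along a morphism. -/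
def IsMorphism.stalkMap {S : SpaceWithFunctions X} {T : SpaceWithFunctions Y} {φ : X → Y}
    (hφ : IsMorphism S T φ) {x : X} {y : Y} (h : φ x = y) : T.stalk y →ₐ[ℂ] S.stalk x :=
  Ideal.quotientMapₐ (S.nullIdeal x) (hφ.regMap h) (by
    intro g hg
    have : Tendsto φ (S.nbhd x) (T.nbhd y) := h ▸ hφ.tendsto x
    exact this.eventually hg)

theorem IsMorphism.evalGerm_stalkMap {S : SpaceWithFunctions X} {T : SpaceWithFunctions Y}
    {φ : X → Y} (hφ : IsMorphism S T φ) {x : X} {y : Y} (h : φ x = y) (γ : T.stalk y) :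
    S.evalGerm x (hφ.stalkMap h γ) = T.evalGerm y γ := by
  obtain ⟨g, rfl⟩ := T.germ_surjective _ γ
  subst h
  rfl

/-- The codifferential of a morphism `φ` at a point `x` with `φ x = y`. -/
def IsMorphism.codiff {S : SpaceWithFunctions X} {T : SpaceWithFunctions Y} {φ : X → Y}
    (hφ : IsMorphism S T φ) {x : X} {y : Y} (h : φ x = y) : T.Cotangent y →ₗ[ℂ] S.Cotangent x :=
  Ideal.mapCotangent (T.maxIdeal y) (S.maxIdeal x) (hφ.stalkMap h) (by
    intro γ hγ
    have h1 : T.evalGerm y γ = 0 := hγ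
    change S.evalGerm x (hφ.stalkMap h γ) = 0
    rw [hφ.evalGerm_stalkMap h, h1])

/-- The differential `(dφ)ₓ : Tₓ X → T_y Y` of a morphism `φ`, where `y = φ x`. -/
def IsMorphism.differential {S : SpaceWithFunctions X} {T : SpaceWithFunctions Y} {φ : X → Y}
    (hφ : IsMorphism S T φ) {x : X} {y : Y} (h : φ x = y) : S.Tangent x →ₗ[ℂ] T.Tangent y :=
  (hφ.codiff h).dualMap

theorem IsMorphism.differential_comp {S : SpaceWithFunctions X} {T : SpaceWithFunctions Y}
    {R : SpaceWithFunctions Z} {ψ : Y → Z} {φ : X → Y} {χ : X → Z} (hψ : IsMorphism T R ψ)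
    (hφ : IsMorphism S T φ) (hχ : IsMorphism S R χ) (e : ψ ∘ φ = χ) {x : X} {y : Y} {z : Z}
    (h : φ x = y) (h' : ψ y = z) (h'' : χ x = z) (ξ : S.Tangent x) :
    hψ.differential h' (hφ.differential h ξ) = hχ.differential h'' ξ := by
  subst e
  apply LinearMap.ext
  intro c
  obtain ⟨⟨γ, hγ⟩, rfl⟩ := R.toCotangent_surjective _ c
  obtain ⟨g, rfl⟩ := R.germ_surjective _ γ
  rfl

/-- A functional on germs that satisfies the Leibniz rule at `x` defines a tangent vector. -/
noncomputable def tangentOfDer (S : SpaceWithFunctions X) (x : X) (δ : S.stalk x →ₗ[ℂ] ℂ)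
    (hδ : ∀ a b, δ (a * b) = S.evalGerm x a * δ b + S.evalGerm x b * δ a) : S.Tangent x :=
  (LinearMap.ker (S.toCotangent x)).liftQ (δ ∘ₗ ((S.maxIdeal x).restrictScalars ℂ).subtype) (by
      intro γ hγ
      have h1 : (γ : S.stalk x) ∈ S.maxIdeal x ^ 2 := (Ideal.toCotangent_eq_zero _ γ).1 hγ
      change δ γ = 0
      rw [pow_two] at h1
      refine Submodule.mul_induction_on h1 (fun a ha b hb => ?_) (fun a b ha hb => ?_)
      · have ha' : S.evalGerm x a = 0 := ha
        have hb' : S.evalGerm x b = 0 := hb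
        rw [hδ, ha', hb']; ring
      · rw [map_add, ha, hb, add_zero]) ∘ₗ
    ((S.toCotangent x).quotKerEquivOfSurjective (S.toCotangent_surjective x)).symm.toLinearMap

theorem tangentOfDer_toCotangent (S : SpaceWithFunctions X) (x : X) (δ : S.stalk x →ₗ[ℂ] ℂ)
    (hδ : ∀ a b, δ (a * b) = S.evalGerm x a * δ b + S.evalGerm x b * δ a)
    (γ : (S.maxIdeal x).restrictScalars ℂ) :
    S.tangentOfDer x δ hδ (S.toCotangent x γ) = δ γ := by
  have : ((S.toCotangent x).quotKerEquivOfSurjective (S.toCotangent_surjective x)).symm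
      (S.toCotangent x γ) = (LinearMap.ker (S.toCotangent x)).mkQ γ := by
    rw [LinearEquiv.symm_apply_eq]; rfl
  unfold tangentOfDer
  simp only [LinearMap.comp_apply, LinearEquiv.coe_coe, this]
  rfl

/-! ### Final and initial structures -/

/-- The final structure for a family of maps `φ i : Z i → Y`: the final topology, and a function
is regular on an open set iff all its pullbacks are. -/
def coinduced {ι : Type*} {W : ι → Type*} (S : ∀ i, SpaceWithFunctions (W i))
    (φ : ∀ i, W i → Y) : SpaceWithFunctions Y where
  top := ⨆ i, TopologicalSpace.coinduced (φ i) (S i).top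
  IsRegAt y g := ∀ᶠ y' in @nhds Y (⨆ i, TopologicalSpace.coinduced (φ i) (S i).top) y,
    ∀ i z, φ i z = y' → (S i).IsRegAt z (g ∘ φ i)
  congr_germ := by
    intro y f g hfg hf
    let _ : TopologicalSpace Y := ⨆ i, TopologicalSpace.coinduced (φ i) (S i).top
    have h2 := eventually_eventually_nhds.2 hfg
    filter_upwards [h2, hf] with y' h3 h4 i z hz
    refine (S i).congr_germ z _ _ ?_ (h4 i z hz)
    have hc : @Continuous _ _ (S i).top _ (φ i) :=
      continuous_iff_coinduced_le.2 (le_iSup (fun i => TopologicalSpace.coinduced (φ i) (S i).top) i)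
    have := @Continuous.tendsto _ _ (S i).top _ (φ i) hc z
    rw [hz] at this
    exact this.eventually h3
  regular_near := by
    intro y f hf
    let _ : TopologicalSpace Y := ⨆ i, TopologicalSpace.coinduced (φ i) (S i).top
    exact eventually_eventually_nhds.2 hf
  const_mem := fun y c => Filter.Eventually.of_forall fun _ i z _ => (S i).const_mem z c
  add_mem := by
    intro y f g hf hg
    filter_upwards [hf, hg] with y' h1 h2 i z hz
    exact (S i).add_mem z _ _ (h1 i z hz) (h2 i z hz)
  mul_mem := by
    intro y f g hf hg
    filter_upwards [hf, hg] with y' h1 h2 i z hz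
    exact (S i).mul_mem z _ _ (h1 i z hz) (h2 i z hz)

theorem isMorphism_coinduced {ι : Type*} {W : ι → Type*} (S : ∀ i, SpaceWithFunctions (W i))
    (φ : ∀ i, W i → Y) (i : ι) : IsMorphism (S i) (coinduced S φ) (φ i) :=
  ⟨continuous_iff_coinduced_le.2 (le_iSup (fun i => TopologicalSpace.coinduced (φ i) (S i).top) i),
    fun z _ hg => (coinduced S φ).self_of_nbhd hg i z rfl⟩

theorem isMorphism_of_coinduced {ι : Type*} {W : ι → Type*} (S : ∀ i, SpaceWithFunctions (W i))
    (φ : ∀ i, W i → Y) (T : SpaceWithFunctions Z) (ψ : Y → Z)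
    (h : ∀ i, IsMorphism (S i) T (ψ ∘ φ i)) : IsMorphism (coinduced S φ) T ψ := by
  have hc : @Continuous Y Z (coinduced S φ).top T.top ψ := by
    refine continuous_iSup_dom.2 fun i => ?_
    exact continuous_coinduced_dom.2 (h i).continuous
  refine ⟨hc, fun y g hg => ?_⟩
  have h1 : ∀ᶠ y' in (coinduced S φ).nbhd y, T.IsRegAt (ψ y') g :=
    (@Continuous.tendsto _ _ (coinduced S φ).top T.top ψ hc y).eventually (T.regular_near _ g hg)
  change ∀ᶠ y' in (coinduced S φ).nbhd y, ∀ i z, φ i z = y' → (S i).IsRegAt z ((g ∘ ψ) ∘ φ i)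
  filter_upwards [h1] with y' h2 i z hz
  subst hz
  exact (h i).pullback z g h2

/-- The inverse limit structure on `X`, for maps `p n : X → W n` to an inverse system with
transition morphisms `q`: the inverse limit topology, and the regular functions
are locally pulled back from regular functions on some `W n`. -/
def proLimit {W : ℕ → Type v} (S : ∀ n, SpaceWithFunctions (W n)) (p : ∀ n, X → W n)
    (q : ∀ m n, m ≤ n → W n → W m) (hq : ∀ m n h, IsMorphism (S n) (S m) (q m n h))
    (hp : ∀ m n h, q m n h ∘ p n = p m) : SpaceWithFunctions X where
  top := ⨅ n, TopologicalSpace.induced (p n) (S n).top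
  IsRegAt x f := ∃ (n : ℕ) (g : W n → ℂ), (S n).IsRegAt (p n x) g ∧
    ∀ᶠ y in @nhds X (⨅ n, TopologicalSpace.induced (p n) (S n).top) x, f y = g (p n y)
  congr_germ := by
    rintro x f f' hff ⟨n, g, hg, hf⟩
    refine ⟨n, g, hg, ?_⟩
    filter_upwards [hff, hf] with y h1 h2
    rw [← h1, h2]
  regular_near := by
    rintro x f ⟨n, g, hg, hf⟩
    let _ : TopologicalSpace X := ⨅ n, TopologicalSpace.induced (p n) (S n).top
    have hc : @Continuous _ _ _ (S n).top (p n) :=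
      continuous_iff_le_induced.2 (iInf_le (fun n => TopologicalSpace.induced (p n) (S n).top) n)
    have h1 := (@Continuous.tendsto _ _ _ (S n).top (p n) hc x).eventually
      ((S n).regular_near _ g hg)
    filter_upwards [h1, eventually_eventually_nhds.2 hf] with y h2 h3
    exact ⟨n, g, h2, h3⟩
  const_mem := fun x c => ⟨0, fun _ => c, (S 0).const_mem _ c, Filter.Eventually.of_forall fun _ => rfl⟩
  add_mem := by
    rintro x f f' ⟨m, g, hg, hf⟩ ⟨n, g', hg', hf'⟩
    refine ⟨max m n, g ∘ q m _ (le_max_left m n) + g' ∘ q n _ (le_max_right m n), ?_, ?_⟩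
    · refine (S _).add_mem _ _ _ ?_ ?_
      · exact (hq m _ _).pullback _ g (by rw [← hp m _ (le_max_left m n)] at hg; exact hg)
      · exact (hq n _ _).pullback _ g' (by rw [← hp n _ (le_max_right m n)] at hg'; exact hg')
    · filter_upwards [hf, hf'] with y h1 h2
      have e1 := congrFun (hp m _ (le_max_left m n)) y
      have e2 := congrFun (hp n _ (le_max_right m n)) y
      simp only [Function.comp_apply] at e1 e2
      simp [h1, h2, e1, e2]
  mul_mem := by
    rintro x f f' ⟨m, g, hg, hf⟩ ⟨n, g', hg', hf'⟩
    refine ⟨max m n, (g ∘ q m _ (le_max_left m n)) * (g' ∘ q n _ (le_max_right m n)), ?_, ?_⟩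
    · refine (S _).mul_mem _ _ _ ?_ ?_
      · exact (hq m _ _).pullback _ g (by rw [← hp m _ (le_max_left m n)] at hg; exact hg)
      · exact (hq n _ _).pullback _ g' (by rw [← hp n _ (le_max_right m n)] at hg'; exact hg')
    · filter_upwards [hf, hf'] with y h1 h2
      have e1 := congrFun (hp m _ (le_max_left m n)) y
      have e2 := congrFun (hp n _ (le_max_right m n)) y
      simp only [Function.comp_apply] at e1 e2
      simp [h1, h2, e1, e2]

theorem isMorphism_proLimit {W : ℕ → Type v} (S : ∀ n, SpaceWithFunctions (W n))
    (p : ∀ n, X → W n) (q : ∀ m n, m ≤ n → W n → W m)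
    (hq : ∀ m n h, IsMorphism (S n) (S m) (q m n h)) (hp : ∀ m n h, q m n h ∘ p n = p m)
    (T : SpaceWithFunctions Z) (ψ : Z → X) (h : ∀ n, IsMorphism T (S n) (p n ∘ ψ)) :
    IsMorphism T (proLimit S p q hq hp) ψ := by
  have hc : @Continuous Z X T.top (proLimit S p q hq hp).top ψ :=
    continuous_iInf_rng.2 fun n => continuous_induced_rng.2 (h n).continuous
  refine ⟨hc, ?_⟩
  rintro z f ⟨n, g, hg, hf⟩
  refine T.congr_germ z (g ∘ (p n ∘ ψ)) _ ?_ ((h n).pullback z g hg)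
  have := (@Continuous.tendsto _ _ T.top (proLimit S p q hq hp).top ψ hc z).eventually hf
  filter_upwards [this] with y hy
  exact hy.symm

/-! ### Affine structures -/

/-- The structure on `X` defined by an algebra `A` of functions: the topology has the sets
`{a ≠ 0}`, `a ∈ A`, as a basis (for the coordinate ring of an affine variety it is the Zariski
topology), and the regular functions are locally quotients of elements of `A`. -/
def affine (A : Subalgebra ℂ (X → ℂ)) : SpaceWithFunctions X where
  top := TopologicalSpace.generateFrom {U | ∃ a ∈ A, U = {x | a x ≠ 0}}
  IsRegAt x f := ∃ a ∈ A, ∃ b ∈ A, b x ≠ 0 ∧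
    ∀ᶠ y in @nhds X (TopologicalSpace.generateFrom {U | ∃ a ∈ A, U = {x | a x ≠ 0}}) x,
      f y = a y / b y
  congr_germ := by
    rintro x f g hfg ⟨a, ha, b, hb, hx, h⟩
    refine ⟨a, ha, b, hb, hx, ?_⟩
    filter_upwards [hfg, h] with y h1 h2
    rw [← h1, h2]
  regular_near := by
    rintro x f ⟨a, ha, b, hb, hx, h⟩
    let _ : TopologicalSpace X := TopologicalSpace.generateFrom {U | ∃ a ∈ A, U = {x | a x ≠ 0}}
    have hU : IsOpen {x | b x ≠ 0} := TopologicalSpace.isOpen_generateFrom_of_mem ⟨b, hb, rfl⟩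
    filter_upwards [hU.mem_nhds hx, eventually_eventually_nhds.2 h] with y h1 h2
    exact ⟨a, ha, b, hb, h1, h2⟩
  const_mem := fun x c => ⟨fun _ => c, A.algebraMap_mem c, 1, A.one_mem, by simp,
    Filter.Eventually.of_forall fun y => by simp⟩
  add_mem := by
    rintro x f g ⟨a, ha, b, hb, hx, h⟩ ⟨a', ha', b', hb', hx', h'⟩
    let _ : TopologicalSpace X := TopologicalSpace.generateFrom {U | ∃ a ∈ A, U = {x | a x ≠ 0}}
    have hU : IsOpen {x | b x ≠ 0} := TopologicalSpace.isOpen_generateFrom_of_mem ⟨b, hb, rfl⟩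
    have hU' : IsOpen {x | b' x ≠ 0} := TopologicalSpace.isOpen_generateFrom_of_mem ⟨b', hb', rfl⟩
    refine ⟨a * b' + b * a', A.add_mem (A.mul_mem ha hb') (A.mul_mem hb ha'), b * b',
      A.mul_mem hb hb', mul_ne_zero hx hx', ?_⟩
    filter_upwards [h, h', hU.mem_nhds hx, hU'.mem_nhds hx'] with y h1 h2 h3 h4
    have h3 : b y ≠ 0 := h3
    have h4 : b' y ≠ 0 := h4
    simp only [Pi.add_apply, Pi.mul_apply, h1, h2]
    field_simp
  mul_mem := by
    rintro x f g ⟨a, ha, b, hb, hx, h⟩ ⟨a', ha', b', hb', hx', h'⟩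
    refine ⟨a * a', A.mul_mem ha ha', b * b', A.mul_mem hb hb', mul_ne_zero hx hx', ?_⟩
    filter_upwards [h, h'] with y h1 h2
    simp only [Pi.mul_apply, h1, h2]
    rw [div_mul_div_comm]

theorem affine_isOpen (A : Subalgebra ℂ (X → ℂ)) {a : X → ℂ} (ha : a ∈ A) :
    @IsOpen X (affine A).top {x | a x ≠ 0} :=
  TopologicalSpace.isOpen_generateFrom_of_mem ⟨a, ha, rfl⟩

theorem affine_ne_zero (A : Subalgebra ℂ (X → ℂ)) {a : X → ℂ} (ha : a ∈ A) {x : X}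
    (hx : a x ≠ 0) : ∀ᶠ y in (affine A).nbhd x, a y ≠ 0 :=
  let _ : TopologicalSpace X := (affine A).top
  (affine_isOpen A ha).mem_nhds hx

/-- The sets `{a ≠ 0}` form a basis of the topology of `affine A`. -/
theorem affine_basis (A : Subalgebra ℂ (X → ℂ)) (x : X) {p : X → Prop}
    (h : ∀ᶠ y in (affine A).nbhd x, p y) : ∃ a ∈ A, a x ≠ 0 ∧ ∀ y, a y ≠ 0 → p y := by
  have h1 : {y | p y} ∈ @nhds X
      (TopologicalSpace.generateFrom {U | ∃ a ∈ A, U = {x | a x ≠ 0}}) x := h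
  rw [TopologicalSpace.nhds_generateFrom] at h1
  have key : ∀ s ∈ ⨅ s ∈ {s | x ∈ s ∧ s ∈ {U | ∃ a ∈ A, U = {x | a x ≠ 0}}}, 𝓟 s,
      ∃ a ∈ A, a x ≠ 0 ∧ ∀ y, a y ≠ 0 → y ∈ s := by
    intro s hs
    rw [Filter.mem_biInf_of_directed] at hs
    · obtain ⟨U, ⟨hxU, a, ha, rfl⟩, hU⟩ := hs
      exact ⟨a, ha, hxU, fun y hy => hU hy⟩
    · rintro U ⟨hxU, a, ha, rfl⟩ V ⟨hxV, b, hb, rfl⟩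
      refine ⟨{x | (a * b) x ≠ 0}, ⟨mul_ne_zero hxU hxV, a * b, A.mul_mem ha hb, rfl⟩, ?_, ?_⟩
      · exact principal_mono.2 fun y hy => left_ne_zero_of_mul hy
      · exact principal_mono.2 fun y hy => right_ne_zero_of_mul hy
    · exact ⟨Set.univ, trivial, 1, A.one_mem, by simp⟩
  exact key _ h1

theorem affine_isRegAt (A : Subalgebra ℂ (X → ℂ)) {a : X → ℂ} (ha : a ∈ A) (x : X) :
    (affine A).IsRegAt x a :=
  ⟨a, ha, 1, A.one_mem, by simp, Filter.Eventually.of_forall fun y => by simp⟩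

theorem affine_isRegAt_of_eventually (A : Subalgebra ℂ (X → ℂ)) {a b f : X → ℂ} (ha : a ∈ A)
    (hb : b ∈ A) {x : X} (hx : b x ≠ 0) (h : ∀ᶠ y in (affine A).nbhd x, f y = a y / b y) :
    (affine A).IsRegAt x f :=
  ⟨a, ha, b, hb, hx, h⟩

/-- A map to an affine structure is a morphism as soon as it pulls the elements of the
coordinate algebra back to elements of the coordinate algebra. -/
theorem isMorphism_affine (A : Subalgebra ℂ (X → ℂ)) (B : Subalgebra ℂ (Y → ℂ)) (φ : X → Y)
    (h : ∀ b ∈ B, b ∘ φ ∈ A) : IsMorphism (affine A) (affine B) φ := by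
  have hc : @Continuous X Y (affine A).top (affine B).top φ := by
    refine continuous_generateFrom_iff.2 ?_
    rintro U ⟨b, hb, rfl⟩
    exact affine_isOpen A (h b hb)
  refine ⟨hc, ?_⟩
  rintro x g ⟨a, ha, b, hb, hx, hg⟩
  exact ⟨a ∘ φ, h a ha, b ∘ φ, h b hb, hx,
    (@Continuous.tendsto _ _ (affine A).top (affine B).top φ hc x).eventually hg⟩

/-! ### Tangent vectors of affine structures from point derivations -/

/-- The point derivations at `x` of an algebra `A` of functions. -/
def pointDer (A : Subalgebra ℂ (X → ℂ)) (x : X) : Submodule ℂ (A →ₗ[ℂ] ℂ) where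
  carrier := {D | ∀ a b : A, D (a * b) = a.1 x * D b + b.1 x * D a}
  add_mem' := by
    intro D E hD hE a b
    simp only [LinearMap.add_apply, hD a b, hE a b]; ring
  zero_mem' := by intro a b; simp
  smul_mem' := by
    intro c D hD a b
    simp only [LinearMap.smul_apply, hD a b, smul_eq_mul]; ring

theorem pointDer_quotient_unique {A : Subalgebra ℂ (X → ℂ)} {x : X} (D : pointDer A x)
    (a b a' b' : A) (hb : b.1 x ≠ 0) (hb' : b'.1 x ≠ 0)
    (h : ∀ᶠ y in (affine A).nbhd x, a.1 y / b.1 y = a'.1 y / b'.1 y) :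
    (D.1 a * b.1 x - a.1 x * D.1 b) / b.1 x ^ 2 =
      (D.1 a' * b'.1 x - a'.1 x * D.1 b') / b'.1 x ^ 2 := by
  have h0 := (affine A).self_of_nbhd h
  obtain ⟨c, hc, hcx, hcy⟩ := affine_basis A x
    ((h.and (affine_ne_zero A b.2 hb)).and (affine_ne_zero A b'.2 hb'))
  have hz : (⟨c, hc⟩ : A) * (a * b' - a' * b) = 0 := by
    apply Subtype.ext
    funext y
    by_cases hy : c y = 0
    · simp [hy]
    · obtain ⟨⟨h1, h2⟩, h3⟩ := hcy y hy
      rw [div_eq_div_iff h2 h3] at h1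
      simp [h1]
  have e0 : a.1 x * b'.1 x = a'.1 x * b.1 x := by rwa [div_eq_div_iff hb hb'] at h0
  have h1 := D.2 ⟨c, hc⟩ (a * b' - a' * b)
  rw [hz, map_zero, map_sub, D.2 a b', D.2 a' b] at h1
  have e1 : ((a * b' - a' * b : A) : X → ℂ) x = 0 := by
    simp [e0]
  rw [e1, zero_mul, add_zero] at h1
  have h2 := (mul_eq_zero.1 h1.symm).resolve_left hcx
  have hb2 : b.1 x ≠ 0 := hb
  rw [div_eq_div_iff (pow_ne_zero 2 hb) (pow_ne_zero 2 hb')]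
  generalize D.1 a = p at *
  generalize D.1 b = q at *
  generalize D.1 a' = p' at *
  generalize D.1 b' = q' at *
  generalize a.1 x = α at *
  generalize b.1 x = β at *
  generalize a'.1 x = α' at *
  generalize b'.1 x = β' at *
  linear_combination (β * β') * h2 + (-(q' * β) - q * β') * e0

/-- The value of a point derivation on a function that is regular at `x`, by the quotient rule. -/
noncomputable def derVal {A : Subalgebra ℂ (X → ℂ)} {x : X} (D : pointDer A x)
    (f : (affine A).regFns x) : ℂ :=
  let a : A := ⟨f.2.choose, f.2.choose_spec.1⟩
  let b : A := ⟨f.2.choose_spec.2.choose, f.2.choose_spec.2.choose_spec.1⟩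
  (D.1 a * b.1 x - a.1 x * D.1 b) / b.1 x ^ 2

theorem derVal_eq {A : Subalgebra ℂ (X → ℂ)} {x : X} (D : pointDer A x)
    (f : (affine A).regFns x) (a b : A) (hb : b.1 x ≠ 0)
    (h : ∀ᶠ y in (affine A).nbhd x, f.1 y = a.1 y / b.1 y) :
    derVal D f = (D.1 a * b.1 x - a.1 x * D.1 b) / b.1 x ^ 2 := by
  refine pointDer_quotient_unique D _ _ a b ?_ hb ?_
  · exact f.2.choose_spec.2.choose_spec.2.1
  · filter_upwards [h, f.2.choose_spec.2.choose_spec.2.2] with y h1 h2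
    rw [← h1, ← h2]

theorem exists_quotient {A : Subalgebra ℂ (X → ℂ)} {x : X} (f : (affine A).regFns x) :
    ∃ a b : A, b.1 x ≠ 0 ∧ ∀ᶠ y in (affine A).nbhd x, f.1 y = a.1 y / b.1 y := by
  obtain ⟨a, ha, b, hb, h1, h2⟩ := f.2
  exact ⟨⟨a, ha⟩, ⟨b, hb⟩, h1, h2⟩

theorem derVal_add {A : Subalgebra ℂ (X → ℂ)} {x : X} (D : pointDer A x)
    (f g : (affine A).regFns x) : derVal D (f + g) = derVal D f + derVal D g := by
  obtain ⟨a, b, hb, h⟩ := exists_quotient f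
  obtain ⟨a', b', hb', h'⟩ := exists_quotient g
  rw [derVal_eq D f a b hb h, derVal_eq D g a' b' hb' h',
    derVal_eq D (f + g) (a * b' + b * a') (b * b') (mul_ne_zero hb hb') ?_]
  · rw [map_add, D.2 a b', D.2 b a', D.2 b b']
    simp only [MulMemClass.coe_mul, AddMemClass.coe_add, Pi.mul_apply, Pi.add_apply]
    field_simp
    ring
  · filter_upwards [h, h', affine_ne_zero A b.2 hb, affine_ne_zero A b'.2 hb'] with y h1 h2 h3 h4
    simp only [MulMemClass.coe_mul, AddMemClass.coe_add, Pi.mul_apply, Pi.add_apply, h1, h2]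
    field_simp

theorem derVal_mul {A : Subalgebra ℂ (X → ℂ)} {x : X} (D : pointDer A x)
    (f g : (affine A).regFns x) :
    derVal D (f * g) = f.1 x * derVal D g + g.1 x * derVal D f := by
  obtain ⟨a, b, hb, h⟩ := exists_quotient f
  obtain ⟨a', b', hb', h'⟩ := exists_quotient g
  rw [derVal_eq D f a b hb h, derVal_eq D g a' b' hb' h',
    derVal_eq D (f * g) (a * a') (b * b') (mul_ne_zero hb hb') ?_,
    (affine A).self_of_nbhd h, (affine A).self_of_nbhd h']
  · rw [D.2 a a', D.2 b b']
    simp only [MulMemClass.coe_mul, Pi.mul_apply]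
    field_simp
    ring
  · filter_upwards [h, h'] with y h1 h2
    simp only [MulMemClass.coe_mul, Pi.mul_apply, h1, h2, div_mul_div_comm]

theorem derVal_const_mul {A : Subalgebra ℂ (X → ℂ)} {x : X} (D : pointDer A x) (c : ℂ)
    (f : (affine A).regFns x) : derVal D (c • f) = c * derVal D f := by
  obtain ⟨a, b, hb, h⟩ := exists_quotient f
  rw [derVal_eq D f a b hb h, derVal_eq D (c • f) (c • a) b hb ?_]
  · simp only [map_smul, SetLike.val_smul, Pi.smul_apply, smul_eq_mul]
    field_simp
  · filter_upwards [h] with y h1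
    simp only [SetLike.val_smul, Pi.smul_apply, h1, smul_eq_mul]
    ring

theorem derVal_null {A : Subalgebra ℂ (X → ℂ)} {x : X} (D : pointDer A x)
    (f : (affine A).regFns x) (hf : f ∈ (affine A).nullIdeal x) : derVal D f = 0 := by
  have hf' : ∀ᶠ y in (affine A).nbhd x, f.1 y = 0 := hf
  rw [derVal_eq D f 0 1 (by simp) (by filter_upwards [hf'] with y hy; simp [hy])]
  simp

/-- A point derivation at `x` of the coordinate algebra as a functional on germs. -/
noncomputable def derGerm {A : Subalgebra ℂ (X → ℂ)} {x : X} (D : pointDer A x) :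
    (affine A).stalk x →ₗ[ℂ] ℂ :=
  (LinearMap.ker ((affine A).germ x).toLinearMap).liftQ
    { toFun := derVal D
      map_add' := derVal_add D
      map_smul' := derVal_const_mul D }
    (fun f hf => derVal_null D f (Ideal.Quotient.eq_zero_iff_mem.1 hf)) ∘ₗ
  (((affine A).germ x).toLinearMap.quotKerEquivOfSurjective
    ((affine A).germ_surjective x)).symm.toLinearMap

theorem derGerm_mk {A : Subalgebra ℂ (X → ℂ)} {x : X} (D : pointDer A x)
    (f : (affine A).regFns x) : derGerm D ((affine A).germ x f) = derVal D f := by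
  have : (((affine A).germ x).toLinearMap.quotKerEquivOfSurjective
      ((affine A).germ_surjective x)).symm ((affine A).germ x f) =
        (LinearMap.ker ((affine A).germ x).toLinearMap).mkQ f := by
    rw [LinearEquiv.symm_apply_eq]; rfl
  unfold derGerm
  simp only [LinearMap.comp_apply, LinearEquiv.coe_coe, this]
  rfl

theorem derGerm_mul {A : Subalgebra ℂ (X → ℂ)} {x : X} (D : pointDer A x)
    (γ γ' : (affine A).stalk x) : derGerm D (γ * γ') =
      (affine A).evalGerm x γ * derGerm D γ' + (affine A).evalGerm x γ' * derGerm D γ := by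
  obtain ⟨f, rfl⟩ := (affine A).germ_surjective x γ
  obtain ⟨g, rfl⟩ := (affine A).germ_surjective x γ'
  rw [← map_mul, derGerm_mk, derGerm_mk, derGerm_mk, derVal_mul]
  rfl

/-- The tangent vector of `affine A` at `x` that corresponds to a point derivation of `A`: the
functional on `𝔪ₓ / 𝔪ₓ²` given by the quotient rule. -/
noncomputable def tangentOfPointDer (A : Subalgebra ℂ (X → ℂ)) (x : X) :
    pointDer A x →ₗ[ℂ] (affine A).Tangent x where
  toFun D := (affine A).tangentOfDer x (derGerm D) (derGerm_mul D)
  map_add' := by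
    intro D E
    apply LinearMap.ext
    intro c
    obtain ⟨⟨γ, hγ⟩, rfl⟩ := (affine A).toCotangent_surjective x c
    obtain ⟨f, rfl⟩ := (affine A).germ_surjective x γ
    rw [LinearMap.add_apply, tangentOfDer_toCotangent, tangentOfDer_toCotangent,
      tangentOfDer_toCotangent, derGerm_mk, derGerm_mk, derGerm_mk]
    obtain ⟨a, b, hb, h⟩ := exists_quotient f
    rw [derVal_eq _ f a b hb h, derVal_eq _ f a b hb h, derVal_eq _ f a b hb h]
    simp only [Submodule.coe_add, LinearMap.add_apply]
    ring
  map_smul' := by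
    intro t D
    apply LinearMap.ext
    intro c
    obtain ⟨⟨γ, hγ⟩, rfl⟩ := (affine A).toCotangent_surjective x c
    obtain ⟨f, rfl⟩ := (affine A).germ_surjective x γ
    rw [LinearMap.smul_apply, tangentOfDer_toCotangent, tangentOfDer_toCotangent,
      derGerm_mk, derGerm_mk]
    obtain ⟨a, b, hb, h⟩ := exists_quotient f
    rw [derVal_eq _ f a b hb h, derVal_eq _ f a b hb h]
    simp only [Submodule.coe_smul, LinearMap.smul_apply, smul_eq_mul, RingHom.id_apply]
    ring

end SpaceWithFunctions

/-! ## Affine algebraic groups and their Lie algebras -/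

/-- A (complex) affine algebraic group: a group `G` together with its coordinate ring, a finitely
generated algebra `coord` of `ℂ`-valued functions on `G` such that the points of `G` are exactly
the algebra homomorphisms `coord → ℂ`, and such that multiplication and inversion are morphisms
of affine varieties. -/
class AffineAlgGroup (G : Type u) [Group G] where
  coord : Subalgebra ℂ (G → ℂ)
  fg : coord.FG
  points : ∀ χ : coord →ₐ[ℂ] ℂ, ∃! x : G, ∀ f : coord, χ f = f.1 x
  mul_coord : ∀ f ∈ coord, ∃ (k : ℕ) (a b : Fin k → coord),
    ∀ x y : G, f (x * y) = ∑ i, (a i).1 x * (b i).1 y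
  inv_coord : ∀ f ∈ coord, (fun x => f x⁻¹) ∈ coord

/-- The underlying variety of an affine algebraic group, with the Zariski topology. -/
def groupVariety (G : Type u) [Group G] [AffineAlgGroup G] : SpaceWithFunctions G :=
  SpaceWithFunctions.affine (AffineAlgGroup.coord (G := G))

/-- A homomorphic embedding of affine algebraic groups: a homomorphism that is a closed embedding
of varieties, i.e. pulling back functions defines a surjection of coordinate rings. -/
structure IsAlgGroupEmbedding {G : Type u} {H : Type v} [Group G] [AffineAlgGroup G] [Group H]
    [AffineAlgGroup H] (φ : G →* H) : Prop where
  pullback : ∀ f ∈ AffineAlgGroup.coord (G := H), f ∘ φ ∈ AffineAlgGroup.coord (G := G)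
  surjective : ∀ g ∈ AffineAlgGroup.coord (G := G),
    ∃ f ∈ AffineAlgGroup.coord (G := H), f ∘ φ = g

namespace AffineAlgGroup

variable {G : Type u} [Group G] [AffineAlgGroup G] {H : Type v} [Group H] [AffineAlgGroup H]
  {K : Type w} [Group K] [AffineAlgGroup K]

theorem left_mem {f : G → ℂ} (hf : f ∈ coord (G := G)) (x : G) :
    (fun y => f (x * y)) ∈ coord (G := G) := by
  obtain ⟨k, a, b, h⟩ := mul_coord f hf
  have : (fun y => f (x * y)) = ∑ i, (a i).1 x • (b i).1 := by
    funext y; simp [h]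
  rw [this]
  exact Subalgebra.sum_mem _ fun i _ => Subalgebra.smul_mem _ (b i).2 _

theorem right_mem {f : G → ℂ} (hf : f ∈ coord (G := G)) (y : G) :
    (fun x => f (x * y)) ∈ coord (G := G) := by
  obtain ⟨k, a, b, h⟩ := mul_coord f hf
  have : (fun x => f (x * y)) = ∑ i, (b i).1 y • (a i).1 := by
    funext x; simp [h, mul_comm]
  rw [this]
  exact Subalgebra.sum_mem _ fun i _ => Subalgebra.smul_mem _ (a i).2 _

/-- Left translation of functions: `(leftTr x f) y = f (x * y)`. -/
def leftTr (x : G) : coord (G := G) →ₐ[ℂ] coord (G := G) where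
  toFun f := ⟨fun y => f.1 (x * y), left_mem f.2 x⟩
  map_one' := rfl
  map_mul' _ _ := rfl
  map_zero' := rfl
  map_add' _ _ := rfl
  commutes' _ := rfl

theorem leftTr_apply (x : G) (f : coord (G := G)) (y : G) : (leftTr x f).1 y = f.1 (x * y) := rfl

/-- The left-invariant vector field `f ↦ (x ↦ D (y ↦ f (x * y)))` defined by a functional `D` on
the coordinate ring. -/
def leftInv (D : coord (G := G) →ₗ[ℂ] ℂ) : coord (G := G) →ₗ[ℂ] coord (G := G) where
  toFun f := ⟨fun x => D (leftTr x f), by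
    obtain ⟨k, a, b, h⟩ := mul_coord f.1 f.2
    have : (fun x => D (leftTr x f)) = ∑ i, D (b i) • (a i).1 := by
      funext x
      have h1 : leftTr x f = ∑ i, (a i).1 x • b i := by
        apply Subtype.ext
        funext y
        simp [leftTr_apply, h]
      rw [h1, map_sum]
      simp [mul_comm]
    rw [this]
    exact Subalgebra.sum_mem _ fun i _ => Subalgebra.smul_mem _ (a i).2 _⟩
  map_add' f g := by
    apply Subtype.ext; funext x
    simp only [map_add]; rfl
  map_smul' c f := by
    apply Subtype.ext; funext x
    simp only [map_smul]; rfl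

theorem leftInv_apply (D : coord (G := G) →ₗ[ℂ] ℂ) (f : coord (G := G)) (x : G) :
    (leftInv D f).1 x = D (leftTr x f) := rfl

theorem leftTr_one (f : coord (G := G)) : leftTr 1 f = f := by
  apply Subtype.ext; funext y; simp [leftTr_apply]

theorem leftTr_leftInv (D : coord (G := G) →ₗ[ℂ] ℂ) (x : G) (f : coord (G := G)) :
    leftTr x (leftInv D f) = leftInv D (leftTr x f) := by
  apply Subtype.ext; funext y
  have : leftTr (x * y) f = leftTr y (leftTr x f) := by
    apply Subtype.ext; funext z; simp [leftTr_apply, mul_assoc]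
  change D (leftTr (x * y) f) = D (leftTr y (leftTr x f))
  rw [this]

variable (G) in
/-- The Lie algebra of an affine algebraic group, realized as the tangent space at the identity
(point derivations of the coordinate ring at `1`). -/
def LieAlg : Type u := SpaceWithFunctions.pointDer (coord (G := G)) 1

instance : AddCommGroup (LieAlg G) :=
  inferInstanceAs (AddCommGroup (SpaceWithFunctions.pointDer (coord (G := G)) 1))

instance : Module ℂ (LieAlg G) :=
  inferInstanceAs (Module ℂ (SpaceWithFunctions.pointDer (coord (G := G)) 1))

/-- The functional on the coordinate ring underlying an element of the Lie algebra. -/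
def LieAlg.functional : LieAlg G →ₗ[ℂ] (coord (G := G) →ₗ[ℂ] ℂ) :=
  (SpaceWithFunctions.pointDer (coord (G := G)) 1).subtype

theorem LieAlg.ext {X Y : LieAlg G} (h : ∀ f, X.functional f = Y.functional f) : X = Y :=
  Subtype.ext (LinearMap.ext h)

theorem LieAlg.leibniz (X : LieAlg G) (f g : coord (G := G)) :
    X.functional (f * g) = f.1 1 * X.functional g + g.1 1 * X.functional f :=
  X.2 f g

theorem leftInv_mul (X : LieAlg G) (f g : coord (G := G)) :
    leftInv X.functional (f * g) = f * leftInv X.functional g + g * leftInv X.functional f := by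
  apply Subtype.ext; funext x
  have := X.leibniz (leftTr x f) (leftTr x g)
  rw [← map_mul, leftTr_apply, leftTr_apply, mul_one] at this
  exact this

/-- The Lie bracket: the commutator of left-invariant vector fields, evaluated at `1`. -/
instance : Bracket (LieAlg G) (LieAlg G) where
  bracket X Y := ⟨X.functional ∘ₗ leftInv Y.functional - Y.functional ∘ₗ leftInv X.functional, by
    intro f g
    have e (Z : LieAlg G) (f : coord (G := G)) : (leftInv Z.functional f).1 1 = Z.functional f := by
      rw [leftInv_apply, leftTr_one]
    simp only [LinearMap.sub_apply, LinearMap.comp_apply, leftInv_mul, map_add, LieAlg.leibniz, e]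
    ring⟩

theorem functional_lie (X Y : LieAlg G) (f : coord (G := G)) :
    LieAlg.functional ⁅X, Y⁆ f =
      X.functional (leftInv Y.functional f) - Y.functional (leftInv X.functional f) := rfl

theorem leftInv_lie (X Y : LieAlg G) (f : coord (G := G)) :
    leftInv (LieAlg.functional ⁅X, Y⁆) f = leftInv X.functional (leftInv Y.functional f) -
      leftInv Y.functional (leftInv X.functional f) := by
  apply Subtype.ext; funext x
  change LieAlg.functional ⁅X, Y⁆ (leftTr x f) = X.functional (leftTr x (leftInv Y.functional f)) -
    Y.functional (leftTr x (leftInv X.functional f))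
  rw [functional_lie, leftTr_leftInv, leftTr_leftInv]

theorem leftInv_add (D E : coord (G := G) →ₗ[ℂ] ℂ) (f : coord (G := G)) :
    leftInv (D + E) f = leftInv D f + leftInv E f := rfl

theorem leftInv_smul (c : ℂ) (D : coord (G := G) →ₗ[ℂ] ℂ) (f : coord (G := G)) :
    leftInv (c • D) f = c • leftInv D f := rfl

instance : LieRing (LieAlg G) where
  add_lie X Y Z := by
    apply LieAlg.ext; intro f
    simp only [map_add, LinearMap.add_apply, functional_lie, leftInv_add]
    ring
  lie_add X Y Z := by
    apply LieAlg.ext; intro f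
    simp only [map_add, LinearMap.add_apply, functional_lie, leftInv_add]
    ring
  lie_self X := by
    apply LieAlg.ext; intro f
    simp [functional_lie]
  leibniz_lie X Y Z := by
    apply LieAlg.ext; intro f
    simp only [map_add, LinearMap.add_apply, functional_lie, leftInv_lie, map_sub]
    ring

instance : LieAlgebra ℂ (LieAlg G) where
  lie_smul c X Y := by
    apply LieAlg.ext; intro f
    simp only [map_smul, LinearMap.smul_apply, functional_lie, leftInv_smul, smul_eq_mul]
    ring

/-- The tangent vector at `1` of the variety `G` that corresponds to an element of the Lie
algebra. -/
noncomputable def LieAlg.toTangent : LieAlg G →ₗ[ℂ] (groupVariety G).Tangent 1 :=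
  SpaceWithFunctions.tangentOfPointDer (coord (G := G)) 1

/-- Pulling back functions along a homomorphism of algebraic groups. -/
def comorphism (φ : G →* H) (hφ : ∀ f ∈ coord (G := H), f ∘ φ ∈ coord (G := G)) :
    coord (G := H) →ₐ[ℂ] coord (G := G) where
  toFun f := ⟨f.1 ∘ φ, hφ f.1 f.2⟩
  map_one' := rfl
  map_mul' _ _ := rfl
  map_zero' := rfl
  map_add' _ _ := rfl
  commutes' _ := rfl

theorem comorphism_apply (φ : G →* H) (hφ : ∀ f ∈ coord (G := H), f ∘ φ ∈ coord (G := G))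
    (f : coord (G := H)) (x : G) : (comorphism φ hφ f).1 x = f.1 (φ x) := rfl

/-- The differential at `1` of a homomorphism of algebraic groups, a homomorphism of Lie
algebras. -/
def lieMap (φ : G →* H) (hφ : ∀ f ∈ coord (G := H), f ∘ φ ∈ coord (G := G)) :
    LieAlg G →ₗ⁅ℂ⁆ LieAlg H where
  toFun X := ⟨X.functional ∘ₗ (comorphism φ hφ).toLinearMap, by
    intro f g
    have := X.leibniz (comorphism φ hφ f) (comorphism φ hφ g)
    rw [← map_mul, comorphism_apply, comorphism_apply, map_one] at this
    exact this⟩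
  map_add' _ _ := rfl
  map_smul' _ _ := rfl
  map_lie' {X Y} := by
    have key (Z : LieAlg G) (f : coord (G := H)) :
        comorphism φ hφ (leftInv (Z.functional ∘ₗ (comorphism φ hφ).toLinearMap) f) =
          leftInv Z.functional (comorphism φ hφ f) := by
      apply Subtype.ext; funext x
      change Z.functional (comorphism φ hφ (leftTr (φ x) f)) =
        Z.functional (leftTr x (comorphism φ hφ f))
      congr 1
      apply Subtype.ext; funext y
      simp [comorphism_apply, leftTr_apply]
    apply LieAlg.ext; intro f
    have h1 := congrArg X.functional (key Y f)
    have h2 := congrArg Y.functional (key X f)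
    exact (congrArg₂ (· - ·) h1 h2).symm

theorem functional_lieMap (φ : G →* H) (hφ : ∀ f ∈ coord (G := H), f ∘ φ ∈ coord (G := G))
    (X : LieAlg G) (f : coord (G := H)) :
    (lieMap φ hφ X).functional f = X.functional (comorphism φ hφ f) := rfl

theorem conj_mem (g : G) : ∀ f ∈ coord (G := G),
    f ∘ (MulAut.conj g).toMonoidHom ∈ coord (G := G) := by
  intro f hf
  exact left_mem (right_mem hf g⁻¹) g

variable (G) in
/-- The adjoint representation: `Ad g` is the differential at `1` of `x ↦ g x g⁻¹`. -/
def Ad : Representation ℂ G (LieAlg G) where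
  toFun g := (lieMap (MulAut.conj g).toMonoidHom (conj_mem g)).toLinearMap
  map_one' := by
    apply LinearMap.ext; intro X
    apply LieAlg.ext; intro f
    change X.functional _ = X.functional _
    congr 1
    apply Subtype.ext; funext x
    simp [comorphism_apply]
  map_mul' g h := by
    apply LinearMap.ext; intro X
    apply LieAlg.ext; intro f
    change X.functional _ = X.functional _
    congr 1
    apply Subtype.ext; funext x
    simp [comorphism_apply, mul_assoc]

theorem functional_Ad (g : G) (X : LieAlg G) (f : coord (G := G)) :
    (Ad G g X).functional f =
      X.functional ⟨fun x => f.1 (g * x * g⁻¹), conj_mem g f.1 f.2⟩ := rfl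

theorem lieMap_Ad (φ : G →* H) (hφ : ∀ f ∈ coord (G := H), f ∘ φ ∈ coord (G := G)) (g : G)
    (X : LieAlg G) : lieMap φ hφ (Ad G g X) = Ad H (φ g) (lieMap φ hφ X) := by
  apply LieAlg.ext; intro f
  change X.functional _ = X.functional _
  congr 1
  apply Subtype.ext; funext x
  simp [comorphism_apply]

/-- Every functional on the Lie algebra is the evaluation at some regular function; in particular
the Lie algebra is finite-dimensional. -/
theorem exists_eval (L : Dual ℂ (LieAlg G)) :
    ∃ f : coord (G := G), ∀ X : LieAlg G, L X = X.functional f := by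
  obtain ⟨s, hs⟩ := fg (G := G)
  have hsub : ∀ f ∈ s, f ∈ coord (G := G) := fun f hf => hs ▸ Algebra.subset_adjoin hf
  let ev : LieAlg G →ₗ[ℂ] (s → ℂ) :=
    LinearMap.pi fun f => (LinearMap.applyₗ (⟨f.1, hsub f.1 f.2⟩ : coord (G := G))) ∘ₗ
      LieAlg.functional
  have hinj : Function.Injective ev := by
    rw [← LinearMap.ker_eq_bot, LinearMap.ker_eq_bot']
    intro X hX
    have h0 : ∀ f (hf : f ∈ s), X.functional ⟨f, hsub f hf⟩ = 0 := fun f hf => congrFun hX ⟨f, hf⟩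
    have h1 : X.functional 1 = 0 := by
      have := X.leibniz 1 1
      simpa using this
    apply LieAlg.ext
    rintro ⟨f, hf⟩
    have hf' : f ∈ Algebra.adjoin ℂ (s : Set (G → ℂ)) := hs ▸ hf
    have main : ∀ f (_ : f ∈ Algebra.adjoin ℂ (s : Set (G → ℂ))),
        ∀ h : f ∈ coord (G := G), X.functional ⟨f, h⟩ = 0 := by
      intro f hf
      induction hf using Algebra.adjoin_induction with
      | mem x hx => intro h; exact h0 x hx
      | algebraMap r =>
        intro h
        have : (⟨algebraMap ℂ (G → ℂ) r, h⟩ : coord (G := G)) = r • 1 := by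
          apply Subtype.ext; funext x; simp
        rw [this, map_smul, h1, smul_zero]
      | add x y hx hy ihx ihy =>
        intro h
        have hx' : x ∈ coord (G := G) := hs ▸ hx
        have hy' : y ∈ coord (G := G) := hs ▸ hy
        have : (⟨x + y, h⟩ : coord (G := G)) = ⟨x, hx'⟩ + ⟨y, hy'⟩ := rfl
        rw [this, map_add, ihx, ihy, add_zero]
      | mul x y hx hy ihx ihy =>
        intro h
        have hx' : x ∈ coord (G := G) := hs ▸ hx
        have hy' : y ∈ coord (G := G) := hs ▸ hy
        have : (⟨x * y, h⟩ : coord (G := G)) = ⟨x, hx'⟩ * ⟨y, hy'⟩ := rfl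
        rw [this, X.leibniz, ihx, ihy, mul_zero, mul_zero, add_zero]
    rw [main f hf' hf]
    simp
  obtain ⟨r, hr⟩ := ev.exists_leftInverse_of_injective (LinearMap.ker_eq_bot.2 hinj)
  classical
  refine ⟨∑ f : s, (L (r (Pi.single f 1))) • ⟨f.1, hsub f.1 f.2⟩, fun X => ?_⟩
  have h1 : X = r (ev X) := (LinearMap.congr_fun hr X).symm
  conv_lhs => rw [h1, pi_eq_sum_univ' (ev X)]
  simp only [map_sum, map_smul, smul_eq_mul]
  refine Finset.sum_congr rfl fun f _ => ?_
  rw [mul_comm]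
  congr 2

/-- The functions `g ↦ L (Ad g⁻¹ X)` are regular on `G`. -/
theorem coad_mem (L : Dual ℂ (LieAlg G)) (X : LieAlg G) :
    (fun g => L (Ad G g⁻¹ X)) ∈ coord (G := G) := by
  obtain ⟨f, hf⟩ := exists_eval L
  have e : (fun g => L (Ad G g⁻¹ X)) = fun g =>
      X.functional ⟨fun x => f.1 (g⁻¹ * x * (g⁻¹)⁻¹), conj_mem g⁻¹ f.1 f.2⟩ := by
    funext g
    rw [hf, functional_Ad]
  obtain ⟨k, a, b, h⟩ := mul_coord f.1 f.2
  choose k' a' b' h' using fun i => mul_coord (b i).1 (b i).2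
  have e2 : ∀ g : G, (⟨fun x => f.1 (g⁻¹ * x * (g⁻¹)⁻¹), conj_mem g⁻¹ f.1 f.2⟩ : coord (G := G)) =
      ∑ i, ∑ j, ((a i).1 g⁻¹ * (b' i j).1 g) • a' i j := by
    intro g
    apply Subtype.ext; funext x
    simp only [mul_assoc, h, h', inv_inv, AddSubmonoidClass.coe_finsetSum, Finset.sum_apply,
      SetLike.val_smul, Pi.smul_apply, smul_eq_mul, Finset.mul_sum]
    refine Finset.sum_congr rfl fun i _ => Finset.sum_congr rfl fun j _ => ?_
    ring
  have e3 : (fun g => L (Ad G g⁻¹ X)) = ∑ i, ∑ j, (X.functional (a' i j)) •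
      ((fun g => (a i).1 g⁻¹) * (b' i j).1) := by
    rw [e]
    funext g
    rw [e2]
    simp only [map_sum, map_smul, smul_eq_mul, Finset.sum_apply, Pi.smul_apply, Pi.mul_apply]
    refine Finset.sum_congr rfl fun i _ => Finset.sum_congr rfl fun j _ => ?_
    ring
  rw [e3]
  exact Subalgebra.sum_mem _ fun i _ => Subalgebra.sum_mem _ fun j _ =>
    Subalgebra.smul_mem _ (Subalgebra.mul_mem _ (inv_coord _ (a i).2) (b' i j).2) _

end AffineAlgGroup

namespace SpaceWithFunctions

variable {X : Type u} {Y : Type v} {Z : Type w}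

/-! ### Rules for differentials of functions -/

theorem diff_of_reg (S : SpaceWithFunctions X) {x : X} {f : X → ℂ} (h : S.IsRegAt x f)
    (hm : S.germ x ⟨f, h⟩ - algebraMap ℂ (S.stalk x) (f x) ∈
      (S.maxIdeal x).restrictScalars ℂ) :
    S.diff x f = S.toCotangent x ⟨S.germ x ⟨f, h⟩ - algebraMap ℂ (S.stalk x) (f x), hm⟩ := by
  unfold diff
  rw [dif_pos h]

theorem germ_sub_mem (S : SpaceWithFunctions X) {x : X} {f : X → ℂ} (h : S.IsRegAt x f) :
    S.germ x ⟨f, h⟩ - algebraMap ℂ (S.stalk x) (f x) ∈ (S.maxIdeal x).restrictScalars ℂ := by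
  change S.evalGerm x _ = 0
  rw [map_sub, AlgHom.commutes]
  exact sub_self (f x)

theorem diff_congr (S : SpaceWithFunctions X) {x : X} {f g : X → ℂ} (hf : S.IsRegAt x f)
    (h : ∀ᶠ y in S.nbhd x, f y = g y) : S.diff x f = S.diff x g := by
  have hg : S.IsRegAt x g := S.congr_germ x f g h hf
  rw [S.diff_of_reg hf (S.germ_sub_mem hf), S.diff_of_reg hg (S.germ_sub_mem hg)]
  congr 1
  apply Subtype.ext
  have e : S.germ x ⟨f, hf⟩ = S.germ x ⟨g, hg⟩ := by
    refine Ideal.Quotient.eq.2 ?_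
    change ∀ᶠ y in S.nbhd x, f y - g y = 0
    filter_upwards [h] with y hy
    rw [hy, sub_self]
  simp only [e, S.self_of_nbhd h]

theorem diff_add (S : SpaceWithFunctions X) {x : X} {f g : X → ℂ} (hf : S.IsRegAt x f)
    (hg : S.IsRegAt x g) : S.diff x (f + g) = S.diff x f + S.diff x g := by
  have hfg := S.add_mem x f g hf hg
  rw [S.diff_of_reg hf (S.germ_sub_mem hf), S.diff_of_reg hg (S.germ_sub_mem hg),
    S.diff_of_reg hfg (S.germ_sub_mem hfg), ← map_add]
  congr 1
  apply Subtype.ext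
  have e : S.germ x ⟨f + g, hfg⟩ = S.germ x ⟨f, hf⟩ + S.germ x ⟨g, hg⟩ := rfl
  simp only [e, Submodule.coe_add, Pi.add_apply, map_add]
  ring

theorem diff_const (S : SpaceWithFunctions X) (x : X) (c : ℂ) : S.diff x (fun _ => c) = 0 := by
  have h := S.const_mem x c
  rw [S.diff_of_reg h (S.germ_sub_mem h)]
  convert (S.toCotangent x).map_zero using 2
  apply Subtype.ext
  exact sub_self (algebraMap ℂ (S.stalk x) c)

theorem diff_mul (S : SpaceWithFunctions X) {x : X} {f g : X → ℂ} (hf : S.IsRegAt x f)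
    (hg : S.IsRegAt x g) : S.diff x (f * g) = f x • S.diff x g + g x • S.diff x f := by
  have hfg := S.mul_mem x f g hf hg
  rw [S.diff_of_reg hf (S.germ_sub_mem hf), S.diff_of_reg hg (S.germ_sub_mem hg),
    S.diff_of_reg hfg (S.germ_sub_mem hfg), ← map_smul, ← map_smul, ← map_add]
  refine (Ideal.toCotangent_eq (S.maxIdeal x)).2 ?_
  have e : S.germ x ⟨f * g, hfg⟩ = S.germ x ⟨f, hf⟩ * S.germ x ⟨g, hg⟩ := rfl
  have key : (S.germ x ⟨f * g, hfg⟩ - algebraMap ℂ (S.stalk x) ((f * g) x)) -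
      (f x • (S.germ x ⟨g, hg⟩ - algebraMap ℂ (S.stalk x) (g x)) +
        g x • (S.germ x ⟨f, hf⟩ - algebraMap ℂ (S.stalk x) (f x))) =
      (S.germ x ⟨f, hf⟩ - algebraMap ℂ (S.stalk x) (f x)) *
        (S.germ x ⟨g, hg⟩ - algebraMap ℂ (S.stalk x) (g x)) := by
    rw [e, Pi.mul_apply, map_mul, Algebra.smul_def, Algebra.smul_def]
    ring
  change (S.germ x ⟨f * g, hfg⟩ - algebraMap ℂ (S.stalk x) ((f * g) x)) -
      (f x • (S.germ x ⟨g, hg⟩ - algebraMap ℂ (S.stalk x) (g x)) +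
        g x • (S.germ x ⟨f, hf⟩ - algebraMap ℂ (S.stalk x) (f x))) ∈ S.maxIdeal x ^ 2
  rw [key, pow_two]
  exact Ideal.mul_mem_mul (S.germ_sub_mem hf) (S.germ_sub_mem hg)

theorem diff_smul (S : SpaceWithFunctions X) {x : X} (c : ℂ) {f : X → ℂ} (hf : S.IsRegAt x f) :
    S.diff x (c • f) = c • S.diff x f := by
  have e : c • f = (fun _ => c) * f := rfl
  rw [e, S.diff_mul (S.const_mem x c) hf, S.diff_const, smul_zero, add_zero]

theorem exists_diff (S : SpaceWithFunctions X) (x : X) (c : S.Cotangent x) :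
    ∃ f, S.IsRegAt x f ∧ S.diff x f = c := by
  obtain ⟨⟨γ, hγ⟩, rfl⟩ := S.toCotangent_surjective x c
  obtain ⟨⟨f, hf⟩, rfl⟩ := S.germ_surjective x γ
  refine ⟨f, hf, ?_⟩
  rw [S.diff_of_reg hf (S.germ_sub_mem hf)]
  congr 1
  apply Subtype.ext
  have h0 : f x = 0 := hγ
  simp [h0]

theorem IsMorphism.differential_diff {S : SpaceWithFunctions X} {T : SpaceWithFunctions Y}
    {φ : X → Y} (hφ : IsMorphism S T φ) {x : X} {y : Y} (h : φ x = y) (ξ : S.Tangent x)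
    {g : Y → ℂ} (hg : T.IsRegAt y g) :
    hφ.differential h ξ (T.diff y g) = ξ (S.diff x (g ∘ φ)) := by
  subst h
  have hg' := hφ.pullback x g hg
  rw [T.diff_of_reg hg (T.germ_sub_mem hg), S.diff_of_reg hg' (S.germ_sub_mem hg')]
  rfl

theorem tangentOfPointDer_diff {A : Subalgebra ℂ (X → ℂ)} {x : X} (D : pointDer A x) (a : A) :
    tangentOfPointDer A x D ((affine A).diff x a.1) = D.1 a := by
  have ha := affine_isRegAt A a.2 x
  have h1 : derGerm D ((affine A).germ x ⟨a.1, ha⟩) = D.1 a := by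
    have d1 : D.1 1 = 0 := by simpa using D.2 1 1
    rw [derGerm_mk, derVal_eq D ⟨a.1, ha⟩ a 1 (by simp)
      (Filter.Eventually.of_forall fun y => by simp), d1]
    simp
  have h2 : derGerm D (algebraMap ℂ ((affine A).stalk x) (a.1 x)) = 0 := by
    have := derGerm_mul D 1 1
    rw [Algebra.algebraMap_eq_smul_one, map_smul]
    simp only [mul_one, map_one, one_mul] at this
    have h3 : derGerm D (1 : (affine A).stalk x) = 0 := by linear_combination -this
    rw [h3, smul_zero]
  rw [(affine A).diff_of_reg ha ((affine A).germ_sub_mem ha)]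
  refine (tangentOfDer_toCotangent (affine A) x (derGerm D) (derGerm_mul D) _).trans ?_
  rw [map_sub, h1, h2, sub_zero]

/-! ### Embeddings and varieties -/

/-- A locally closed embedding: an isomorphism onto a locally closed subset with its induced
topology and its induced sheaf of functions (local restrictions of regular functions). -/
structure IsLocallyClosedEmbedding (S : SpaceWithFunctions X) (T : SpaceWithFunctions Y)
    (φ : X → Y) : Prop where
  isMorphism : IsMorphism S T φ
  injective : Function.Injective φ
  induced : S.top = TopologicalSpace.induced φ T.top
  locallyClosed : @IsLocallyClosed Y T.top (Set.range φ)
  extend : ∀ (x : X) (f : X → ℂ), S.IsRegAt x f →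
    ∃ g : Y → ℂ, T.IsRegAt (φ x) g ∧ ∀ᶠ y in S.nbhd x, f y = g (φ y)

/-- The affine space `𝔸ᴺ`. -/
def affineSpace (N : ℕ) : SpaceWithFunctions (Fin N → ℂ) :=
  affine (Algebra.adjoin ℂ (Set.range fun (i : Fin N) (z : Fin N → ℂ) => z i))

/-- A quasi-affine variety: isomorphic to a locally closed subvariety of some `𝔸ᴺ`. -/
def IsQuasiAffineVariety (S : SpaceWithFunctions X) : Prop :=
  ∃ (N : ℕ) (φ : X → (Fin N → ℂ)), IsLocallyClosedEmbedding S (affineSpace N) φ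

/-! ### Vector fields and closed 2-forms -/

/-- A regular vector field on the open set `U` (the values outside `U` are irrelevant): it maps
regular functions to regular functions. -/
def IsVectorFieldOn (S : SpaceWithFunctions X) (U : Set X) (v : ∀ x, S.Tangent x) : Prop :=
  ∀ x ∈ U, ∀ f : X → ℂ, S.IsRegAt x f → S.IsRegAt x fun y => v y (S.diff y f)

/-- `z = [v, w]` on `U`, for vector fields `v`, `w` on `U`. -/
def IsLieBracketOn (S : SpaceWithFunctions X) (U : Set X) (v w z : ∀ x, S.Tangent x) : Prop :=
  ∀ x ∈ U, ∀ f : X → ℂ, S.IsRegAt x f →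
    z x (S.diff x f) = v x (S.diff x fun y => w y (S.diff y f)) -
      w x (S.diff x fun y => v y (S.diff y f))

/-- A closed regular 2-form (on a smooth variety): it maps local vector fields to regular
functions, it is alternating, and its exterior derivative, evaluated on local vector fields by
Cartan's formula, vanishes. -/
structure IsClosedTwoForm (S : SpaceWithFunctions X)
    (ω : ∀ x, S.Tangent x →ₗ[ℂ] S.Tangent x →ₗ[ℂ] ℂ) : Prop where
  alternating : ∀ x, (ω x).IsAlt
  regular : ∀ U, @IsOpen X S.top U → ∀ v w, S.IsVectorFieldOn U v → S.IsVectorFieldOn U w →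
    ∀ x ∈ U, S.IsRegAt x fun y => ω y (v y) (w y)
  closed : ∀ U, @IsOpen X S.top U → ∀ u v w uv uw vw,
    S.IsVectorFieldOn U u → S.IsVectorFieldOn U v → S.IsVectorFieldOn U w →
    S.IsLieBracketOn U u v uv → S.IsLieBracketOn U u w uw → S.IsLieBracketOn U v w vw →
    ∀ x ∈ U,
      u x (S.diff x fun y => ω y (v y) (w y)) - v x (S.diff x fun y => ω y (u y) (w y)) +
          w x (S.diff x fun y => ω y (u y) (v y)) - ω x (uv x) (w x) + ω x (uw x) (v x) -
        ω x (vw x) (u x) = 0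

/-! ### The dual of a vector space as an affine space -/

section Dual

variable (V : Type u) [AddCommGroup V] [Module ℂ V]

/-- The polynomial functions on the dual space `V*`, generated by the elements of `V`. -/
def polyFns : Subalgebra ℂ (Dual ℂ V → ℂ) :=
  Algebra.adjoin ℂ (Set.range fun (x : V) (μ : Dual ℂ V) => μ x)

/-- The dual of a (finite-dimensional) vector space as an affine variety. -/
def dualVariety : SpaceWithFunctions (Dual ℂ V) := affine (polyFns V)

/-- A (finite-dimensional) vector space as an affine variety. -/
def linVariety : SpaceWithFunctions V :=
  affine (Algebra.adjoin ℂ (Set.range fun (l : Dual ℂ V) (x : V) => l x))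

end Dual

theorem comp_mem_of_adjoin {A : Subalgebra ℂ (X → ℂ)} {s : Set (Y → ℂ)} (φ : X → Y)
    (h : ∀ f ∈ s, f ∘ φ ∈ A) : ∀ f ∈ Algebra.adjoin ℂ s, f ∘ φ ∈ A := by
  intro f hf
  induction hf using Algebra.adjoin_induction with
  | mem x hx => exact h x hx
  | algebraMap r => exact A.algebraMap_mem r
  | add f g _ _ hf hg => exact A.add_mem hf hg
  | mul f g _ _ hf hg => exact A.mul_mem hf hg

/-- The transpose of a linear map is a morphism of the dual spaces. -/
theorem isMorphism_dualMap {V W : Type u} [AddCommGroup V] [Module ℂ V] [AddCommGroup W]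
    [Module ℂ W] (L : V →ₗ[ℂ] W) :
    IsMorphism (dualVariety W) (dualVariety V) (fun μ : Dual ℂ W => μ ∘ₗ L) := by
  refine isMorphism_affine _ _ _ (comp_mem_of_adjoin _ ?_)
  rintro _ ⟨x, rfl⟩
  exact Algebra.subset_adjoin ⟨L x, rfl⟩

end SpaceWithFunctions

/-! ## Direct limits of algebraic groups, their Lie algebras and the coadjoint action -/

/-- A directed system of affine algebraic groups, indexed by `ℕ`, whose transition maps are
homomorphic embeddings. -/
structure AlgGroupSystem where
  G : ℕ → Type u
  [group : ∀ n, Group (G n)]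
  [algGroup : ∀ n, AffineAlgGroup (G n)]
  ι : ∀ m n, m ≤ n → G m →* G n
  [directed : DirectedSystem G fun m n h => ι m n h]
  emb : ∀ m n h, IsAlgGroupEmbedding (ι m n h)

attribute [instance] AlgGroupSystem.group AlgGroupSystem.algGroup AlgGroupSystem.directed

namespace AlgGroupSystem

open AffineAlgGroup SpaceWithFunctions

variable (S : AlgGroupSystem.{u})

/-- The direct limit group `G = lim Gₙ`. -/
abbrev GInf : Type u := DirectLimit S.G S.ι

/-- The homomorphism `Gₙ → G`. -/
def toGInf (n : ℕ) : S.G n →* S.GInf where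
  toFun g := ⟦⟨n, g⟩⟧
  map_one' := (DirectLimit.one_def n).symm
  map_mul' g h := (DirectLimit.mul_def n g h).symm

theorem toGInf_ι (m n : ℕ) (h : m ≤ n) (g : S.G m) : S.toGInf n (S.ι m n h g) = S.toGInf m g :=
  DirectLimit.mk_apply _ _ _ _

/-- The Lie algebra `𝔤ₙ` of `Gₙ`. -/
abbrev LieN (n : ℕ) : Type u := LieAlg (S.G n)

/-- The transition maps `𝔤ₘ → 𝔤ₙ`. -/
def lieι (m n : ℕ) (h : m ≤ n) : S.LieN m →ₗ⁅ℂ⁆ S.LieN n :=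
  lieMap (S.ι m n h) (S.emb m n h).pullback

instance : DirectedSystem S.LieN fun m n h => S.lieι m n h where
  map_self n X := by
    apply LieAlg.ext; intro f
    change X.functional _ = X.functional _
    congr 1
    apply Subtype.ext; funext x
    exact congrArg f.1 (DirectedSystem.map_self' S.ι x)
  map_map k m n h h' X := by
    apply LieAlg.ext; intro f
    change X.functional _ = X.functional _
    congr 1
    apply Subtype.ext; funext x
    exact congrArg f.1 (DirectedSystem.map_map' S.ι h h' x)

/-- The direct limit Lie algebra `𝔤 = lim 𝔤ₙ`. -/
def LieInf : Type u := DirectLimit S.LieN S.lieι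

noncomputable instance : AddCommGroup S.LieInf := inferInstanceAs (AddCommGroup (DirectLimit S.LieN S.lieι))

noncomputable instance : Module ℂ S.LieInf := inferInstanceAs (Module ℂ (DirectLimit S.LieN S.lieι))

/-- The map `𝔤ₙ → 𝔤`. -/
noncomputable def toLie (n : ℕ) : S.LieN n →ₗ[ℂ] S.LieInf where
  toFun X := (⟦⟨n, X⟩⟧ : DirectLimit S.LieN S.lieι)
  map_add' X Y := (DirectLimit.add_def n X Y).symm
  map_smul' _ _ := rfl

theorem toLie_lieι (m n : ℕ) (h : m ≤ n) (X : S.LieN m) :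
    S.toLie n (S.lieι m n h X) = S.toLie m X :=
  DirectLimit.mk_apply _ _ _ _

theorem lie_ind {C : S.LieInf → Prop} (h : ∀ n X, C (S.toLie n X)) (x : S.LieInf) : C x :=
  DirectLimit.induction S.lieι h x

theorem lie_ind₂ {C : S.LieInf → S.LieInf → Prop}
    (h : ∀ n X Y, C (S.toLie n X) (S.toLie n Y)) (x y : S.LieInf) : C x y :=
  DirectLimit.induction₂ S.lieι h x y

theorem lie_ind₃ {C : S.LieInf → S.LieInf → S.LieInf → Prop}
    (h : ∀ n X Y Z, C (S.toLie n X) (S.toLie n Y) (S.toLie n Z)) (x y z : S.LieInf) : C x y z :=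
  DirectLimit.induction₃ S.lieι h x y z

/-- The Lie bracket of `𝔤`, computed in any `𝔤ₙ` that contains both elements. -/
noncomputable instance : Bracket S.LieInf S.LieInf where
  bracket := DirectLimit.map₂ S.lieι S.lieι S.lieι (fun _ X Y => ⁅X, Y⁆)
    fun m n h X Y => (S.lieι m n h).map_lie X Y

theorem toLie_lie (n : ℕ) (X Y : S.LieN n) : ⁅S.toLie n X, S.toLie n Y⁆ = S.toLie n ⁅X, Y⁆ :=
  DirectLimit.map₂_def S.lieι S.lieι S.lieι _ _ n X Y

noncomputable instance : LieRing S.LieInf where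
  add_lie := S.lie_ind₃ fun n X Y Z => by
    rw [← map_add, toLie_lie, toLie_lie, toLie_lie, ← map_add, add_lie]
  lie_add := S.lie_ind₃ fun n X Y Z => by
    rw [← map_add, toLie_lie, toLie_lie, toLie_lie, ← map_add, lie_add]
  lie_self := S.lie_ind fun n X => by rw [toLie_lie, lie_self, map_zero]
  leibniz_lie := S.lie_ind₃ fun n X Y Z => by
    simp only [toLie_lie, ← map_add]
    rw [leibniz_lie]

noncomputable instance : LieAlgebra ℂ S.LieInf where
  lie_smul c := S.lie_ind₂ fun n X Y => by
    rw [← map_smul, toLie_lie, toLie_lie, ← map_smul, lie_smul]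

/-- The adjoint action of `G` on `𝔤`, as a map. -/
noncomputable def adMap : S.GInf → S.LieInf → S.LieInf :=
  DirectLimit.map₂ S.ι S.lieι S.lieι (fun n g X => Ad (S.G n) g X)
    fun m n h g X => lieMap_Ad (S.ι m n h) (S.emb m n h).pullback g X

theorem adMap_mk (n : ℕ) (g : S.G n) (X : S.LieN n) :
    S.adMap (S.toGInf n g) (S.toLie n X) = S.toLie n (Ad (S.G n) g X) :=
  DirectLimit.map₂_def S.ι S.lieι S.lieι _ _ n g X

theorem group_ind_lie {C : S.GInf → S.LieInf → Prop}
    (h : ∀ n g X, C (S.toGInf n g) (S.toLie n X)) (g : S.GInf) (x : S.LieInf) : C g x := by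
  induction g using DirectLimit.induction with | _ m g =>
  induction x using S.lie_ind with | _ n X =>
  have e1 := S.toGInf_ι m _ (le_max_left m n) g
  have e2 := S.toLie_lieι n _ (le_max_right m n) X
  rw [← e2]
  have := h _ (S.ι m _ (le_max_left m n) g) (S.lieι n _ (le_max_right m n) X)
  rw [e1] at this
  exact this

theorem group_ind_lie₂ {C : S.GInf → S.LieInf → S.LieInf → Prop}
    (h : ∀ n g X Y, C (S.toGInf n g) (S.toLie n X) (S.toLie n Y)) (g : S.GInf)
    (x y : S.LieInf) : C g x y := by
  induction g using DirectLimit.induction with | _ m g =>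
  induction x, y using S.lie_ind₂ with | _ n X Y =>
  have e1 := S.toGInf_ι m _ (le_max_left m n) g
  have e2 := S.toLie_lieι n _ (le_max_right m n) X
  have e3 := S.toLie_lieι n _ (le_max_right m n) Y
  rw [← e2, ← e3]
  have := h _ (S.ι m _ (le_max_left m n) g) (S.lieι n _ (le_max_right m n) X)
    (S.lieι n _ (le_max_right m n) Y)
  rw [e1] at this
  exact this

theorem group_ind₂_lie {C : S.GInf → S.GInf → S.LieInf → Prop}
    (h : ∀ n g g' X, C (S.toGInf n g) (S.toGInf n g') (S.toLie n X)) (g g' : S.GInf)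
    (x : S.LieInf) : C g g' x := by
  induction g, g' using DirectLimit.induction₂ with | _ m g g' =>
  induction x using S.lie_ind with | _ n X =>
  have e1 := S.toGInf_ι m _ (le_max_left m n) g
  have e2 := S.toLie_lieι n _ (le_max_right m n) X
  have e3 := S.toGInf_ι m _ (le_max_left m n) g'
  rw [← e2]
  have := h _ (S.ι m _ (le_max_left m n) g) (S.ι m _ (le_max_left m n) g')
    (S.lieι n _ (le_max_right m n) X)
  rw [e1, e3] at this
  exact this

/-- The adjoint representation of `G` on `𝔤`. -/
noncomputable def AdInf : Representation ℂ S.GInf S.LieInf where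
  toFun g :=
    { toFun := S.adMap g
      map_add' := S.group_ind_lie₂
        (C := fun g x y => S.adMap g (x + y) = S.adMap g x + S.adMap g y)
        (fun n g X Y => by
          rw [← map_add, adMap_mk, adMap_mk, adMap_mk, map_add, map_add]) g
      map_smul' := fun c => S.group_ind_lie
        (C := fun g x => S.adMap g (c • x) = c • S.adMap g x)
        (fun n g X => by
          rw [← map_smul, adMap_mk, adMap_mk, map_smul, map_smul]) g }
  map_one' := by
    apply LinearMap.ext
    refine S.lie_ind fun n X => ?_
    change S.adMap 1 (S.toLie n X) = S.toLie n X
    rw [← map_one (S.toGInf n), adMap_mk, map_one]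
    rfl
  map_mul' g g' := by
    apply LinearMap.ext
    intro x
    refine S.group_ind₂_lie (C := fun g g' x => S.adMap (g * g') x = S.adMap g (S.adMap g' x))
      (fun n g g' X => ?_) g g' x
    rw [← map_mul, adMap_mk, adMap_mk, adMap_mk, map_mul]
    rfl

theorem AdInf_mk (n : ℕ) (g : S.G n) (X : S.LieN n) :
    S.AdInf (S.toGInf n g) (S.toLie n X) = S.toLie n (Ad (S.G n) g X) := S.adMap_mk n g X

/-- The dual space `𝔤* = lim 𝔤ₙ*`; the projection `𝔤* → 𝔤ₙ*` is the restriction `S.res n`. -/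
abbrev LieDual : Type u := Dual ℂ S.LieInf

/-- The projection `λ ↦ λₙ`, `𝔤* → 𝔤ₙ*`. -/
noncomputable def res (n : ℕ) : S.LieDual →ₗ[ℂ] Dual ℂ (S.LieN n) := (S.toLie n).dualMap

/-- The coadjoint representation of `G` on `𝔤*`. -/
noncomputable def coad : Representation ℂ S.GInf S.LieDual := S.AdInf.dual

/-- The coadjoint action restricted to `Gₙ`. -/
noncomputable def coadN (n : ℕ) : Representation ℂ (S.G n) S.LieDual := S.coad.comp (S.toGInf n)

theorem coadN_apply (n : ℕ) (g : S.G n) (μ : S.LieDual) (X : S.LieN n) :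
    S.coadN n g μ (S.toLie n X) = μ (S.toLie n (Ad (S.G n) g⁻¹ X)) := by
  change μ (S.AdInf (S.toGInf n g)⁻¹ (S.toLie n X)) = _
  rw [← map_inv, AdInf_mk]

theorem coadN_ι (m n : ℕ) (h : m ≤ n) (g : S.G m) : S.coadN n (S.ι m n h g) = S.coadN m g := by
  change S.coad (S.toGInf n (S.ι m n h g)) = S.coad (S.toGInf m g)
  rw [toGInf_ι]

/-- The coadjoint representation of `Gₙ` on `𝔤ₙ*`. -/
noncomputable def coadFin (n : ℕ) : Representation ℂ (S.G n) (Dual ℂ (S.LieN n)) :=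
  (Ad (S.G n)).dual

theorem res_coadN (n : ℕ) (g : S.G n) (μ : S.LieDual) :
    S.res n (S.coadN n g μ) = S.coadFin n g (S.res n μ) := by
  apply LinearMap.ext
  intro X
  exact S.coadN_apply n g μ X

/-! ### The Poisson provariety `𝔤*` -/

theorem isMorphism_res (m n : ℕ) (h : m ≤ n) :
    IsMorphism (dualVariety (S.LieN n)) (dualVariety (S.LieN m))
      (fun μ : Dual ℂ (S.LieN n) => μ ∘ₗ (S.lieι m n h).toLinearMap) :=
  isMorphism_dualMap _

theorem res_comp (m n : ℕ) (h : m ≤ n) :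
    (fun μ : Dual ℂ (S.LieN n) => μ ∘ₗ (S.lieι m n h).toLinearMap) ∘ S.res n = S.res m := by
  funext μ
  apply LinearMap.ext
  intro X
  exact congrArg μ (S.toLie_lieι m n h X)

/-- The provariety `𝔤* = lim 𝔤ₙ*`. -/
noncomputable def proVariety : SpaceWithFunctions S.LieDual :=
  proLimit (fun n => dualVariety (S.LieN n)) (fun n => S.res n)
    (fun m n h μ => μ ∘ₗ (S.lieι m n h).toLinearMap) S.isMorphism_res S.res_comp

theorem proVariety_reg (n : ℕ) (μ : S.LieDual) (f : Dual ℂ (S.LieN n) → ℂ)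
    (h : (dualVariety (S.LieN n)).IsRegAt (S.res n μ) f) :
    S.proVariety.IsRegAt μ (f ∘ S.res n) :=
  ⟨n, f, h, Filter.Eventually.of_forall fun _ => rfl⟩

/-- The linear function `μ ↦ μ x` on `𝔤*` defined by `x ∈ 𝔤`. -/
noncomputable def evalFn (x : S.LieInf) : S.LieDual → ℂ := fun μ => μ x

theorem evalFn_reg (μ : S.LieDual) (x : S.LieInf) : S.proVariety.IsRegAt μ (S.evalFn x) := by
  induction x using S.lie_ind with | _ n X =>
  exact S.proVariety_reg n μ (fun ν => ν X)
    (affine_isRegAt (polyFns (S.LieN n)) (Algebra.subset_adjoin ⟨X, rfl⟩) _)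

/-- The linear map `𝔤 → T*_μ(𝔤*)` that sends `x` to the differential of the linear function
defined by `x`. -/
noncomputable def linDiff (μ : S.LieDual) : S.LieInf →ₗ[ℂ] S.proVariety.Cotangent μ where
  toFun x := S.proVariety.diff μ (S.evalFn x)
  map_add' x y := by
    rw [← S.proVariety.diff_add (S.evalFn_reg μ x) (S.evalFn_reg μ y)]
    congr 1
    funext ν
    exact map_add ν x y
  map_smul' c x := by
    rw [RingHom.id_apply, ← S.proVariety.diff_smul c (S.evalFn_reg μ x)]
    congr 1
    funext ν
    exact map_smul ν c x

theorem diff_poly (n : ℕ) (μ : S.LieDual) (f : Dual ℂ (S.LieN n) → ℂ)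
    (hf : f ∈ polyFns (S.LieN n)) :
    S.proVariety.IsRegAt μ (f ∘ S.res n) ∧
      S.proVariety.diff μ (f ∘ S.res n) ∈ LinearMap.range (S.linDiff μ) := by
  have hreg : ∀ f ∈ polyFns (S.LieN n), S.proVariety.IsRegAt μ (f ∘ S.res n) := fun f hf =>
    S.proVariety_reg n μ f (affine_isRegAt _ hf _)
  refine ⟨hreg f hf, ?_⟩
  induction hf using Algebra.adjoin_induction with
  | mem f hf =>
    obtain ⟨X, rfl⟩ := hf
    exact ⟨S.toLie n X, rfl⟩
  | algebraMap r =>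
    have : S.proVariety.diff μ (algebraMap ℂ (Dual ℂ (S.LieN n) → ℂ) r ∘ S.res n) = 0 :=
      S.proVariety.diff_const μ r
    rw [this]
    exact Submodule.zero_mem _
  | add f g hf hg ihf ihg =>
    have : S.proVariety.diff μ ((f + g) ∘ S.res n) = _ :=
      S.proVariety.diff_add (hreg f hf) (hreg g hg)
    rw [this]
    exact Submodule.add_mem _ ihf ihg
  | mul f g hf hg ihf ihg =>
    have : S.proVariety.diff μ ((f * g) ∘ S.res n) = _ :=
      S.proVariety.diff_mul (hreg f hf) (hreg g hg)
    rw [this]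
    exact Submodule.add_mem _ (Submodule.smul_mem _ _ ihg) (Submodule.smul_mem _ _ ihf)

theorem linDiff_surjective (μ : S.LieDual) : Function.Surjective (S.linDiff μ) := by
  intro c
  obtain ⟨f, hf, rfl⟩ := S.proVariety.exists_diff μ c
  change S.proVariety.diff μ f ∈ LinearMap.range (S.linDiff μ)
  obtain ⟨n, g, ⟨a, ha, b, hb, hb0, hg⟩, hfg⟩ := hf
  have hf : S.proVariety.IsRegAt μ f := ⟨n, g, ⟨a, ha, b, hb, hb0, hg⟩, hfg⟩
  obtain ⟨ra, da⟩ := S.diff_poly n μ a ha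
  obtain ⟨rb, db⟩ := S.diff_poly n μ b hb
  have hres : IsMorphism S.proVariety (dualVariety (S.LieN n)) (S.res n) :=
    ⟨continuous_iff_le_induced.2
      (iInf_le (fun n => TopologicalSpace.induced (S.res n) (dualVariety (S.LieN n)).top) n),
      fun μ f hf => S.proVariety_reg n μ f hf⟩
  have h1 : ∀ᶠ ν in S.proVariety.nbhd μ, g (S.res n ν) = a (S.res n ν) / b (S.res n ν) :=
    (hres.tendsto μ).eventually hg
  have h2 : ∀ᶠ ν in S.proVariety.nbhd μ, b (S.res n ν) ≠ 0 :=
    (hres.tendsto μ).eventually (affine_ne_zero _ hb hb0)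
  have h3 : ∀ᶠ ν in S.proVariety.nbhd μ, (f * (b ∘ S.res n)) ν = (a ∘ S.res n) ν := by
    filter_upwards [h1, h2, hfg] with ν e1 e2 e3
    simp only [Pi.mul_apply, Function.comp_apply, e3, e1]
    field_simp
  have h4 := S.proVariety.diff_congr (S.proVariety.mul_mem μ _ _ hf rb) h3
  rw [S.proVariety.diff_mul hf rb] at h4
  have h5 : S.proVariety.diff μ f = (b (S.res n μ))⁻¹ •
      (S.proVariety.diff μ (a ∘ S.res n) - f μ • S.proVariety.diff μ (b ∘ S.res n)) := by
    rw [← h4, add_sub_cancel_left]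
    exact (inv_smul_smul₀ hb0 _).symm
  rw [h5]
  exact Submodule.smul_mem _ _ (Submodule.sub_mem _ da (Submodule.smul_mem _ _ db))

/-- The functions on `ℂ` that are differentiable everywhere. -/
def entireFns : Subalgebra ℂ (ℂ → ℂ) where
  carrier := {f | Differentiable ℂ f}
  mul_mem' hf hg := Differentiable.mul hf hg
  add_mem' hf hg := Differentiable.add hf hg
  algebraMap_mem' c := differentiable_const c

/-- The derivative at `0`. -/
noncomputable def derivZero : pointDer entireFns 0 :=
  ⟨{ toFun := fun f => deriv f.1 0
     map_add' := fun f g => deriv_add (f.2 0) (g.2 0)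
     map_smul' := fun c f => deriv_const_mul c (f.2 0) }, by
    intro f g
    have : deriv (f.1 * g.1) 0 = _ := deriv_mul (f.2 0) (g.2 0)
    change deriv (f.1 * g.1) 0 = f.1 0 * deriv g.1 0 + g.1 0 * deriv f.1 0
    rw [this]
    ring⟩

theorem isMorphism_line (μ ν : S.LieDual) :
    IsMorphism (affine entireFns) S.proVariety (fun t : ℂ => μ + t • ν) := by
  refine isMorphism_proLimit _ _ _ _ _ _ _ fun n => ?_
  refine isMorphism_affine _ _ _ (comp_mem_of_adjoin _ ?_)
  rintro _ ⟨X, rfl⟩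
  change Differentiable ℂ fun t : ℂ => μ (S.toLie n X) + t * ν (S.toLie n X)
  fun_prop

theorem linDiff_injective (μ : S.LieDual) : Function.Injective (S.linDiff μ) := by
  rw [← LinearMap.ker_eq_bot, LinearMap.ker_eq_bot']
  intro x hx
  rw [← Module.forall_dual_apply_eq_zero_iff ℂ x]
  intro ν
  have h0 : (fun t : ℂ => μ + t • ν) 0 = μ := by simp
  have h1 := (S.isMorphism_line μ ν).differential_diff h0
    (tangentOfPointDer entireFns 0 derivZero) (S.evalFn_reg μ x)
  have h2 : S.proVariety.diff μ (S.evalFn x) = 0 := hx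
  have h3 : Differentiable ℂ (S.evalFn x ∘ fun t : ℂ => μ + t • ν) := by
    change Differentiable ℂ fun t : ℂ => μ x + t * ν x
    fun_prop
  rw [h2, map_zero, tangentOfPointDer_diff derivZero ⟨_, h3⟩] at h1
  have h4 : deriv (fun t : ℂ => μ x + t * ν x) 0 = ν x := by simp
  exact h4.symm.trans h1.symm

/-- The identification `𝔤 ≅ T*_μ(𝔤*)`. -/
noncomputable def cotangentEquiv (μ : S.LieDual) :
    S.LieInf ≃ₗ[ℂ] S.proVariety.Cotangent μ :=
  LinearEquiv.ofBijective (S.linDiff μ) ⟨S.linDiff_injective μ, S.linDiff_surjective μ⟩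

/-- The Poisson bivector `π_μ` of the Lie-Poisson structure `{f, g}(μ) = μ [d_μ f, d_μ g]` of
`𝔤*`, a bilinear form on `T*_μ(𝔤*) ≅ 𝔤`. -/
noncomputable def bivector (μ : S.LieDual) :
    S.proVariety.Cotangent μ →ₗ[ℂ] S.proVariety.Cotangent μ →ₗ[ℂ] ℂ :=
  LinearMap.mk₂ ℂ (fun α β => μ ⁅(S.cotangentEquiv μ).symm α, (S.cotangentEquiv μ).symm β⁆)
    (by intro α α' β; rw [map_add, add_lie, map_add])
    (by intro c α β; rw [map_smul, smul_lie, map_smul])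
    (by intro α β β'; rw [map_add, lie_add, map_add])
    (by intro c α β; rw [map_smul, lie_smul, map_smul])

theorem bivector_skew (μ : S.LieDual) (α β : S.proVariety.Cotangent μ) :
    S.bivector μ α β = -S.bivector μ β α := by
  change μ _ = -μ _
  rw [← lie_skew, map_neg]

/-- The anchor map `π̃_μ : T*_μ(𝔤*) → T_μ(𝔤*)`, `π̃_μ(α)(β) = π_μ(α, β)`. -/
noncomputable def anchor (μ : S.LieDual) :
    S.proVariety.Cotangent μ →ₗ[ℂ] S.proVariety.Tangent μ := S.bivector μ

/-- The characteristic distribution of `𝔤*` at `μ`: the image of the anchor map. -/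
noncomputable def charDist (μ : S.LieDual) : Submodule ℂ (S.proVariety.Tangent μ) :=
  LinearMap.range (S.anchor μ)

/-- The isomorphism `[π̃_μ] : T*_μ(𝔤*) / Ker π̃_μ → 𝔛(𝔤*)_μ` induced by the anchor map. -/
noncomputable def anchorEquiv (μ : S.LieDual) :
    (S.proVariety.Cotangent μ ⧸ LinearMap.ker (S.anchor μ)) ≃ₗ[ℂ] S.charDist μ :=
  (S.anchor μ).quotKerEquivRange

/-- The bilinear form on `T*_μ(𝔤*) / Ker π̃_μ` induced by the Poisson bivector `π_μ`. -/
noncomputable def redBivector (μ : S.LieDual) :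
    (S.proVariety.Cotangent μ ⧸ LinearMap.ker (S.anchor μ)) →ₗ[ℂ]
      (S.proVariety.Cotangent μ ⧸ LinearMap.ker (S.anchor μ)) →ₗ[ℂ] ℂ :=
  ((LinearMap.ker (S.anchor μ)).liftQ
    ((LinearMap.ker (S.anchor μ)).liftQ (S.bivector μ) le_rfl).flip (by
      intro β hβ
      have hβ' : S.bivector μ β = 0 := hβ
      change ((LinearMap.ker (S.anchor μ)).liftQ (S.bivector μ) le_rfl).flip β = 0
      apply LinearMap.ext
      intro q
      obtain ⟨α, rfl⟩ := Submodule.Quotient.mk_surjective _ q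
      change S.bivector μ α β = 0
      rw [bivector_skew, hβ', LinearMap.zero_apply, neg_zero])).flip

theorem redBivector_mk (μ : S.LieDual) (α β : S.proVariety.Cotangent μ) :
    S.redBivector μ (Submodule.Quotient.mk α) (Submodule.Quotient.mk β) = S.bivector μ α β := rfl

end AlgGroupSystem

/-! ## Orbits of algebraic groups -/

section Orbits

variable {G : Type u} [Group G] {V : Type v} [AddCommGroup V] [Module ℂ V]

/-- The orbit of `v` under a linear action. -/
def orb (ρ : Representation ℂ G V) (v : V) : Set V := Set.range fun g => ρ g v

theorem mem_orb_self (ρ : Representation ℂ G V) (v : V) : v ∈ orb ρ v := ⟨1, by simp⟩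

theorem orb_smul_mem (ρ : Representation ℂ G V) {v m : V} (hm : m ∈ orb ρ v) (g : G) :
    ρ g m ∈ orb ρ v := by
  obtain ⟨h, rfl⟩ := hm
  exact ⟨g * h, by simp⟩

/-- The orbit map `g ↦ g · m` of a point `m` of the orbit of `v`. -/
def orbMap (ρ : Representation ℂ G V) (v : V) (m : orb ρ v) (g : G) : orb ρ v :=
  ⟨ρ g m.1, orb_smul_mem ρ m.2 g⟩

theorem orbMap_one (ρ : Representation ℂ G V) (v : V) (m : orb ρ v) : orbMap ρ v m 1 = m := by
  apply Subtype.ext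
  simp [orbMap]

variable [AffineAlgGroup G]

/-- The orbit of `v` with the structure of the homogeneous space `G / Gᵛ` (the geometric
quotient): the orbit map `g ↦ g · v` induces the quotient topology, and a function is regular on
an open set iff its pullback to `G` is regular. -/
def orbSpace (ρ : Representation ℂ G V) (v : V) : SpaceWithFunctions (orb ρ v) :=
  SpaceWithFunctions.coinduced (fun _ : Unit => groupVariety G)
    fun _ => orbMap ρ v ⟨v, mem_orb_self ρ v⟩

theorem isMorphism_orbMap (ρ : Representation ℂ G V) (v : V) (m : orb ρ v) :
    SpaceWithFunctions.IsMorphism (groupVariety G) (orbSpace ρ v) (orbMap ρ v m) := by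
  obtain ⟨m, h, rfl⟩ := m
  have e : orbMap ρ v ⟨ρ h v, ⟨h, rfl⟩⟩ =
      orbMap ρ v ⟨v, mem_orb_self ρ v⟩ ∘ fun g => g * h := by
    funext g
    apply Subtype.ext
    simp [orbMap]
  have h1 : SpaceWithFunctions.IsMorphism (groupVariety G) (groupVariety G) fun g => g * h :=
    SpaceWithFunctions.isMorphism_affine _ _ _ fun f hf => AffineAlgGroup.right_mem hf h
  have h2 : SpaceWithFunctions.IsMorphism (groupVariety G) (orbSpace ρ v)
      (orbMap ρ v ⟨v, mem_orb_self ρ v⟩) :=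
    SpaceWithFunctions.isMorphism_coinduced (fun _ : Unit => groupVariety G)
      (fun _ => orbMap ρ v ⟨v, mem_orb_self ρ v⟩) ()
  change SpaceWithFunctions.IsMorphism _ _ (orbMap ρ v ⟨ρ h v, ⟨h, rfl⟩⟩)
  rw [e]
  exact h2.comp h1

/-- The velocity vector at `m` of `X` in the Lie algebra: the image of `X` under the differential
at `1` of the orbit map `g ↦ g · m`.  It is the class of `X` in `T_m (G · v) = 𝔤 / 𝔤ᵐ`. -/
noncomputable def velocity (ρ : Representation ℂ G V) (v : V) (m : orb ρ v) :
    AffineAlgGroup.LieAlg G →ₗ[ℂ] (orbSpace ρ v).Tangent m :=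
  (isMorphism_orbMap ρ v m).differential (orbMap_one ρ v m) ∘ₗ AffineAlgGroup.LieAlg.toTangent

end Orbits

namespace AlgGroupSystem

open AffineAlgGroup SpaceWithFunctions

variable (S : AlgGroupSystem.{u})

/-! ## Coadjoint orbits -/

/-- The coadjoint orbit `G · λ`. -/
def orbit (lam : S.LieDual) : Set S.LieDual := orb S.coad lam

/-- The orbit `Gₙ · λ` in `𝔤*`. -/
def orbitN (lam : S.LieDual) (n : ℕ) : Set S.LieDual := orb (S.coadN n) lam

theorem orbitN_subset (lam : S.LieDual) (n : ℕ) : S.orbitN lam n ⊆ S.orbit lam := by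
  rintro _ ⟨g, rfl⟩
  exact ⟨S.toGInf n g, rfl⟩

theorem orbitN_mono (lam : S.LieDual) {m n : ℕ} (h : m ≤ n) :
    S.orbitN lam m ⊆ S.orbitN lam n := by
  rintro _ ⟨g, rfl⟩
  exact ⟨S.ι m n h g, by simp only [coadN_ι]⟩

/-- `Gₙ · λ` with the structure of the variety `Gₙ / Gₙ^λ`. -/
noncomputable def orbitNSpace (lam : S.LieDual) (n : ℕ) : SpaceWithFunctions (S.orbitN lam n) :=
  orbSpace (S.coadN n) lam

/-- The inclusion `Gₘ · λ → Gₙ · λ`. -/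
def orbitIncl (lam : S.LieDual) (m n : ℕ) (h : m ≤ n) : S.orbitN lam m → S.orbitN lam n :=
  Set.inclusion (S.orbitN_mono lam h)

theorem isMorphism_ι (m n : ℕ) (h : m ≤ n) :
    IsMorphism (groupVariety (S.G m)) (groupVariety (S.G n)) (S.ι m n h) :=
  isMorphism_affine _ _ _ (S.emb m n h).pullback

theorem isMorphism_orbitIncl (lam : S.LieDual) (m n : ℕ) (h : m ≤ n) :
    IsMorphism (S.orbitNSpace lam m) (S.orbitNSpace lam n) (S.orbitIncl lam m n h) := by
  refine isMorphism_of_coinduced _ _ _ _ fun _ => ?_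
  have e : S.orbitIncl lam m n h ∘ orbMap (S.coadN m) lam ⟨lam, mem_orb_self _ lam⟩ =
      orbMap (S.coadN n) lam ⟨lam, mem_orb_self _ lam⟩ ∘ S.ι m n h := by
    funext g
    apply Subtype.ext
    change S.coadN m g lam = S.coadN n (S.ι m n h g) lam
    rw [coadN_ι]
  rw [e]
  exact (isMorphism_orbMap (S.coadN n) lam ⟨lam, mem_orb_self _ lam⟩).comp (S.isMorphism_ι m n h)

/-- The ind-variety structure of `G · λ = lim Gₙ · λ`: the final topology, and the functions
whose restrictions to all `Gₙ · λ` are regular. -/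
noncomputable def orbitSpace (lam : S.LieDual) : SpaceWithFunctions (S.orbit lam) :=
  coinduced (fun n => S.orbitNSpace lam n) fun n => Set.inclusion (S.orbitN_subset lam n)

/-- `G · λ` is an ind-variety, as the direct limit of the `Gₙ · λ`: these are varieties, and the
inclusions between them are locally closed embeddings. -/
def IsIndVarietyOrbit (lam : S.LieDual) : Prop :=
  (∀ n, (S.orbitNSpace lam n).IsQuasiAffineVariety) ∧
    ∀ m n h, IsLocallyClosedEmbedding (S.orbitNSpace lam m) (S.orbitNSpace lam n)
      (S.orbitIncl lam m n h)

/-- The inclusion `iₙ : Gₙ · λ → 𝔤*` is a morphism. -/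
theorem isMorphism_inclN (lam : S.LieDual) (n : ℕ) :
    IsMorphism (S.orbitNSpace lam n) S.proVariety (fun μ : S.orbitN lam n => μ.1) := by
  refine isMorphism_of_coinduced _ _ _ _ fun _ => isMorphism_proLimit _ _ _ _ _ _ _ fun k => ?_
  refine isMorphism_affine _ _ _ (comp_mem_of_adjoin _ ?_)
  rintro _ ⟨X, rfl⟩
  change (fun g : S.G n => S.coadN n g lam (S.toLie k X)) ∈ coord (G := S.G n)
  let N := max n k
  have hn : n ≤ N := le_max_left n k
  have hk : k ≤ N := le_max_right n k
  have e : (fun g : S.G n => S.coadN n g lam (S.toLie k X)) =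
      (fun g : S.G N => S.res N lam (Ad (S.G N) g⁻¹ (S.lieι k N hk X))) ∘ S.ι n N hn := by
    funext g
    rw [← S.coadN_ι n N hn, ← S.toLie_lieι k N hk, coadN_apply]
    rfl
  rw [e]
  exact (S.emb n N hn).pullback _ (coad_mem _ _)

/-! ### Tangent spaces of coadjoint orbits -/

section Tangent

variable (lam : S.LieDual) (μ : S.orbit lam)

/-- The tangent spaces `T_μ(Gₗ · λ)`, for those `l` with `μ ∈ Gₗ · λ`. -/
abbrev TangentN (l : {l : ℕ // μ.1 ∈ S.orbitN lam l}) : Type u :=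
  (S.orbitNSpace lam l.1).Tangent ⟨μ.1, l.2⟩

/-- The transition maps of the tangent spaces, the differentials of the inclusions. -/
noncomputable def tangentTrans (l m : {l : ℕ // μ.1 ∈ S.orbitN lam l}) (h : l ≤ m) :
    S.TangentN lam μ l →ₗ[ℂ] S.TangentN lam μ m :=
  (S.isMorphism_orbitIncl lam l.1 m.1 h).differential rfl

/-- The tangent space `T_μ(G · λ) = lim T_μ(Gₗ · λ)`. -/
abbrev OrbitTangent : Type u := Module.DirectLimit (S.TangentN lam μ) (S.tangentTrans lam μ)

/-- The map `T_μ(Gₗ · λ) → T_μ(G · λ)`. -/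
noncomputable def tangentOf (l : ℕ) (hl : μ.1 ∈ S.orbitN lam l) :
    (S.orbitNSpace lam l).Tangent ⟨μ.1, hl⟩ →ₗ[ℂ] S.OrbitTangent lam μ :=
  Module.DirectLimit.of ℂ _ (S.TangentN lam μ) (S.tangentTrans lam μ) ⟨l, hl⟩

/-- The differential `(di)_μ : T_μ(G · λ) → T_μ(𝔤*)` of the inclusion `i : G · λ → 𝔤*`, the
limit of the differentials of its restrictions to the `Gₗ · λ`. -/
noncomputable def dIncl : S.OrbitTangent lam μ →ₗ[ℂ] S.proVariety.Tangent μ.1 :=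
  Module.DirectLimit.lift ℂ _ (S.TangentN lam μ) (S.tangentTrans lam μ)
    (fun l => (S.isMorphism_inclN lam l.1).differential rfl)
    (fun l m h ξ => (S.isMorphism_inclN lam m.1).differential_comp
      (S.isMorphism_orbitIncl lam l.1 m.1 h) (S.isMorphism_inclN lam l.1) rfl rfl rfl rfl ξ)

end Tangent

/-! ### The form `ω_∞` -/

/-- The orbit `Gₙ · λₙ` in `𝔤ₙ*`. -/
def finOrbit (lam : S.LieDual) (n : ℕ) : Set (Dual ℂ (S.LieN n)) :=
  orb (S.coadFin n) (S.res n lam)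

/-- `Gₙ · λₙ` with the structure of the variety `Gₙ / Gₙ^{λₙ}`. -/
noncomputable def finOrbitSpace (lam : S.LieDual) (n : ℕ) :
    SpaceWithFunctions (S.finOrbit lam n) :=
  orbSpace (S.coadFin n) (S.res n lam)

/-- The projection `pₙ : Gₙ · λ → Gₙ · λₙ`. -/
noncomputable def proj (lam : S.LieDual) (n : ℕ) (μ : S.orbitN lam n) : S.finOrbit lam n :=
  ⟨S.res n μ.1, by
    obtain ⟨g, hg⟩ := μ.2
    exact ⟨g, by rw [← hg]; exact (S.res_coadN n g lam).symm⟩⟩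

theorem isMorphism_proj (lam : S.LieDual) (n : ℕ) :
    IsMorphism (S.orbitNSpace lam n) (S.finOrbitSpace lam n) (S.proj lam n) := by
  refine isMorphism_of_coinduced _ _ _ _ fun _ => ?_
  have e : S.proj lam n ∘ orbMap (S.coadN n) lam ⟨lam, mem_orb_self _ lam⟩ =
      orbMap (S.coadFin n) (S.res n lam) ⟨S.res n lam, mem_orb_self _ _⟩ := by
    funext g
    apply Subtype.ext
    exact S.res_coadN n g lam
  rw [e]
  exact isMorphism_orbMap (S.coadFin n) (S.res n lam) ⟨S.res n lam, mem_orb_self _ _⟩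

/-- `κ` is the Kostant-Kirillov form on `Gₙ · λₙ`: at every point `m` of the orbit,
`κ_m(X + 𝔤ₙᵐ, Y + 𝔤ₙᵐ) = m [X, Y]`. -/
def IsKostantKirillov (lam : S.LieDual) (n : ℕ)
    (κ : ∀ m : S.finOrbit lam n,
      (S.finOrbitSpace lam n).Tangent m →ₗ[ℂ] (S.finOrbitSpace lam n).Tangent m →ₗ[ℂ] ℂ) : Prop :=
  ∀ (m : S.finOrbit lam n) (X Y : S.LieN n),
    κ m (velocity (S.coadFin n) (S.res n lam) m X) (velocity (S.coadFin n) (S.res n lam) m Y) =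
      m.1 ⁅X, Y⁆

/-- A 2-form on `G · λ`: a bilinear form on every tangent space. -/
abbrev OrbitForm (lam : S.LieDual) : Type u :=
  ∀ μ : S.orbit lam, S.OrbitTangent lam μ →ₗ[ℂ] S.OrbitTangent lam μ →ₗ[ℂ] ℂ

/-- The pullback of a form on `G · λ` to `Gₙ · λ`. -/
noncomputable def restrictForm (lam : S.LieDual) (ω : S.OrbitForm lam) (n : ℕ)
    (μ : S.orbitN lam n) : (S.orbitNSpace lam n).Tangent μ →ₗ[ℂ]
      (S.orbitNSpace lam n).Tangent μ →ₗ[ℂ] ℂ :=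
  (ω ⟨μ.1, S.orbitN_subset lam n μ.2⟩).compl₁₂
    (S.tangentOf lam ⟨μ.1, S.orbitN_subset lam n μ.2⟩ n μ.2)
    (S.tangentOf lam ⟨μ.1, S.orbitN_subset lam n μ.2⟩ n μ.2)

/-- `ω = ω_∞ = lim dpₙ* ωₙ`, where `ωₙ` is the Kostant-Kirillov form on `Gₙ · λₙ`: for every `n`
the pullback of `ω` to `Gₙ · λ` is the pullback of `ωₙ` along `pₙ`. -/
def IsOmegaInf (lam : S.LieDual) (ω : S.OrbitForm lam) : Prop :=
  ∃ κ : ∀ (n : ℕ) (m : S.finOrbit lam n),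
      (S.finOrbitSpace lam n).Tangent m →ₗ[ℂ] (S.finOrbitSpace lam n).Tangent m →ₗ[ℂ] ℂ,
    (∀ n, S.IsKostantKirillov lam n (κ n)) ∧
      ∀ (n : ℕ) (μ : S.orbitN lam n) (ξ η : (S.orbitNSpace lam n).Tangent μ),
        S.restrictForm lam ω n μ ξ η =
          κ n (S.proj lam n μ) ((S.isMorphism_proj lam n).differential rfl ξ)
            ((S.isMorphism_proj lam n).differential rfl η)

/-- A weak symplectic form on `G · λ`: alternating, closed (its pullback to every `Gₙ · λ` is a
closed regular 2-form), and such that the induced map `ω̃_μ : T_μ(G · λ) → T_μ*(G · λ)` from the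
linear ind-variety `lim T_μ(Gₗ · λ)` to the linear provariety `lim T_μ*(Gₗ · λ)` is injective and
regular (its components `T_μ(Gₗ · λ) → T_μ*(Gₘ · λ)` are morphisms). -/
structure IsWeakSymplectic (lam : S.LieDual) (ω : S.OrbitForm lam) : Prop where
  alternating : ∀ μ, (ω μ).IsAlt
  closed : ∀ n, (S.orbitNSpace lam n).IsClosedTwoForm (S.restrictForm lam ω n)
  injective : ∀ μ, Function.Injective (ω μ)
  regular : ∀ (μ : S.orbit lam) (l m : ℕ) (hl : μ.1 ∈ S.orbitN lam l) (hm : μ.1 ∈ S.orbitN lam m),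
    IsMorphism (linVariety ((S.orbitNSpace lam l).Tangent ⟨μ.1, hl⟩))
      (dualVariety ((S.orbitNSpace lam m).Tangent ⟨μ.1, hm⟩))
      (fun ξ => ω μ (S.tangentOf lam μ l hl ξ) ∘ₗ S.tangentOf lam μ m hm)

end AlgGroupSystem

/-! Although 𝔤* is infinite-dimensional, each Gₙ · λ is visible at a finite level. The functions g ↦
(g · λ - λ)(x), x ∈ 𝔤, cut out the stabilizer of λ in Gₙ; they generate an ideal of a Noetherian
ring, so those with x in some 𝔤_K suffice, and Gₙ · λ is the orbit of Gₙ in the finite-dimensional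
representation 𝔤_K* (`exists_res_injective`). This reduces part 1 to a classical fact: the quotient
structure on an orbit of a connected group in a rational representation is that of a locally closed
subvariety (`OrbitModel.isLocallyClosedEmbedding`), and all its tangent vectors are velocities of
one-parameter motions, that is, images of the Lie algebra (`OrbitModel.velocity_surjective`).

For that fact, let B be the coordinate ring of the group, a domain because a connected algebraic
group is irreducible, and let A ⊆ B be the coordinate ring of the orbit closure. In characteristic
zero B is generically smooth over A, and since A is stable under translations, the consequences of
smoothness hold at every point of the group (`isSubmersiveAt_of_stable`). Three of them are used.
The orbit map is open onto the closure of the orbit, so the quotient topology is the induced one.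
Point derivations of A extend to B, so tangent vectors lift to the group. Finally, a regular
function on the quotient pulls back to a function that is constant on fibres; it lies in the
fraction field of A (`exists_div_of_constant_on_fibres`), and flat descent of divisibility makes its
denominator invertible at the given point (`exists_div_of_smooth`).

For part 2, differentiating the coadjoint action shows that the velocity of X at μ is the functional
x ↦ -μ[X, x], the value of the anchor at -X (`differential_inclN_velN`). As every element of 𝔤 lies
in some 𝔤ₙ, these velocities fill the characteristic distribution (`range_dIncl`).

For part 3, the form is the bivector reduced modulo the kernel of the anchor, transported along di.
On velocities it is μ[X, Y], the pullback of the Kostant-Kirillov form; since velocities exhaust the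
tangent spaces, this determines it. Weak nondegeneracy follows from part 2 and the injectivity of
di. For closedness, vector fields on Gₙ · λ are lifted to 𝔤ₙ-valued functions on Gₙ by means of the
left-invariant frame (`exists_lift_vectorField`). In this frame the form has constant coefficients
λ[X, Y], and Cartan's formula becomes the Jacobi identity (`isClosedTwoForm_omegaInf`). -/

/-! ## Generically smooth extensions of domains -/

section CommutativeAlgebra

open TensorProduct

/-- An element of a finitely generated `ℂ`-algebra that is not nilpotent does not vanish at some
point. -/
theorem exists_algHom_ne_zero {R : Type*} [CommRing R] [Algebra ℂ R] [Algebra.FiniteType ℂ R]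
    {t : R} (ht : ¬IsNilpotent t) : ∃ χ : R →ₐ[ℂ] ℂ, χ t ≠ 0 := by
  let T := Localization.Away t
  have hT : Nontrivial T := by
    rw [← not_subsingleton_iff_nontrivial]
    intro h
    have h1 : (algebraMap R T) 1 = algebraMap R T 0 := Subsingleton.elim _ _
    obtain ⟨⟨_, n, rfl⟩, hc⟩ := (IsLocalization.eq_iff_exists (Submonoid.powers t) T).1 h1
    exact ht ⟨n, by simpa using hc⟩
  have : Algebra.FiniteType ℂ T := inferInstance
  obtain ⟨M, hM⟩ := Ideal.exists_maximal T
  let : Field (T ⧸ M) := Ideal.Quotient.field M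
  have : Algebra.FiniteType ℂ (T ⧸ M) :=
    Algebra.FiniteType.of_surjective (Ideal.Quotient.mkₐ ℂ M) Ideal.Quotient.mk_surjective
  -- Zariski's lemma: the residue field of the localization is finite over ℂ, hence equal to ℂ. The
  -- resulting character of `R` does not kill `t`, which is a unit in `T`.
  have : Module.Finite ℂ (T ⧸ M) := finite_of_finite_type_of_isJacobsonRing ℂ _
  have : Algebra.IsIntegral ℂ (T ⧸ M) := inferInstance
  have hb : Function.Bijective (algebraMap ℂ (T ⧸ M)) :=
    IsAlgClosed.algebraMap_bijective_of_isIntegral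
  let e : ℂ ≃ₐ[ℂ] (T ⧸ M) := AlgEquiv.ofBijective (Algebra.ofId ℂ _) hb
  let φ : R →ₐ[ℂ] (T ⧸ M) := (Ideal.Quotient.mkₐ ℂ M).comp (IsScalarTower.toAlgHom ℂ R T)
  refine ⟨e.symm.toAlgHom.comp φ, ?_⟩
  have hu : IsUnit (φ t) := (IsLocalization.Away.algebraMap_isUnit (S := T) t).map
    (Ideal.Quotient.mkₐ ℂ M)
  exact (hu.map e.symm.toAlgHom).ne_zero

variable {A B : Type u} [CommRing A] [CommRing B] [Algebra ℂ B] [Algebra A B]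

variable (A B) in
-- Generic smoothness. In characteristic zero the extension of fraction fields is formally smooth,
-- and so is `A` → Frac `A`; hence `B` is smooth over `A` at its generic point. The smooth locus is
-- open, so it contains a nonempty basic open set.
theorem exists_smooth_localization_away [IsDomain A] [IsDomain B] [Algebra ℂ A]
    [IsScalarTower ℂ A B] [Algebra.FiniteType ℂ A] [Algebra.FiniteType ℂ B]
    (hinj : Function.Injective (algebraMap A B)) :
    ∃ b : B, b ≠ 0 ∧ Algebra.Smooth A (Localization.Away b) := by
  have : FaithfulSMul A B := (faithfulSMul_iff_algebraMap_injective A B).2 hinj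
  have : IsNoetherianRing A := Algebra.FiniteType.isNoetherianRing ℂ A
  have : Algebra.FiniteType A B := Algebra.FiniteType.of_restrictScalars_finiteType ℂ A B
  have : Algebra.FinitePresentation A B := Algebra.FinitePresentation.of_finiteType.1 inferInstance
  let K := FractionRing A
  let L := FractionRing B
  have : CharZero A := charZero_of_injective_algebraMap (algebraMap ℂ A).injective
  have : CharZero K := charZero_of_injective_algebraMap (IsFractionRing.injective A K)
  let : Algebra K L := FractionRing.liftAlgebra A L
  have : IsScalarTower A K L := FractionRing.isScalarTower_liftAlgebra A L
  have : Algebra.EssFiniteType B L := .of_isLocalization _ (nonZeroDivisors B)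
  have : Algebra.EssFiniteType A L := .comp _ B _
  have : Algebra.EssFiniteType K L := .of_comp A K L
  have h1 : Algebra.FormallySmooth K L := inferInstance
  have h2 : Algebra.FormallySmooth A K := .of_isLocalization (nonZeroDivisors A)
  have h3 : Algebra.FormallySmooth A L := .comp A K L
  -- The local ring at the generic point is the fraction field `L`.
  let p : PrimeSpectrum B := ⟨⊥, Ideal.isPrime_bot⟩
  have hp : p ∈ Algebra.smoothLocus A B := by
    change Algebra.FormallySmooth A (Localization.AtPrime p.asIdeal)
    have e0 : p.asIdeal.primeCompl = nonZeroDivisors B := by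
      ext x
      simp [p, Ideal.primeCompl, mem_nonZeroDivisors_iff_ne_zero]
    have : IsLocalization (nonZeroDivisors B) (Localization.AtPrime p.asIdeal) := by
      rw [← e0]; infer_instance
    let e : L ≃ₐ[B] Localization.AtPrime p.asIdeal :=
      IsLocalization.algEquiv (nonZeroDivisors B) _ _
    exact .of_equiv (e.restrictScalars A)
  obtain ⟨_, ⟨_, ⟨b, rfl⟩, rfl⟩, hpb, hb⟩ :=
    PrimeSpectrum.isBasis_basic_opens.exists_subset_of_mem_open hp Algebra.isOpen_smoothLocus
  refine ⟨b, ?_, Algebra.basicOpen_subset_smoothLocus_iff_smooth.1 hb⟩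
  rintro rfl
  simp at hpb

/-- A point derivation of `A` extends to `B` at the points where `B` is smooth over `A`. -/
theorem exists_derivation_extension [Algebra ℂ A] [IsScalarTower ℂ A B] {b : B}
    [Algebra.Smooth A (Localization.Away b)]
    (ψ : B →ₐ[ℂ] ℂ) (hb : ψ b ≠ 0) (D : A →ₗ[ℂ] ℂ)
    (hD : ∀ x y, D (x * y) = ψ (algebraMap A B x) * D y + ψ (algebraMap A B y) * D x) :
    ∃ E : B →ₗ[ℂ] ℂ, (∀ x y, E (x * y) = ψ x * E y + ψ y * E x) ∧
      ∀ a, E (algebraMap A B a) = D a := by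
  -- A point derivation is the same as a homomorphism to the dual numbers, a ↦ ψ(a) + D(a)ε.
  let φ : A →+* TrivSqZeroExt ℂ ℂ :=
    { toFun := fun a => TrivSqZeroExt.inl (ψ (algebraMap A B a)) + TrivSqZeroExt.inr (D a)
      map_one' := by
        have := hD 1 1
        simp only [mul_one, map_one, one_mul] at this
        have h0 : D 1 = 0 := by linear_combination -this
        ext <;> simp [h0]
      map_mul' := by
        intro x y
        ext <;> simp [hD, mul_comm]
      map_zero' := by ext <;> simp
      map_add' := by intro x y; ext <;> simp }
  let φ0 : A →+* ℂ := (ψ : B →+* ℂ).comp (algebraMap A B)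
  let : Algebra A (TrivSqZeroExt ℂ ℂ) := φ.toAlgebra
  let : Algebra A ℂ := φ0.toAlgebra
  let π : TrivSqZeroExt ℂ ℂ →ₐ[A] ℂ :=
    { (TrivSqZeroExt.fstHom ℂ ℂ ℂ).toRingHom with
      commutes' := by
        intro a
        change TrivSqZeroExt.fst (φ a) = φ0 a
        simp [φ, φ0] }
  have hu : ∀ y : Submonoid.powers b, IsUnit ((ψ : B →+* ℂ) y) := by
    rintro ⟨_, n, rfl⟩
    simpa using pow_ne_zero n hb
  let ψb : Localization.Away b →ₐ[A] ℂ :=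
    { (IsLocalization.lift hu : Localization.Away b →+* ℂ) with
      commutes' := by
        intro a
        change IsLocalization.lift hu (algebraMap A (Localization.Away b) a) = φ0 a
        rw [IsScalarTower.algebraMap_apply A B (Localization.Away b), IsLocalization.lift_eq]
        rfl }
  have hψb : ∀ x, ψb (algebraMap B _ x) = ψ x := fun x => IsLocalization.lift_eq hu x
  have hsurj : Function.Surjective π := fun c => ⟨TrivSqZeroExt.inl c, rfl⟩
  have hker : IsNilpotent (RingHom.ker (π : TrivSqZeroExt ℂ ℂ →+* ℂ)) := by
    refine ⟨2, ?_⟩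
    refine (pow_two (RingHom.ker (π : TrivSqZeroExt ℂ ℂ →+* ℂ))).trans ?_
    rw [Ideal.zero_eq_bot, eq_bot_iff, Ideal.mul_le]
    intro x hx y hy
    have hx' : x.fst = 0 := hx
    have hy' : y.fst = 0 := hy
    rw [Ideal.mem_bot]
    ext <;> simp [hx', hy']
  -- Formal smoothness lifts the character of the localization along the square-zero extension ℂ[ε]
  -- → ℂ, compatibly with `φ` on `A`; the ε-component of the lift is the extended derivation.
  let l := Algebra.FormallySmooth.liftOfSurjective ψb π hsurj hker
  have hl : ∀ x, (l x).fst = ψb x := fun x =>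
    Algebra.FormallySmooth.liftOfSurjective_apply ψb π hsurj hker x
  -- The lift is only known to be `A`-linear; it is ℂ-linear because `D` kills constants.
  have hlC : ∀ c : ℂ, l (algebraMap B _ (algebraMap ℂ B c)) = TrivSqZeroExt.inl c := by
    intro c
    rw [IsScalarTower.algebraMap_apply ℂ A B, ← IsScalarTower.algebraMap_apply A B, l.commutes]
    change φ _ = _
    have h0 : D (algebraMap ℂ A c) = 0 := by
      have := hD 1 1
      simp only [mul_one, map_one, one_mul] at this
      rw [Algebra.algebraMap_eq_smul_one, map_smul]
      have h0 : D 1 = 0 := by linear_combination -this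
      rw [h0, smul_zero]
    ext
    · simp [φ, ← IsScalarTower.algebraMap_apply ℂ A B]
    · simp [φ, h0]
  refine ⟨{ toFun := fun x => (l (algebraMap B _ x)).snd
            map_add' := fun x y => by simp
            map_smul' := fun c x => by
              rw [Algebra.smul_def, map_mul, map_mul, hlC]
              simp }, ?_, ?_⟩
  · intro x y
    change (l (algebraMap B _ (x * y))).snd = _
    rw [map_mul, map_mul, TrivSqZeroExt.snd_mul, hl, hl, hψb, hψb]
    simp [mul_comm]
  · intro a
    change (l (algebraMap B _ (algebraMap A B a))).snd = _
    rw [← IsScalarTower.algebraMap_apply A B, l.commutes]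
    change (φ a).snd = _
    simp [φ]

/-- The equational criterion for flatness, applied to the relation p x - q y = 0: it is a
combination of relations p a = q a' that already hold in `R`. -/
theorem Module.Flat.exists_of_algebraMap_mul_eq {R M : Type*} [CommRing R] [CommRing M]
    [Algebra R M] [Module.Flat R M] {p q : R} {x y : M}
    (h : algebraMap R M q * y = algebraMap R M p * x) :
    ∃ (k : ℕ) (a a' : Fin k → R) (z : Fin k → M), x = ∑ j, algebraMap R M (a j) * z j ∧
      ∀ j, p * a j = q * a' j := by
  have h0 : ∑ i, (![p, -q] : Fin 2 → R) i • (![x, y] : Fin 2 → M) i = 0 := by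
    simp [Fin.sum_univ_two, Algebra.smul_def, h]
  obtain ⟨k, a, z, hx, ha⟩ := Module.Flat.isTrivialRelation_of_sum_smul_eq_zero (R := R) (M := M) h0
  refine ⟨k, a 0, a 1, z, ?_, fun j => ?_⟩
  · simpa [Algebra.smul_def] using hx 0
  have := ha j
  simp only [Fin.sum_univ_two, Matrix.cons_val_zero, Matrix.cons_val_one] at this
  linear_combination this

/-- Flat descent of divisibility. -/
theorem exists_div_of_smooth {b : B} [Algebra.Smooth A (Localization.Away b)]
    (ψ : B →ₐ[ℂ] ℂ) (hb : ψ b ≠ 0) {p q : A} {c d : B} (hd : ψ d ≠ 0)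
    (h : algebraMap A B q * c = algebraMap A B p * d) :
    ∃ r s : A, ψ (algebraMap A B s) ≠ 0 ∧ p * s = q * r := by
  have hfl : Module.Flat A (Localization.Away b) := Algebra.Smooth.flat A _
  have hu : ∀ y : Submonoid.powers b, IsUnit ((ψ : B →+* ℂ) y) := by
    rintro ⟨_, n, rfl⟩
    simpa using pow_ne_zero n hb
  let ψb : Localization.Away b →+* ℂ := IsLocalization.lift hu
  have hψb : ∀ x, ψb (algebraMap B _ x) = ψ x := fun x => IsLocalization.lift_eq hu x
  have h0 : algebraMap A (Localization.Away b) q * algebraMap B (Localization.Away b) c =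
      algebraMap A (Localization.Away b) p * algebraMap B (Localization.Away b) d := by
    rw [IsScalarTower.algebraMap_apply A B, ← map_mul, h, map_mul,
      ← IsScalarTower.algebraMap_apply A B]
  obtain ⟨k, a, a', y, hx, ha⟩ := Module.Flat.exists_of_algebraMap_mul_eq h0
  -- Here `d` = Σ aⱼ yⱼ in the localization, and ψ(d) ≠ 0, so some aⱼ does not vanish at ψ; it
  -- serves as the new denominator.
  have h1 : ∃ j, ψ (algebraMap A B (a j)) ≠ 0 := by
    by_contra! hcon
    apply hd
    have := congrArg ψb hx
    rw [hψb] at this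
    rw [this, map_sum]
    refine Finset.sum_eq_zero fun j _ => ?_
    rw [map_mul, IsScalarTower.algebraMap_apply A B (Localization.Away b), hψb, hcon, zero_mul]
  obtain ⟨j, hj⟩ := h1
  exact ⟨a' j, a j, hj, ha j⟩

/-- The map on closed points is open at the points where `B` is smooth over `A`. -/
theorem exists_lift_of_smooth [Algebra ℂ A] [IsScalarTower ℂ A B]
    [Algebra.FiniteType ℂ B] {b : B} [Algebra.Smooth A (Localization.Away b)]
    (ψ : B →ₐ[ℂ] ℂ) (hb : ψ b ≠ 0) {c : B} (hc : ψ c ≠ 0) :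
    ∃ a : A, ψ (algebraMap A B a) ≠ 0 ∧ ∀ χ : A →ₐ[ℂ] ℂ, χ a ≠ 0 →
      ∃ ψ' : B →ₐ[ℂ] ℂ, ψ' c ≠ 0 ∧ ∀ x, ψ' (algebraMap A B x) = χ x := by
  have hfl : Module.Flat A (Localization.Away b) := Algebra.Smooth.flat A _
  have hfp : Algebra.FinitePresentation A (Localization.Away b) := inferInstance
  -- Flatness gives going-down, and a finitely presented map with going-down is open on spectra.
  have hopen : IsOpenMap (PrimeSpectrum.comap (algebraMap A (Localization.Away b))) :=
    PrimeSpectrum.isOpenMap_comap_of_hasGoingDown_of_finitePresentation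
  have hu : ∀ y : Submonoid.powers b, IsUnit ((ψ : B →+* ℂ) y) := by
    rintro ⟨_, n, rfl⟩
    simpa using pow_ne_zero n hb
  let ψb : Localization.Away b →+* ℂ := IsLocalization.lift hu
  have hψb : ∀ x, ψb (algebraMap B _ x) = ψ x := fun x => IsLocalization.lift_eq hu x
  let P : PrimeSpectrum (Localization.Away b) := ⟨RingHom.ker ψb, RingHom.ker_isPrime ψb⟩
  let c' := algebraMap B (Localization.Away b) c
  have hP : P ∈ PrimeSpectrum.basicOpen c' := by
    change ψb c' ≠ 0
    rwa [hψb]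
  have ho := hopen _ (PrimeSpectrum.basicOpen c').isOpen
  obtain ⟨_, ⟨_, ⟨a, rfl⟩, rfl⟩, hPa, ha⟩ :=
    PrimeSpectrum.isBasis_basic_opens.exists_subset_of_mem_open (Set.mem_image_of_mem _ hP) ho
  refine ⟨a, ?_, fun χ hχ => ?_⟩
  · have h1 : ψb (algebraMap A _ a) ≠ 0 := hPa
    rwa [IsScalarTower.algebraMap_apply A B, hψb] at h1
  · let Q : PrimeSpectrum A := ⟨RingHom.ker χ, RingHom.ker_isPrime χ⟩
    obtain ⟨Q', hQ', e⟩ := ha (show Q ∈ PrimeSpectrum.basicOpen a from hχ)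
    -- Openness only yields a prime over ker χ that avoids `c`. The Nullstellensatz in B/J replaces
    -- it by a closed point, which still restricts to χ since it kills the image of ker χ.
    let J : Ideal B := Q'.asIdeal.comap (algebraMap B _)
    have hJ : J.IsPrime := inferInstance
    have hcJ : c ∉ J := hQ'
    have hnil : ¬IsNilpotent (Ideal.Quotient.mk J c) := by
      rw [isNilpotent_iff_eq_zero]
      rwa [Ideal.Quotient.eq_zero_iff_mem]
    have : Algebra.FiniteType ℂ (B ⧸ J) :=
      Algebra.FiniteType.of_surjective (Ideal.Quotient.mkₐ ℂ J) Ideal.Quotient.mk_surjective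
    obtain ⟨θ, hθ⟩ := exists_algHom_ne_zero hnil
    refine ⟨θ.comp (Ideal.Quotient.mkₐ ℂ J), hθ, fun x => ?_⟩
    have hx : x - algebraMap ℂ A (χ x) ∈ Q.asIdeal := by
      change χ _ = 0
      simp
    rw [← e] at hx
    have hx' : algebraMap A B (x - algebraMap ℂ A (χ x)) ∈ J := by
      change algebraMap B (Localization.Away b) _ ∈ Q'.asIdeal
      rw [← IsScalarTower.algebraMap_apply A B]
      exact hx
    have h2 : θ (Ideal.Quotient.mkₐ ℂ J (algebraMap A B (x - algebraMap ℂ A (χ x)))) = 0 := by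
      rw [Ideal.Quotient.mkₐ_eq_mk, Ideal.Quotient.eq_zero_iff_mem.2 hx', map_zero]
    rw [map_sub, map_sub, map_sub, ← IsScalarTower.algebraMap_apply ℂ A B, AlgHom.commutes,
      AlgHom.commutes, sub_eq_zero] at h2
    exact h2

/-! ### Functions that are constant on fibres -/

/-- An element f outside `K` can be sent to two different places: K[f] has two `K`-homomorphisms to
an algebraically closed field with different values on f. Together they define a homomorphism of
K[f] ⊗ K[f] that sends f ⊗ 1 - 1 ⊗ f to a nonzero element of a field. Characteristic zero provides
separability when f is algebraic. -/
theorem not_isNilpotent_tmul_sub {K L : Type*} [Field K] [Field L] [Algebra K L] [CharZero K]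
    {f : L} (hf : f ∉ Set.range (algebraMap K L)) :
    ¬IsNilpotent (f ⊗ₜ[K] (1 : L) - (1 : L) ⊗ₜ[K] f) := by
  let E := Algebra.adjoin K {f}
  let f0 : E := ⟨f, Algebra.self_mem_adjoin_singleton K f⟩
  let i : E →ₐ[K] L := E.val
  have hi : Function.Injective (Algebra.TensorProduct.map i i) :=
    TensorProduct.map_injective_of_flat_flat i.toLinearMap i.toLinearMap
      Subtype.val_injective Subtype.val_injective
  have e : f ⊗ₜ[K] (1 : L) - (1 : L) ⊗ₜ[K] f =
      Algebra.TensorProduct.map i i (f0 ⊗ₜ[K] (1 : E) - (1 : E) ⊗ₜ[K] f0) := by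
    simp [i, f0]
  rw [e, IsNilpotent.map_iff hi]
  let Ω := AlgebraicClosure L
  obtain ⟨y, hy, hne⟩ : ∃ y : Ω, Polynomial.aeval y (minpoly K f) = 0 ∧ algebraMap L Ω f ≠ y := by
    by_cases hal : IsIntegral K f
    · have hsep : (minpoly K f).Separable := (minpoly.irreducible hal).separable
      have hroot : Polynomial.aeval (algebraMap L Ω f) (minpoly K f) = 0 := by
        rw [Polynomial.aeval_algebraMap_apply, minpoly.aeval, map_zero]
      have hcard : Fintype.card ((minpoly K f).rootSet Ω) = (minpoly K f).natDegree :=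
        Polynomial.card_rootSet_eq_natDegree hsep (IsAlgClosed.splits _)
      have hdeg : 2 ≤ (minpoly K f).natDegree := (minpoly.two_le_natDegree_iff hal).2 hf
      have : Nontrivial ((minpoly K f).rootSet Ω) := by
        rw [← Fintype.one_lt_card_iff_nontrivial]
        omega
      obtain ⟨⟨x, hx⟩, hne⟩ := exists_ne (⟨algebraMap L Ω f,
        (Polynomial.mem_rootSet_of_ne (minpoly.ne_zero hal)).2 hroot⟩ : (minpoly K f).rootSet Ω)
      exact ⟨x, (Polynomial.mem_rootSet_of_ne (minpoly.ne_zero hal)).1 hx,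
        fun h => hne (Subtype.ext h.symm)⟩
    -- For transcendental f the polynomial `minpoly K f` is 0 by convention, so any y ≠ f will do.
    · exact ⟨algebraMap L Ω f + 1, by rw [minpoly.eq_zero hal, map_zero], by simp⟩
  let σ : E →ₐ[K] Ω := (IsScalarTower.toAlgHom K L Ω).comp i
  let τ : E →ₐ[K] Ω := Algebra.adjoin.liftSingleton K f y hy
  have hτ : τ f0 = y := by
    have h1 : AlgEquiv.adjoinSingletonEquivAdjoinRootMinpoly K f f0 = AdjoinRoot.root _ := by
      rw [← AlgEquiv.eq_symm_apply]
      simp [f0]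
    change AdjoinRoot.liftAlgHom _ _ y hy (AlgEquiv.adjoinSingletonEquivAdjoinRootMinpoly K f f0) = y
    rw [h1]
    exact AdjoinRoot.liftAlgHom_root _ _ y hy
  intro hn
  have := hn.map (Algebra.TensorProduct.lift σ τ fun _ _ => Commute.all _ _)
  simp only [map_sub, Algebra.TensorProduct.lift_tmul, map_one, mul_one, one_mul, hτ] at this
  exact sub_ne_zero.2 hne (isNilpotent_iff_eq_zero.1 this)

/-- A rational function `c / d` that is constant on the fibres over `A`, where it is defined and
`e` does not vanish, lies in the fraction field of `A`. -/
theorem exists_div_of_constant_on_fibres [IsDomain A] [IsDomain B] [Algebra ℂ A]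
    [IsScalarTower ℂ A B] [Algebra.FiniteType ℂ B] (hinj : Function.Injective (algebraMap A B)) {c d e : B}
    (hd : d ≠ 0) (he : e ≠ 0)
    (h : ∀ ψ ψ' : B →ₐ[ℂ] ℂ, (∀ a : A, ψ (algebraMap A B a) = ψ' (algebraMap A B a)) →
      ψ d ≠ 0 → ψ' d ≠ 0 → ψ e ≠ 0 → ψ' e ≠ 0 → ψ c * ψ' d = ψ' c * ψ d) :
    ∃ p q : A, q ≠ 0 ∧ algebraMap A B q * c = algebraMap A B p * d := by
  have : FaithfulSMul A B := (faithfulSMul_iff_algebraMap_injective A B).2 hinj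
  have : CharZero A := charZero_of_injective_algebraMap (algebraMap ℂ A).injective
  let K := FractionRing A
  let L := FractionRing B
  have : CharZero K := charZero_of_injective_algebraMap (IsFractionRing.injective A K)
  let _ : Algebra K L := FractionRing.liftAlgebra A L
  have : IsScalarTower A K L := FractionRing.isScalarTower_liftAlgebra A L
  have hBL : Function.Injective (algebraMap B L) := IsFractionRing.injective B L
  have hd' : algebraMap B L d ≠ 0 := fun h0 => hd (hBL (by rw [h0, map_zero]))
  have he' : algebraMap B L e ≠ 0 := fun h0 => he (hBL (by rw [h0, map_zero]))
  let f : L := algebraMap B L c / algebraMap B L d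
  by_cases hf : f ∈ Set.range (algebraMap K L)
  · obtain ⟨k, hk⟩ := hf
    obtain ⟨p, q, hq, rfl⟩ := IsFractionRing.div_surjective (A := A) k
    have hq0 : q ≠ 0 := nonZeroDivisors.ne_zero hq
    refine ⟨p, q, hq0, hBL ?_⟩
    have hq' : algebraMap B L (algebraMap A B q) ≠ 0 := fun h0 =>
      hq0 (hinj (hBL (by rw [h0, map_zero, map_zero])))
    rw [map_div₀, ← IsScalarTower.algebraMap_apply, ← IsScalarTower.algebraMap_apply,
      IsScalarTower.algebraMap_apply A B L, IsScalarTower.algebraMap_apply A B L,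
      div_eq_div_iff hq' hd'] at hk
    rw [map_mul, map_mul, hk, mul_comm]
  · exfalso
    let g : B →ₐ[A] L := IsScalarTower.toAlgHom A B L
    let Φ : B ⊗[A] B →ₐ[A] L ⊗[K] L := Algebra.TensorProduct.lift
      (((Algebra.TensorProduct.includeLeft : L →ₐ[K] L ⊗[K] L).restrictScalars A).comp g)
      (((Algebra.TensorProduct.includeRight : L →ₐ[K] L ⊗[K] L).restrictScalars A).comp g) fun _ _ => Commute.all _ _
    have hΦ : ∀ x y : B, Φ (x ⊗ₜ y) = algebraMap B L x ⊗ₜ[K] algebraMap B L y := by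
      intro x y
      simp [Φ, g]
    -- A closed point of B ⊗ B over `A` is a pair of points of `B` in the same fibre. The first
    -- factor of `t` is the failure of c/d to agree at the two points; the second restricts to pairs
    -- where `d` and `e` do not vanish, and it becomes a unit in L ⊗ L.
    let t : B ⊗[A] B := (c ⊗ₜ d - d ⊗ₜ c) * ((d * e) ⊗ₜ (d * e))
    have ht : ¬IsNilpotent t := by
      intro hn
      have h1 := hn.map Φ
      have h2 : Φ t = (f ⊗ₜ[K] (1 : L) - (1 : L) ⊗ₜ[K] f) *
          ((algebraMap B L (d * (d * e))) ⊗ₜ[K] (algebraMap B L (d * (d * e)))) := by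
        have e1 : algebraMap B L c * algebraMap B L (d * e) =
            f * algebraMap B L (d * (d * e)) := by
          rw [map_mul _ d (d * e), ← mul_assoc, div_mul_cancel₀ _ hd']
        have e2 : algebraMap B L d * algebraMap B L (d * e) =
            1 * algebraMap B L (d * (d * e)) := by
          rw [map_mul _ d (d * e), one_mul]
        rw [map_mul, map_sub, hΦ, hΦ, hΦ, sub_mul, sub_mul, Algebra.TensorProduct.tmul_mul_tmul,
          Algebra.TensorProduct.tmul_mul_tmul, Algebra.TensorProduct.tmul_mul_tmul,
          Algebra.TensorProduct.tmul_mul_tmul, e1, e2]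
      rw [h2] at h1
      have hu : IsUnit ((algebraMap B L (d * (d * e))) ⊗ₜ[K] (algebraMap B L (d * (d * e)))) := by
        have h3 : algebraMap B L (d * (d * e)) ≠ 0 := by
          rw [map_mul, map_mul]
          exact mul_ne_zero hd' (mul_ne_zero hd' he')
        refine IsUnit.of_mul_eq_one ((algebraMap B L (d * (d * e)))⁻¹ ⊗ₜ[K]
          (algebraMap B L (d * (d * e)))⁻¹) ?_
        rw [Algebra.TensorProduct.tmul_mul_tmul, mul_inv_cancel₀ h3]
        rfl
      obtain ⟨n, hn⟩ := h1
      rw [mul_pow] at hn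
      exact not_isNilpotent_tmul_sub hf ⟨n, (hu.pow n).mul_left_eq_zero.1 hn⟩
    have : Algebra.FiniteType B (B ⊗[A] B) := by
      have : Algebra.FiniteType A B := Algebra.FiniteType.of_restrictScalars_finiteType ℂ A B
      infer_instance
    have : Algebra.FiniteType ℂ (B ⊗[A] B) := Algebra.FiniteType.trans (S := B) inferInstance this
    obtain ⟨χ, hχ⟩ := exists_algHom_ne_zero ht
    let ψ : B →ₐ[ℂ] ℂ := χ.comp (Algebra.TensorProduct.includeLeft (R := A) (S := ℂ))
    let ψ' : B →ₐ[ℂ] ℂ :=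
      χ.comp ((Algebra.TensorProduct.includeRight (R := A) (A := B)).restrictScalars ℂ)
    have e1 : ∀ x y : B, χ (x ⊗ₜ y) = ψ x * ψ' y := by
      intro x y
      change _ = χ (x ⊗ₜ 1) * χ (1 ⊗ₜ y)
      rw [← map_mul, Algebra.TensorProduct.tmul_mul_tmul, mul_one, one_mul]
    have e2 : ∀ a : A, ψ (algebraMap A B a) = ψ' (algebraMap A B a) := by
      intro a
      change χ (_ ⊗ₜ 1) = χ (1 ⊗ₜ _)
      rw [Algebra.algebraMap_eq_smul_one, TensorProduct.smul_tmul]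
    simp only [t, map_mul, map_sub, e1] at hχ
    obtain ⟨h1, h2⟩ := mul_ne_zero_iff.1 hχ
    obtain ⟨h3, h4⟩ := mul_ne_zero_iff.1 h2
    obtain ⟨h5, h6⟩ := mul_ne_zero_iff.1 h3
    obtain ⟨h7, h8⟩ := mul_ne_zero_iff.1 h4
    apply h1
    rw [h ψ ψ' e2 h5 h7 h6 h8]
    ring

/-- `B` behaves like a smooth `A`-algebra at the closed point `ψ`: point derivations extend, the
map on closed points is open, and divisibility descends. -/
structure IsSubmersiveAt (A : Type u) {B : Type u} [CommRing A] [CommRing B] [Algebra ℂ A]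
    [Algebra ℂ B] [Algebra A B] (ψ : B →ₐ[ℂ] ℂ) : Prop where
  extend : ∀ D : A →ₗ[ℂ] ℂ,
    (∀ x y, D (x * y) = ψ (algebraMap A B x) * D y + ψ (algebraMap A B y) * D x) →
    ∃ E : B →ₗ[ℂ] ℂ, (∀ x y, E (x * y) = ψ x * E y + ψ y * E x) ∧ ∀ a, E (algebraMap A B a) = D a
  lift : ∀ c : B, ψ c ≠ 0 → ∃ a : A, ψ (algebraMap A B a) ≠ 0 ∧ ∀ χ : A →ₐ[ℂ] ℂ, χ a ≠ 0 →
    ∃ ψ' : B →ₐ[ℂ] ℂ, ψ' c ≠ 0 ∧ ∀ x, ψ' (algebraMap A B x) = χ x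
  div : ∀ (p q : A) (c d : B), ψ d ≠ 0 → algebraMap A B q * c = algebraMap A B p * d →
    ∃ r s : A, ψ (algebraMap A B s) ≠ 0 ∧ p * s = q * r

variable (A B) in
theorem exists_isSubmersiveAt [IsDomain A] [IsDomain B] [Algebra ℂ A]
    [IsScalarTower ℂ A B] [Algebra.FiniteType ℂ A] [Algebra.FiniteType ℂ B]
    (hinj : Function.Injective (algebraMap A B)) :
    ∃ b : B, b ≠ 0 ∧ ∀ ψ : B →ₐ[ℂ] ℂ, ψ b ≠ 0 → IsSubmersiveAt A ψ := by
  obtain ⟨b, hb, hsm⟩ := exists_smooth_localization_away A B hinj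
  exact ⟨b, hb, fun ψ hψ => ⟨exists_derivation_extension ψ hψ,
    fun c hc => exists_lift_of_smooth ψ hψ hc,
    fun p q c d hd h => exists_div_of_smooth ψ hψ hd h⟩⟩

end CommutativeAlgebra

/-! ## Irreducibility of connected algebraic groups -/

/-- There are finitely many irreducible components, and a component is not covered by the others, so
some point lies on only one. By homogeneity this holds for every point: the components are disjoint,
hence clopen, and connectedness leaves a single one. -/
theorem PreirreducibleSpace.of_connected_of_transitive {X : Type*} [TopologicalSpace X]
    [TopologicalSpace.NoetherianSpace X] [ConnectedSpace X]
    (h : ∀ x y : X, ∃ e : X ≃ₜ X, e x = y) : PreirreducibleSpace X := by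
  have hfin : (irreducibleComponents X).Finite :=
    TopologicalSpace.NoetherianSpace.finite_irreducibleComponents
  -- some point lies on a single component
  obtain ⟨x0⟩ : Nonempty X := inferInstance
  have hZ0 : irreducibleComponent x0 ∈ irreducibleComponents X :=
    irreducibleComponent_mem_irreducibleComponents x0
  obtain ⟨y, hy, hyu⟩ : ∃ y ∈ irreducibleComponent x0,
      ∀ Z ∈ irreducibleComponents X, y ∈ Z → Z = irreducibleComponent x0 := by
    by_contra! hcon
    have hcov : irreducibleComponent x0 ⊆
        ⋃₀ (irreducibleComponents X \ {irreducibleComponent x0}) := by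
      intro y hy
      obtain ⟨Z, hZ, hyZ, hne⟩ := hcon y hy
      exact ⟨Z, ⟨hZ, hne⟩, hyZ⟩
    obtain ⟨Z, hZ, hsub⟩ := (isIrreducible_iff_sUnion_isClosed.1
      (isIrreducible_irreducibleComponent (x := x0)))
      (hfin.subset Set.sdiff_subset).toFinset
      (fun Z hZ => isClosed_of_mem_irreducibleComponents Z ((Set.Finite.mem_toFinset _).1 hZ).1)
      (by simpa using hcov)
    have hZ' := (Set.Finite.mem_toFinset _).1 hZ
    exact hZ'.2 (Set.Subset.antisymm (hZ0.2 hZ'.1.1 hsub) hsub)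
  have key : ∀ x : X, ∀ Z ∈ irreducibleComponents X, ∀ Z' ∈ irreducibleComponents X,
      x ∈ Z → x ∈ Z' → Z = Z' := by
    intro x Z hZ Z' hZ' hx hx'
    obtain ⟨e, he⟩ := h x y
    have himg : ∀ Z ∈ irreducibleComponents X, e '' Z ∈ irreducibleComponents X := by
      intro Z hZ
      refine ⟨hZ.1.image e e.continuous.continuousOn, fun T hT hle => ?_⟩
      have h1 : Z ≤ e.symm '' T := by
        intro z hz
        exact ⟨e z, hle ⟨z, hz, rfl⟩, e.symm_apply_apply z⟩
      have h2 := hZ.2 (hT.image e.symm e.symm.continuous.continuousOn) h1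
      intro t ht
      exact ⟨e.symm t, h2 ⟨t, ht, rfl⟩, e.apply_symm_apply t⟩
    have h1 := hyu _ (himg Z hZ) ⟨x, hx, he⟩
    have h2 := hyu _ (himg Z' hZ') ⟨x, hx', he⟩
    exact e.injective.image_injective (h1.trans h2.symm)
  have hopen : IsOpen (irreducibleComponent x0) := by
    have e : (irreducibleComponent x0)ᶜ =
        ⋃₀ (irreducibleComponents X \ {irreducibleComponent x0}) := by
      ext z
      constructor
      · intro hz
        refine ⟨irreducibleComponent z, ⟨irreducibleComponent_mem_irreducibleComponents z, ?_⟩,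
          mem_irreducibleComponent⟩
        intro he
        exact hz (he ▸ mem_irreducibleComponent)
      · rintro ⟨Z, ⟨hZ, hne⟩, hz⟩ hz0
        exact hne (key z Z hZ _ hZ0 hz hz0)
    rw [← isClosed_compl_iff, e, Set.sUnion_eq_biUnion]
    exact (hfin.subset Set.sdiff_subset).isClosed_biUnion
      fun Z hZ => isClosed_of_mem_irreducibleComponents Z hZ.1
  have huniv : irreducibleComponent x0 = Set.univ :=
    IsClopen.eq_univ ⟨isClosed_irreducibleComponent, hopen⟩ ⟨x0, mem_irreducibleComponent⟩
  exact ⟨huniv ▸ (isIrreducible_irreducibleComponent (x := x0)).2⟩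

namespace AffineAlgGroup

open SpaceWithFunctions

variable {G : Type u} [Group G] [AffineAlgGroup G]

instance : Algebra.FiniteType ℂ (coord (G := G)) :=
  (Subalgebra.fg_iff_finiteType _).1 (fg (G := G))

instance : IsNoetherianRing (coord (G := G)) := Algebra.FiniteType.isNoetherianRing ℂ _

variable (G) in
-- The topology is induced from the prime spectrum of the Noetherian coordinate ring.
theorem noetherianSpace : @TopologicalSpace.NoetherianSpace G (groupVariety G).top := by
  let _ : TopologicalSpace G := (groupVariety G).top
  let ev : G → PrimeSpectrum (coord (G := G)) := fun g =>
    ⟨RingHom.ker ((Pi.evalAlgHom ℂ (fun _ : G => ℂ) g).comp (coord (G := G)).val),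
      RingHom.ker_isPrime _⟩
  have hev : Topology.IsInducing ev := by
    constructor
    rw [PrimeSpectrum.isTopologicalBasis_basic_opens.eq_generateFrom, induced_generateFrom_eq]
    change TopologicalSpace.generateFrom _ = _
    congr 1
    ext U
    constructor
    · rintro ⟨a, ha, rfl⟩
      exact ⟨_, ⟨⟨a, ha⟩, rfl⟩, rfl⟩
    · rintro ⟨_, ⟨a, rfl⟩, rfl⟩
      exact ⟨a.1, a.2, rfl⟩
  exact hev.noetherianSpace

/-- Left translations are homeomorphisms. -/
def leftHomeomorph (h : G) : @Homeomorph G G (groupVariety G).top (groupVariety G).top :=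
  let _ : TopologicalSpace G := (groupVariety G).top
  { toEquiv := Equiv.mulLeft h
    continuous_toFun := (isMorphism_affine _ _ (fun x => h * x) fun _ hf => left_mem hf h).continuous
    continuous_invFun :=
      (isMorphism_affine _ _ (fun x => h⁻¹ * x) fun _ hf => left_mem hf h⁻¹).continuous }

theorem irreducibleSpace (hG : @ConnectedSpace G (groupVariety G).top) :
    @IrreducibleSpace G (groupVariety G).top := by
  let _ : TopologicalSpace G := (groupVariety G).top
  have := noetherianSpace G
  have : PreirreducibleSpace G := PreirreducibleSpace.of_connected_of_transitive fun x y =>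
    ⟨leftHomeomorph (y * x⁻¹), by change y * x⁻¹ * x = y; simp⟩
  exact { toNonempty := ⟨1⟩ }

/-- The nonvanishing sets of two nonzero functions are nonempty and open, so they meet in an
irreducible space. -/
theorem isDomain_coord (hG : @ConnectedSpace G (groupVariety G).top) :
    IsDomain (coord (G := G)) := by
  let _ : TopologicalSpace G := (groupVariety G).top
  have : IrreducibleSpace G := irreducibleSpace hG
  have : NoZeroDivisors (coord (G := G)) := by
    constructor
    intro a b hab
    by_contra! hcon
    obtain ⟨ha, hb⟩ := hcon
    have hne : ∀ f : coord (G := G), f ≠ 0 → Set.Nonempty {x | f.1 x ≠ 0} := by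
      intro f hf
      by_contra hcon
      apply hf
      apply Subtype.ext
      funext x
      by_contra hx
      exact hcon ⟨x, hx⟩
    have hoa : IsOpen {x | a.1 x ≠ 0} := affine_isOpen _ a.2
    have hob : IsOpen {x | b.1 x ≠ 0} := affine_isOpen _ b.2
    obtain ⟨x, hx1, hx2⟩ := nonempty_preirreducible_inter hoa hob (hne a ha) (hne b hb)
    have := congrFun (congrArg Subtype.val hab) x
    exact mul_ne_zero hx1 hx2 this
  exact NoZeroDivisors.to_isDomain _

/-! ## Subalgebras of the coordinate ring that are stable under translations -/

/-- The evaluation at a point of `G`. -/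
def evalAt (g : G) : coord (G := G) →ₐ[ℂ] ℂ :=
  (Pi.evalAlgHom ℂ (fun _ : G => ℂ) g).comp (coord (G := G)).val

theorem evalAt_apply (g : G) (f : coord (G := G)) : evalAt g f = f.1 g := rfl

theorem leftTr_leftTr_inv (k : G) (f : coord (G := G)) : leftTr k (leftTr k⁻¹ f) = f := by
  apply Subtype.ext; funext y; simp [leftTr_apply]

theorem exists_translate_ne_zero {b : coord (G := G)} (hb : b ≠ 0) (g : G) :
    ∃ k : G, b.1 (k * g) ≠ 0 := by
  by_contra! hcon
  apply hb
  apply Subtype.ext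
  funext x
  have := hcon (x * g⁻¹)
  simpa using this

section Stable

variable [IsDomain (coord (G := G))] {A : Subalgebra ℂ (coord (G := G))}

/-- The restriction of a left translation to a stable subalgebra. -/
def leftTrStable (hA : ∀ h, ∀ a ∈ A, leftTr h a ∈ A) (k : G) : A →ₐ[ℂ] A :=
  ((leftTr k).comp A.val).codRestrict A fun a => hA k a.1 a.2

/-- Generic smoothness gives the result where some b ≠ 0 does not vanish. A suitable translate kg of
`g` is such a point, and left translation by k, an automorphism of the pair `A` ⊆ `coord`,
transports the three properties from kg to `g`. -/
theorem isSubmersiveAt_of_stable (hfg : A.FG) (hA : ∀ h, ∀ a ∈ A, leftTr h a ∈ A) (g : G) :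
    IsSubmersiveAt A (evalAt g) := by
  have : Algebra.FiniteType ℂ A := (Subalgebra.fg_iff_finiteType _).1 hfg
  obtain ⟨b, hb, hsub⟩ := exists_isSubmersiveAt A (coord (G := G)) Subtype.val_injective
  obtain ⟨k, hk⟩ := exists_translate_ne_zero hb g
  have H := hsub (evalAt (k * g)) hk
  have hk1 : ∀ x : A, leftTrStable hA k (leftTrStable hA k⁻¹ x) = x := fun x =>
    Subtype.ext (leftTr_leftTr_inv k x.1)
  have hk2 : ∀ x : coord (G := G), evalAt (k * g) (leftTr k⁻¹ x) = evalAt g x := fun x => by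
    simp only [evalAt_apply, leftTr_apply, inv_mul_cancel_left]
  refine ⟨fun D hD => ?_, fun c hc => ?_, fun p q c d hd h => ?_⟩
  · obtain ⟨E, hE, hED⟩ := H.extend (D ∘ₗ (leftTrStable hA k).toLinearMap) (fun x y => by
      have := hD (leftTrStable hA k x) (leftTrStable hA k y)
      rw [← map_mul] at this
      exact this)
    refine ⟨E ∘ₗ (leftTr k⁻¹).toLinearMap, fun x y => ?_, fun a => ?_⟩
    · simp only [LinearMap.comp_apply, AlgHom.toLinearMap_apply, map_mul, hE, hk2]
    · have h1 := hED (leftTrStable hA k⁻¹ a)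
      refine h1.trans ?_
      rw [LinearMap.comp_apply, AlgHom.toLinearMap_apply, hk1]
  · obtain ⟨a, ha, h⟩ := H.lift (leftTr k⁻¹ c) (by rwa [hk2])
    refine ⟨leftTrStable hA k a, ha, fun χ hχ => ?_⟩
    obtain ⟨ψ, hψc, hψ⟩ := h (χ.comp (leftTrStable hA k)) hχ
    refine ⟨ψ.comp (leftTr k⁻¹), hψc, fun x => ?_⟩
    refine (hψ (leftTrStable hA k⁻¹ x)).trans ?_
    rw [AlgHom.comp_apply, hk1]
  · obtain ⟨r, s, hs, hrs⟩ := H.div (leftTrStable hA k⁻¹ p) (leftTrStable hA k⁻¹ q)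
      (leftTr k⁻¹ c) (leftTr k⁻¹ d) (by rwa [hk2]) (by
        have := congrArg (leftTr k⁻¹) h
        rwa [map_mul, map_mul] at this)
    refine ⟨leftTrStable hA k r, leftTrStable hA k s, hs, ?_⟩
    have h1 := congrArg (leftTrStable hA k) hrs
    rwa [map_mul, map_mul, hk1, hk1] at h1

end Stable

end AffineAlgGroup

/-! ## Orbits of algebraic groups in linear representations -/

namespace SpaceWithFunctions

section Poly

variable {W : Type u} [AddCommGroup W] [Module ℂ W]

theorem eval_mem_polyFns (x : W) : (fun μ : Dual ℂ W => μ x) ∈ polyFns W :=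
  Algebra.subset_adjoin ⟨x, rfl⟩

theorem linear_mem_polyFns [FiniteDimensional ℂ W] (l : Dual ℂ (Dual ℂ W)) :
    (fun μ => l μ) ∈ polyFns W := by
  have : (fun μ => l μ) = fun μ : Dual ℂ W => μ ((evalEquiv ℂ W).symm l) := by
    funext μ
    rw [apply_evalEquiv_symm_apply]
  rw [this]
  exact eval_mem_polyFns _

theorem polyFns_fg [FiniteDimensional ℂ W] : (polyFns W).FG := by
  let b := Module.finBasis ℂ W
  have : polyFns W = Algebra.adjoin ℂ (Set.range fun i (μ : Dual ℂ W) => μ (b i)) := by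
    apply le_antisymm
    · refine Algebra.adjoin_le ?_
      rintro _ ⟨x, rfl⟩
      have : (fun μ : Dual ℂ W => μ x) = ∑ i, b.repr x i • fun μ : Dual ℂ W => μ (b i) := by
        funext μ
        conv_lhs => rw [← b.sum_repr x]
        simp only [map_sum, map_smul, smul_eq_mul, Finset.sum_apply, Pi.smul_apply]
      change (fun μ : Dual ℂ W => μ x) ∈ _
      rw [this]
      exact Subalgebra.sum_mem _ fun i _ => Subalgebra.smul_mem _
        (Algebra.subset_adjoin (Set.mem_range_self (f := fun i (μ : Dual ℂ W) => μ (b i)) i)) _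
    · refine Algebra.adjoin_le ?_
      rintro _ ⟨i, rfl⟩
      exact eval_mem_polyFns _
  rw [this]
  exact Subalgebra.fg_def.2 ⟨_, Set.finite_range _, rfl⟩

end Poly

end SpaceWithFunctions

open AffineAlgGroup SpaceWithFunctions

section Orbits

variable {G : Type u} [Group G] [AffineAlgGroup G] {V : Type v} [AddCommGroup V] [Module ℂ V]

/-- An equivariant linear map `T` from `V` to a rational representation of `G` that is injective on
the orbit of `v`. -/
structure OrbitModel (ρ : Representation ℂ G V) (v : V) (W : Type u) [AddCommGroup W]
    [Module ℂ W] where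
  σ : Representation ℂ G (Dual ℂ W)
  T : V →ₗ[ℂ] Dual ℂ W
  equivariant : ∀ g x, T (ρ g x) = σ g (T x)
  regular : ∀ X, (fun g => T (ρ g v) X) ∈ coord (G := G)
  injective : ∀ g h, T (ρ g v) = T (ρ h v) → ρ g v = ρ h v

namespace OrbitModel

variable {ρ : Representation ℂ G V} {v : V} {W : Type u} [AddCommGroup W] [Module ℂ W]
  (M : OrbitModel ρ v W)

/-- The orbit map to the dual of `W`. -/
def orbT (g : G) : Dual ℂ W := M.T (ρ g v)

theorem comp_orbT_mem : ∀ p ∈ polyFns W, p ∘ M.orbT ∈ coord (G := G) :=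
  comp_mem_of_adjoin _ (by rintro _ ⟨X, rfl⟩; exact M.regular X)

/-- The comorphism of the orbit map. -/
def comorph : polyFns W →ₐ[ℂ] coord (G := G) where
  toFun p := ⟨p.1 ∘ M.orbT, M.comp_orbT_mem p.1 p.2⟩
  map_one' := rfl
  map_mul' _ _ := rfl
  map_zero' := rfl
  map_add' _ _ := rfl
  commutes' _ := rfl

/-- The coordinate algebra of the closure of the orbit. -/
abbrev orbAlg : Subalgebra ℂ (coord (G := G)) := M.comorph.range

theorem orbT_mul (h g : G) : M.orbT (h * g) = M.σ h (M.orbT g) := by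
  rw [orbT, map_mul]
  exact M.equivariant h (ρ g v)

/-- The embedding of the orbit. -/
def toDual (m : orb ρ v) : Dual ℂ W := M.T m.1

/-- The orbit map of the base point. -/
abbrev baseMap (ρ : Representation ℂ G V) (v : V) : G → orb ρ v := orbMap ρ v ⟨v, mem_orb_self ρ v⟩

theorem toDual_injective : Function.Injective M.toDual := by
  rintro ⟨_, g, rfl⟩ ⟨_, h, rfl⟩ e
  exact Subtype.ext (M.injective g h e)

theorem isMorphism_toDual : IsMorphism (orbSpace ρ v) (dualVariety W) M.toDual :=
  isMorphism_of_coinduced _ _ _ _ fun _ => isMorphism_affine _ _ _ M.comp_orbT_mem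

variable [FiniteDimensional ℂ W]

theorem orbAlg_fg : M.orbAlg.FG := by
  have : Algebra.FiniteType ℂ (polyFns W) := (Subalgebra.fg_iff_finiteType _).1 polyFns_fg
  refine (Subalgebra.fg_iff_finiteType _).2 ?_
  exact Algebra.FiniteType.of_surjective M.comorph.rangeRestrict M.comorph.rangeRestrict_surjective

theorem leftTr_mem_orbAlg (h : G) : ∀ a ∈ M.orbAlg, leftTr h a ∈ M.orbAlg := by
  rintro _ ⟨p, rfl⟩
  have hp : p.1 ∘ M.σ h ∈ polyFns W := by
    refine comp_mem_of_adjoin (A := polyFns W) (M.σ h) ?_ p.1 p.2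
    rintro _ ⟨X, rfl⟩
    exact linear_mem_polyFns ((LinearMap.applyₗ X) ∘ₗ M.σ h)
  refine ⟨⟨_, hp⟩, ?_⟩
  apply Subtype.ext
  funext g
  exact congrArg p.1 (M.orbT_mul h g).symm

variable [IsDomain (coord (G := G))]

theorem isSubmersiveAt (g : G) : IsSubmersiveAt M.orbAlg (evalAt g) :=
  isSubmersiveAt_of_stable M.orbAlg_fg M.leftTr_mem_orbAlg g

/-- The orbit map is open onto the closure of the orbit. -/
theorem exists_open_subset_image (g : G) {c : G → ℂ} (hc : c ∈ coord (G := G)) (hcg : c g ≠ 0) :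
    ∃ p ∈ polyFns W, p (M.orbT g) ≠ 0 ∧ ∀ y : Dual ℂ W,
      (∀ q ∈ polyFns W, (∀ h, q (M.orbT h) = 0) → q y = 0) → p y ≠ 0 →
        ∃ g', c g' ≠ 0 ∧ M.orbT g' = y := by
  obtain ⟨⟨_, p, rfl⟩, hp, H⟩ := (M.isSubmersiveAt g).lift ⟨c, hc⟩ hcg
  refine ⟨p.1, p.2, hp, fun y hy hpy => ?_⟩
  let f : polyFns W →ₐ[ℂ] M.orbAlg := M.comorph.rangeRestrict
  let ev : polyFns W →ₐ[ℂ] ℂ := (Pi.evalAlgHom ℂ (fun _ : Dual ℂ W => ℂ) y).comp (polyFns W).val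
  have hker : ∀ q : polyFns W, f q = 0 → ev q = 0 := by
    intro q hq
    refine hy q.1 q.2 fun h => ?_
    exact congrFun (congrArg (fun a : M.orbAlg => a.1.1) hq) h
  -- Since y lies in the closure of the orbit, evaluation at y kills the polynomials that vanish on
  -- the orbit, so it factors through `orbAlg`. Lifting this character to `coord` then yields a
  -- group element over y.
  let χ : M.orbAlg →ₐ[ℂ] ℂ := (Ideal.Quotient.liftₐ (RingHom.ker f) ev hker).comp
    (Ideal.quotientKerAlgEquivOfSurjective M.comorph.rangeRestrict_surjective).symm.toAlgHom
  have hχ : ∀ q : polyFns W, χ (f q) = q.1 y := by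
    intro q
    have : (Ideal.quotientKerAlgEquivOfSurjective M.comorph.rangeRestrict_surjective).symm (f q) =
        Ideal.Quotient.mk _ q := by
      rw [AlgEquiv.symm_apply_eq]
      rfl
    change Ideal.Quotient.liftₐ (RingHom.ker f) ev hker
      ((Ideal.quotientKerAlgEquivOfSurjective M.comorph.rangeRestrict_surjective).symm (f q)) = _
    rw [this]
    rfl
  obtain ⟨ψ, hψc, hψ⟩ := H χ (fun h0 => hpy ((hχ p).symm.trans h0))
  obtain ⟨g', hg', -⟩ := points ψ
  refine ⟨g', by rw [hg'] at hψc; exact hψc, ?_⟩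
  apply LinearMap.ext
  intro X
  have h1 := hψ (f ⟨_, eval_mem_polyFns X⟩)
  rw [hχ] at h1
  exact ((hg' (M.comorph ⟨_, eval_mem_polyFns X⟩)).symm.trans h1)

/-- Openness of the orbit map, for the topology that the orbit inherits from the dual of `W`. -/
theorem exists_nhd_subset_image (g : G) {c : G → ℂ} (hc : c ∈ coord (G := G)) (hcg : c g ≠ 0) :
    ∃ p ∈ polyFns W, p (M.orbT g) ≠ 0 ∧ ∀ m : orb ρ v, p (M.toDual m) ≠ 0 →
      ∃ g', c g' ≠ 0 ∧ baseMap ρ v g' = m := by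
  obtain ⟨p, hp, hpg, H⟩ := M.exists_open_subset_image g hc hcg
  refine ⟨p, hp, hpg, ?_⟩
  rintro ⟨_, h, rfl⟩ hm
  obtain ⟨g', hg', e⟩ := H (M.orbT h) (fun q _ hq => hq h) hm
  exact ⟨g', hg', Subtype.ext (M.injective g' h e)⟩

/-- The pullback c/d of `f` to the group is constant on the fibres of the orbit map, so it is a
fraction p/q over `orbAlg`. Here q may vanish at `g`; flat descent of divisibility replaces p/q by
r/s with s(g) ≠ 0. -/
theorem exists_eq_div (g : G) {f : orb ρ v → ℂ}
    (hf : (orbSpace ρ v).IsRegAt (baseMap ρ v g) f) :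
    ∃ r ∈ polyFns W, ∃ s ∈ polyFns W, s (M.orbT g) ≠ 0 ∧
      ∀ᶠ m in (orbSpace ρ v).nbhd (baseMap ρ v g), f m = r (M.toDual m) / s (M.toDual m) := by
  have hf1 : (groupVariety G).IsRegAt g (f ∘ baseMap ρ v) :=
    (isMorphism_orbMap ρ v ⟨v, mem_orb_self ρ v⟩).pullback g f hf
  obtain ⟨c, hc, d, hd, hdg, hcd⟩ := hf1
  obtain ⟨e, he, heg, hey⟩ := affine_basis _ g hcd
  have key := exists_div_of_constant_on_fibres (A := M.orbAlg) (B := coord (G := G))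
    Subtype.val_injective (c := ⟨c, hc⟩) (d := ⟨d, hd⟩) (e := ⟨e, he⟩)
    (fun h => hdg (congrFun (congrArg Subtype.val h) g))
    (fun h => heg (congrFun (congrArg Subtype.val h) g)) (by
      intro ψ ψ' hψ h1 h2 h3 h4
      obtain ⟨g1, hg1, -⟩ := points ψ
      obtain ⟨g2, hg2, -⟩ := points ψ'
      rw [hg1] at h1 h3
      rw [hg2] at h2 h4
      rw [hg1, hg1, hg2, hg2]
      have e1 : M.orbT g1 = M.orbT g2 := by
        apply LinearMap.ext
        intro X
        have := hψ (M.comorph.rangeRestrict ⟨_, eval_mem_polyFns X⟩)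
        have h5 := hg1 (M.comorph ⟨_, eval_mem_polyFns X⟩)
        have h6 := hg2 (M.comorph ⟨_, eval_mem_polyFns X⟩)
        exact h5.symm.trans (this.trans h6)
      have e2 : baseMap ρ v g1 = baseMap ρ v g2 := Subtype.ext (M.injective g1 g2 e1)
      have e3 := hey g1 h3
      have e4 := hey g2 h4
      simp only [Function.comp_apply] at e3 e4
      rw [e2, e4, div_eq_div_iff h2 h1] at e3
      change c g1 * d g2 = c g2 * d g1
      exact e3.symm)
  obtain ⟨p, q, hq, hpq⟩ := key
  obtain ⟨r, s, hs, hrs⟩ := (M.isSubmersiveAt g).div p q ⟨c, hc⟩ ⟨d, hd⟩ hdg hpq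
  have h1 : s.1 * ⟨c, hc⟩ = r.1 * ⟨d, hd⟩ := by
    have hq' : q.1 ≠ 0 := fun h => hq (Subtype.ext h)
    apply mul_left_cancel₀ hq'
    have hrs' : p.1 * s.1 = q.1 * r.1 := congrArg Subtype.val hrs
    have hpq' : q.1 * ⟨c, hc⟩ = p.1 * ⟨d, hd⟩ := hpq
    linear_combination s.1 * hpq' + ⟨d, hd⟩ * hrs'
  obtain ⟨_, r, rfl⟩ := r
  obtain ⟨_, s, rfl⟩ := s
  refine ⟨r.1, r.2, s.1, s.2, hs, ?_⟩
  -- The function d e s singles out the group elements where the pullback of `f` equals c/d (`e`)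
  -- and both denominators `d` and `s` are invertible; the image of this set contains a
  -- neighbourhood in the orbit.
  obtain ⟨t, ht, htg, H⟩ := M.exists_nhd_subset_image g
    (c := d * e * (s.1 ∘ M.orbT)) (mul_mem (mul_mem hd he) (M.comp_orbT_mem s.1 s.2))
    (mul_ne_zero (mul_ne_zero hdg heg) hs)
  have h2 : ∀ᶠ m in (orbSpace ρ v).nbhd (baseMap ρ v g), t (M.toDual m) ≠ 0 :=
    (M.isMorphism_toDual.tendsto (baseMap ρ v g)).eventually (affine_ne_zero _ ht htg)
  filter_upwards [h2] with m hm
  obtain ⟨g', hg', rfl⟩ := H m hm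
  obtain ⟨h3, h4⟩ := mul_ne_zero_iff.1 hg'
  obtain ⟨h5, h6⟩ := mul_ne_zero_iff.1 h3
  have h7 := hey g' h6
  simp only [Function.comp_apply] at h7
  have h8 := congrFun (congrArg Subtype.val h1) g'
  rw [h7]
  change _ = r.1 (M.orbT g') / s.1 (M.orbT g')
  have h9 : s.1 (M.orbT g') ≠ 0 := h4
  rw [div_eq_div_iff h5 h9, mul_comm]
  exact h8

/-- Openness of the orbit map identifies the quotient topology with the induced one and shows that
the orbit is open in its closure; `exists_eq_div` identifies the sheaves. -/
theorem isLocallyClosedEmbedding :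
    IsLocallyClosedEmbedding (orbSpace ρ v) (dualVariety W) M.toDual where
  isMorphism := M.isMorphism_toDual
  injective := M.toDual_injective
  induced := by
    apply le_antisymm
    · exact continuous_iff_le_induced.1 M.isMorphism_toDual.continuous
    · intro U hU
      let _ : TopologicalSpace (orb ρ v) := TopologicalSpace.induced M.toDual (dualVariety W).top
      change IsOpen U
      rw [isOpen_iff_mem_nhds]
      rintro m hm
      obtain ⟨_, g, rfl⟩ := m
      have hV : @IsOpen G (groupVariety G).top (baseMap ρ v ⁻¹' U) :=
        @IsOpen.preimage _ _ (groupVariety G).top (orbSpace ρ v).top _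
          (isMorphism_orbMap ρ v ⟨v, mem_orb_self ρ v⟩).continuous U hU
      have hVg : ∀ᶠ y in (groupVariety G).nbhd g, baseMap ρ v y ∈ U :=
        let _ : TopologicalSpace G := (groupVariety G).top
        hV.mem_nhds hm
      obtain ⟨c, hc, hcg, H⟩ := affine_basis _ g hVg
      obtain ⟨p, hp, hpg, H'⟩ := M.exists_nhd_subset_image g hc hcg
      have ho : IsOpen {m | p (M.toDual m) ≠ 0} :=
        ⟨_, affine_isOpen _ hp, rfl⟩
      refine mem_of_superset (ho.mem_nhds hpg) fun m hm => ?_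
      obtain ⟨g', hg', rfl⟩ := H' m hm
      exact H g' hg'
  locallyClosed := by
    let _ : TopologicalSpace (Dual ℂ W) := (dualVariety W).top
    choose p hp hpg H using fun g : G => M.exists_open_subset_image g
      (c := 1) (one_mem _) one_ne_zero
    -- The second set is the Zariski closure of the orbit; the first is a union of basic open sets
    -- that meet this closure only in points of the orbit.
    refine ⟨⋃ g, {y | p g y ≠ 0}, {y | ∀ q ∈ polyFns W, (∀ h, q (M.orbT h) = 0) → q y = 0},
      isOpen_iUnion fun g => affine_isOpen _ (hp g), ?_, ?_⟩
    · have e : {y | ∀ q ∈ polyFns W, (∀ h, q (M.orbT h) = 0) → q y = 0} =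
          ⋂ q ∈ {q | q ∈ polyFns W ∧ ∀ h, q (M.orbT h) = 0}, {y | q y ≠ 0}ᶜ := by
        ext y
        simp
      rw [e]
      exact isClosed_biInter fun q hq => (affine_isOpen _ hq.1).isClosed_compl
    · ext y
      constructor
      · rintro ⟨⟨_, g, rfl⟩, rfl⟩
        exact ⟨Set.mem_iUnion.2 ⟨g, hpg g⟩, fun q _ hq' => hq' g⟩
      · rintro ⟨h1, h2⟩
        obtain ⟨g, hg⟩ := Set.mem_iUnion.1 h1
        obtain ⟨g', -, rfl⟩ := H g y h2 hg
        exact ⟨baseMap ρ v g', rfl⟩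
  extend := by
    rintro ⟨_, g, rfl⟩ f hf
    obtain ⟨r, hr, s, hs, hsg, h⟩ := M.exists_eq_div g hf
    refine ⟨fun y => r y / s y, affine_isRegAt_of_eventually _ hr hs hsg
      (Filter.Eventually.of_forall fun _ => rfl), h⟩

end OrbitModel

end Orbits

/-! ### Tangent vectors of embedded varieties -/

namespace SpaceWithFunctions

/-- Tangent vectors of a subvariety of an affine variety are determined by their values on the
differentials of generators of the coordinate algebra. -/
theorem IsLocallyClosedEmbedding.tangent_ext {X : Type u} {Y : Type v} {S : SpaceWithFunctions X}
    {s : Set (Y → ℂ)} {φ : X → Y}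
    (hφ : IsLocallyClosedEmbedding S (affine (Algebra.adjoin ℂ s)) φ) {x : X} {ξ η : S.Tangent x}
    (h : ∀ a ∈ s, ξ (S.diff x (a ∘ φ)) = η (S.diff x (a ∘ φ))) : ξ = η := by
  have hreg : ∀ a ∈ Algebra.adjoin ℂ s, S.IsRegAt x (a ∘ φ) := fun a ha =>
    hφ.isMorphism.pullback x a (affine_isRegAt _ ha _)
  have h1 : ∀ a ∈ Algebra.adjoin ℂ s, ξ (S.diff x (a ∘ φ)) = η (S.diff x (a ∘ φ)) := by
    intro a ha
    induction ha using Algebra.adjoin_induction with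
    | mem a ha => exact h a ha
    | algebraMap r =>
      have : S.diff x (algebraMap ℂ (Y → ℂ) r ∘ φ) = 0 := S.diff_const x r
      rw [this, map_zero, map_zero]
    | add a b ha hb iha ihb =>
      have : S.diff x ((a + b) ∘ φ) = S.diff x (a ∘ φ) + S.diff x (b ∘ φ) :=
        S.diff_add (hreg a ha) (hreg b hb)
      rw [this, map_add, map_add, iha, ihb]
    | mul a b ha hb iha ihb =>
      have : S.diff x ((a * b) ∘ φ) = a (φ x) • S.diff x (b ∘ φ) + b (φ x) • S.diff x (a ∘ φ) :=
        S.diff_mul (hreg a ha) (hreg b hb)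
      rw [this, map_add, map_add, map_smul, map_smul, map_smul, map_smul, iha, ihb]
  apply LinearMap.ext
  intro c
  obtain ⟨f, hf, rfl⟩ := S.exists_diff x c
  obtain ⟨g, ⟨a, ha, b, hb, hb0, hg⟩, hfg⟩ := hφ.extend x f hf
  have e1 := (hφ.isMorphism.tendsto x).eventually hg
  have e2 := (hφ.isMorphism.tendsto x).eventually (affine_ne_zero _ hb hb0)
  -- Differentiating f b = a determines df from da and db, because b does not vanish at the point.
  have e3 : ∀ᶠ y in S.nbhd x, (f * (b ∘ φ)) y = (a ∘ φ) y := by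
    filter_upwards [e1, e2, hfg] with y h1 h2 h3
    simp only [Pi.mul_apply, Function.comp_apply, h3, h1]
    field_simp
  have e4 := S.diff_congr (S.mul_mem x _ _ hf (hreg b hb)) e3
  rw [S.diff_mul hf (hreg b hb)] at e4
  have e5 := congrArg ξ e4
  have e6 := congrArg η e4
  simp only [map_add, map_smul, h1 a ha, h1 b hb, smul_eq_mul, Function.comp_apply] at e5 e6
  exact mul_left_cancel₀ hb0 (by linear_combination e5 - e6)

end SpaceWithFunctions

/-! ### Tangent spaces of orbits consist of velocity vectors -/

section Orbits

variable {G : Type u} [Group G] [AffineAlgGroup G] {V : Type v} [AddCommGroup V] [Module ℂ V]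
  {ρ : Representation ℂ G V} {v : V}

theorem velocity_diff (m : orb ρ v) (X : LieAlg G) {f : orb ρ v → ℂ}
    (hf : (orbSpace ρ v).IsRegAt m f) (hm : f ∘ orbMap ρ v m ∈ coord (G := G)) :
    velocity ρ v m X ((orbSpace ρ v).diff m f) = X.functional ⟨f ∘ orbMap ρ v m, hm⟩ := by
  refine ((isMorphism_orbMap ρ v m).differential_diff (orbMap_one ρ v m)
    (LieAlg.toTangent X) hf).trans ?_
  exact tangentOfPointDer_diff (A := coord (G := G)) X ⟨f ∘ orbMap ρ v m, hm⟩

namespace OrbitModel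

variable {W : Type u} [AddCommGroup W] [Module ℂ W] (M : OrbitModel ρ v W)

theorem isRegAt_comp_toDual (m : orb ρ v) {p : Dual ℂ W → ℂ} (hp : p ∈ polyFns W) :
    (orbSpace ρ v).IsRegAt m (p ∘ M.toDual) :=
  M.isMorphism_toDual.pullback m p (affine_isRegAt _ hp _)

variable [FiniteDimensional ℂ W] [IsDomain (coord (G := G))]

/-- A tangent vector at g · v is a point derivation of `orbAlg` at g. It extends to the whole
coordinate ring of the group, and a right translation moves the extension to the identity, where it
is an element of the Lie algebra. -/
theorem velocity_surjective (M : OrbitModel ρ v W) (m : orb ρ v) : Function.Surjective (velocity ρ v m) := by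
  intro ξ
  obtain ⟨m, g, rfl⟩ := m
  let S := orbSpace ρ v
  let m : orb ρ v := baseMap ρ v g
  change S.Tangent m at ξ
  -- Elements of `orbAlg` are constant on the fibres of the orbit map, so the chosen group element
  -- over `m'` does not matter (`hdesc`).
  let desc : M.orbAlg → orb ρ v → ℂ := fun a m' => a.1.1 m'.2.choose
  have hdesc : ∀ p : polyFns W, desc (M.comorph.rangeRestrict p) = p.1 ∘ M.toDual := by
    intro p
    funext m'
    change p.1 (M.T (ρ _ v)) = p.1 (M.T m'.1)
    exact congrArg (fun y => p.1 (M.T y)) m'.2.choose_spec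
  have hreg : ∀ a, S.IsRegAt m (desc a) := by
    intro a
    obtain ⟨p, rfl⟩ := M.comorph.rangeRestrict_surjective a
    rw [hdesc]
    exact M.isRegAt_comp_toDual m p.2
  have hval : ∀ a, desc a m = a.1.1 g := by
    intro a
    obtain ⟨p, rfl⟩ := M.comorph.rangeRestrict_surjective a
    rw [hdesc]
    rfl
  let D : M.orbAlg →ₗ[ℂ] ℂ :=
    { toFun := fun a => ξ (S.diff m (desc a))
      map_add' := fun a b => by
        rw [← map_add, ← S.diff_add (hreg a) (hreg b)]
        rfl
      map_smul' := fun c a => by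
        rw [RingHom.id_apply, ← map_smul, ← S.diff_smul c (hreg a)]
        rfl }
  obtain ⟨E, hE, hED⟩ := (M.isSubmersiveAt g).extend D (fun x y => by
    change ξ (S.diff m (desc x * desc y)) = _
    rw [S.diff_mul (hreg x) (hreg y), map_add, map_smul, map_smul, hval, hval]
    rfl)
  -- A right translation, since the orbit map of g · v is h ↦ hg · v; left translation would produce
  -- a velocity at `v` instead.
  let R : coord (G := G) →ₗ[ℂ] coord (G := G) :=
    { toFun := fun f => ⟨fun x => f.1 (x * g⁻¹), right_mem f.2 g⁻¹⟩
      map_add' := fun _ _ => rfl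
      map_smul' := fun _ _ => rfl }
  let X : LieAlg G := ⟨E ∘ₗ R, by
    intro a b
    change E (R a * R b) = a.1 1 * E (R b) + b.1 1 * E (R a)
    rw [hE]
    change a.1 (g * g⁻¹) * _ + b.1 (g * g⁻¹) * _ = _
    rw [mul_inv_cancel]⟩
  refine ⟨X, M.isLocallyClosedEmbedding.tangent_ext ?_⟩
  rintro _ ⟨x, rfl⟩
  have hx := eval_mem_polyFns x
  have h1 : orbMap ρ v m = baseMap ρ v ∘ fun h => h * g := by
    funext h
    apply Subtype.ext
    simp [orbMap, m]
  have h2 : ((fun μ : Dual ℂ W => μ x) ∘ M.toDual) ∘ orbMap ρ v m ∈ coord (G := G) := by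
    rw [h1]
    exact right_mem (M.comp_orbT_mem _ hx) g
  refine (velocity_diff m X (M.isRegAt_comp_toDual m hx) h2).trans ?_
  have h3 : R ⟨_, h2⟩ = M.comorph ⟨_, hx⟩ := by
    apply Subtype.ext
    funext h
    change M.T (ρ (h * g⁻¹) (ρ g v)) x = M.T (ρ h v) x
    congr 2
    rw [← Module.End.mul_apply, ← map_mul, inv_mul_cancel_right]
  change E (R ⟨_, h2⟩) = _
  rw [h3]
  refine (hED (M.comorph.rangeRestrict ⟨_, hx⟩)).trans ?_
  change ξ (S.diff m (desc _)) = _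
  rw [hdesc]
  rfl

end OrbitModel

end Orbits

/-! ### Composition and cancellation of locally closed embeddings -/

namespace SpaceWithFunctions

variable {X : Type u} {Y : Type v} {Z : Type w} {S : SpaceWithFunctions X}
  {T : SpaceWithFunctions Y} {R : SpaceWithFunctions Z} {φ : X → Y} {ψ : Y → Z}

theorem IsLocallyClosedEmbedding.comp (hψ : IsLocallyClosedEmbedding T R ψ)
    (hφ : IsLocallyClosedEmbedding S T φ) : IsLocallyClosedEmbedding S R (ψ ∘ φ) where
  isMorphism := hψ.isMorphism.comp hφ.isMorphism
  injective := hψ.injective.comp hφ.injective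
  induced := by rw [hφ.induced, hψ.induced, induced_compose]
  locallyClosed := by
    let _ : TopologicalSpace Y := T.top
    let _ : TopologicalSpace Z := R.top
    have hψ' : Topology.IsInducing ψ := ⟨hψ.induced⟩
    rw [Set.range_comp]
    exact hφ.locallyClosed.image hψ' hψ.locallyClosed
  extend := by
    intro x f hf
    obtain ⟨g, hg, hfg⟩ := hφ.extend x f hf
    obtain ⟨k, hk, hgk⟩ := hψ.extend (φ x) g hg
    refine ⟨k, hk, ?_⟩
    filter_upwards [hfg, (hφ.isMorphism.tendsto x).eventually hgk] with y h1 h2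
    rw [h1, h2]
    rfl

/-- Used to compare two orbits that are embedded in the same ambient space. -/
theorem IsLocallyClosedEmbedding.of_comp (hψ : IsLocallyClosedEmbedding T R ψ)
    (h : IsLocallyClosedEmbedding S R (ψ ∘ φ)) (hφ : IsMorphism S T φ) :
    IsLocallyClosedEmbedding S T φ where
  isMorphism := hφ
  injective := h.injective.of_comp
  induced := by rw [h.induced, hψ.induced, induced_compose]
  locallyClosed := by
    let _ : TopologicalSpace Y := T.top
    let _ : TopologicalSpace Z := R.top
    have e : Set.range φ = ψ ⁻¹' Set.range (ψ ∘ φ) := by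
      rw [Set.range_comp, Set.preimage_image_eq _ hψ.injective]
    rw [e]
    exact h.locallyClosed.preimage hψ.isMorphism.continuous
  extend := by
    intro x f hf
    obtain ⟨g, hg, hfg⟩ := h.extend x f hf
    exact ⟨g ∘ ψ, hψ.isMorphism.pullback (φ x) g hg, hfg⟩

theorem IsLocallyClosedEmbedding.of_inverse {χ : Y → X} (hφ : IsMorphism S T φ)
    (hχ : IsMorphism T S χ) (h1 : χ ∘ φ = id) (h2 : φ ∘ χ = id) :
    IsLocallyClosedEmbedding S T φ where
  isMorphism := hφ
  injective := Function.LeftInverse.injective (congrFun h1)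
  induced := by
    apply le_antisymm
    · exact continuous_iff_le_induced.1 hφ.continuous
    · have h3 : T.top ≤ TopologicalSpace.induced χ S.top := continuous_iff_le_induced.1 hχ.continuous
      have h4 := induced_mono (g := φ) h3
      rwa [induced_compose, h1, @induced_id _ S.top] at h4
  locallyClosed := by
    let _ : TopologicalSpace Y := T.top
    have h3 : Function.Surjective φ := fun y => ⟨χ y, congrFun h2 y⟩
    rw [h3.range_eq]
    exact isOpen_univ.isLocallyClosed
  extend := by
    intro x f hf
    have e : χ (φ x) = x := congrFun h1 x
    refine ⟨f ∘ χ, hχ.pullback (φ x) f (by rwa [e]), Filter.Eventually.of_forall fun y => ?_⟩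
    exact congrArg f (congrFun h1 y).symm

theorem isQuasiAffineVariety_of_embedding {W : Type u} [AddCommGroup W] [Module ℂ W]
    [FiniteDimensional ℂ W] {φ : X → Dual ℂ W}
    (hφ : IsLocallyClosedEmbedding S (dualVariety W) φ) : S.IsQuasiAffineVariety := by
  let b := Module.finBasis ℂ W
  let θ : Dual ℂ W → (Fin (finrank ℂ W) → ℂ) := fun μ i => μ (b i)
  let χ : (Fin (finrank ℂ W) → ℂ) → Dual ℂ W := fun z => b.constr ℂ z
  have hθ : IsLocallyClosedEmbedding (dualVariety W) (affineSpace _) θ := by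
    refine IsLocallyClosedEmbedding.of_inverse (χ := χ)
      (isMorphism_affine _ _ _ (comp_mem_of_adjoin _ ?_))
      (isMorphism_affine _ _ _ (comp_mem_of_adjoin _ ?_)) ?_ ?_
    · rintro _ ⟨i, rfl⟩
      exact eval_mem_polyFns (b i)
    · rintro _ ⟨x, rfl⟩
      have e : (fun μ : Dual ℂ W => μ x) ∘ χ =
          ∑ i, b.repr x i • fun z : Fin (finrank ℂ W) → ℂ => z i := by
        funext z
        simp [χ, Basis.constr_apply_fintype, Basis.equivFun_apply]
      change (fun μ : Dual ℂ W => μ x) ∘ χ ∈ _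
      rw [e]
      exact Subalgebra.sum_mem _ fun i _ => Subalgebra.smul_mem _
        (Algebra.subset_adjoin (Set.mem_range_self
          (f := fun i (z : Fin (finrank ℂ W) → ℂ) => z i) i)) _
    · funext μ
      exact b.ext fun i => by simp [χ, θ]
    · funext z i
      simp [χ, θ]
  exact ⟨_, _, hθ.comp hφ⟩

end SpaceWithFunctions

/-! ### Finite-dimensionality of the Lie algebra -/

namespace AffineAlgGroup

variable {G : Type u} [Group G] [AffineAlgGroup G]

theorem LieAlg.functional_one (X : LieAlg G) : X.functional 1 = 0 := by
  simpa using X.leibniz 1 1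

theorem LieAlg.functional_algebraMap (X : LieAlg G) (c : ℂ) :
    X.functional (algebraMap ℂ _ c) = 0 := by
  rw [Algebra.algebraMap_eq_smul_one, map_smul, X.functional_one, smul_zero]

/-- By the Leibniz rule a point derivation is determined by its values on finitely many generators.
-/
instance finiteDimensional_lieAlg : FiniteDimensional ℂ (LieAlg G) := by
  obtain ⟨s, hs⟩ := (inferInstance : Algebra.FiniteType ℂ (coord (G := G))).out
  let ev : LieAlg G →ₗ[ℂ] (s → ℂ) :=
    LinearMap.pi fun f => (LinearMap.applyₗ f.1) ∘ₗ LieAlg.functional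
  refine FiniteDimensional.of_injective ev ?_
  rw [← LinearMap.ker_eq_bot, LinearMap.ker_eq_bot']
  intro X hX
  apply LieAlg.ext
  intro f
  have hf : f ∈ Algebra.adjoin ℂ (s : Set (coord (G := G))) := hs ▸ Algebra.mem_top
  rw [map_zero, LinearMap.zero_apply]
  induction hf using Algebra.adjoin_induction with
  | mem x hx => exact congrFun hX ⟨x, hx⟩
  | algebraMap r => exact X.functional_algebraMap r
  | add x y hx hy ihx ihy => rw [map_add, ihx, ihy, add_zero]
  | mul x y hx hy ihx ihy => rw [X.leibniz, ihx, ihy, mul_zero, mul_zero, add_zero]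

end AffineAlgGroup

/-! ### The orbits Gₙ · λ as subvarieties of 𝔤_K* -/

namespace AlgGroupSystem

variable (S : AlgGroupSystem.{u}) (lam : S.LieDual)

/-- The matrix coefficients of the coadjoint action are regular functions. -/
theorem coadN_mem (n : ℕ) (μ : S.LieDual) (x : S.LieInf) :
    (fun g : S.G n => S.coadN n g μ x) ∈ coord (G := S.G n) := by
  induction x using S.lie_ind with | _ k X =>
  let N := max n k
  have hn : n ≤ N := le_max_left n k
  have hk : k ≤ N := le_max_right n k
  have e : (fun g : S.G n => S.coadN n g μ (S.toLie k X)) =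
      (fun g : S.G N => S.res N μ (Ad (S.G N) g⁻¹ (S.lieι k N hk X))) ∘ S.ι n N hn := by
    funext g
    rw [← S.coadN_ι n N hn, ← S.toLie_lieι k N hk, coadN_apply]
    rfl
  rw [e]
  exact (S.emb n N hn).pullback _ (coad_mem _ _)

theorem res_coadN_ι {n K : ℕ} (h : n ≤ K) (g : S.G n) (μ : S.LieDual) :
    S.res K (S.coadN n g μ) = S.coadFin K (S.ι n K h g) (S.res K μ) := by
  rw [← S.coadN_ι n K h, res_coadN]

/-- For large `K` the points of `Gₙ · λ` are separated by their restrictions to `𝔤_K`. -/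
theorem exists_res_injective (n : ℕ) : ∃ K₀, n ≤ K₀ ∧ ∀ K, K₀ ≤ K → ∀ g h : S.G n,
    S.res K (S.coadN n g lam) = S.res K (S.coadN n h lam) →
      S.coadN n g lam = S.coadN n h lam := by
  -- The equations of the stabilizer of λ in Gₙ, one for each x ∈ 𝔤.
  let F : S.LieInf → coord (G := S.G n) := fun x =>
    ⟨fun g => S.coadN n g lam x, S.coadN_mem n lam x⟩ - algebraMap ℂ _ (lam x)
  have hF : ∀ x g, (F x).1 g = S.coadN n g lam x - lam x := fun _ _ => rfl
  -- The ideals generated by the equations from 𝔤ₖ increase with k, so they stabilize at some K₁.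
  let I : ℕ →o Ideal (coord (G := S.G n)) :=
    { toFun := fun k => Ideal.span (Set.range fun X : S.LieN k => F (S.toLie k X))
      monotone' := by
        intro k l h
        refine Ideal.span_mono ?_
        rintro _ ⟨X, rfl⟩
        exact ⟨S.lieι k l h X, by simp only [toLie_lieι]⟩ }
  obtain ⟨K₁, hK₁⟩ := monotone_stabilizes_iff_noetherian.2 (inferInstance :
    IsNoetherian (coord (G := S.G n)) (coord (G := S.G n))) I
  refine ⟨max n K₁, le_max_left _ _, fun K hK g h hgh => ?_⟩
  have hn : n ≤ K := (le_max_left _ _).trans hK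
  have hK1 : K₁ ≤ K := (le_max_right _ _).trans hK
  let w := h⁻¹ * g
  have hw : S.res K (S.coadN n w lam) = S.res K lam := by
    rw [S.res_coadN_ι hn, S.res_coadN_ι hn] at hgh
    rw [S.res_coadN_ι hn, map_mul, map_mul, Module.End.mul_apply, hgh, ← Module.End.mul_apply,
      ← map_mul, ← map_mul, inv_mul_cancel, map_one, map_one]
    rfl
  -- The element w = h⁻¹g fixes the restriction of λ to 𝔤_K, so it is a zero of `I K`. By
  -- stabilization it is then a zero of all equations and fixes λ itself.
  have hle : I K ≤ RingHom.ker (evalAt w) := by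
    refine Ideal.span_le.2 ?_
    rintro _ ⟨X, rfl⟩
    change (F (S.toLie K X)).1 w = 0
    rw [hF, sub_eq_zero]
    exact LinearMap.congr_fun hw X
  have hfix : S.coadN n w lam = lam := by
    apply LinearMap.ext
    intro x
    induction x using S.lie_ind with | _ k X =>
    have h1 : F (S.toLie k X) ∈ I (max k K) := by
      refine I.monotone (le_max_left k K) (Ideal.subset_span ⟨X, rfl⟩)
    rw [← hK₁ _ (hK1.trans (le_max_right k K)), hK₁ K hK1] at h1
    have h2 : (F (S.toLie k X)).1 w = 0 := hle h1
    rwa [hF, sub_eq_zero] at h2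
  have e : g = h * w := by simp [w]
  rw [e, map_mul, Module.End.mul_apply, hfix]

/-- The model of `Gₙ · λ` in `𝔤_K*`. -/
noncomputable def modelN {n K : ℕ} (hK : n ≤ K) (h : ∀ g h : S.G n,
    S.res K (S.coadN n g lam) = S.res K (S.coadN n h lam) →
      S.coadN n g lam = S.coadN n h lam) : OrbitModel (S.coadN n) lam (S.LieN K) where
  σ := (S.coadFin K).comp (S.ι n K hK)
  T := S.res K
  equivariant g μ := S.res_coadN_ι hK g μ
  regular X := S.coadN_mem n lam (S.toLie K X)
  injective := h

/-- The model of `Gₙ · λₙ` in `𝔤ₙ*`. -/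
noncomputable def modelFin (n : ℕ) : OrbitModel (S.coadFin n) (S.res n lam) (S.LieN n) where
  σ := S.coadFin n
  T := LinearMap.id
  equivariant _ _ := rfl
  regular X := coad_mem (S.res n lam) X
  injective _ _ h := h

theorem exists_mem_orbitN (μ : S.orbit lam) : ∃ n, μ.1 ∈ S.orbitN lam n := by
  obtain ⟨_, g, rfl⟩ := μ
  induction g using DirectLimit.induction with | _ n g => exact ⟨n, g, rfl⟩

section Connected

variable (hconn : ∀ n, @ConnectedSpace (S.G n) (groupVariety (S.G n)).top)

include hconn

/-- That every large K works, and not only one, makes it possible to embed two orbits at a common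
level. -/
theorem exists_embedding (n : ℕ) : ∃ K₀, n ≤ K₀ ∧ ∀ K, K₀ ≤ K →
    IsLocallyClosedEmbedding (S.orbitNSpace lam n) (dualVariety (S.LieN K))
      fun μ => S.res K μ.1 := by
  obtain ⟨K₀, hn, h⟩ := S.exists_res_injective lam n
  have := isDomain_coord (hconn n)
  exact ⟨K₀, hn, fun K hK =>
    (S.modelN lam (hn.trans hK) (h K hK)).isLocallyClosedEmbedding⟩

theorem velocity_orbitN_surjective (n : ℕ) (m : S.orbitN lam n) :
    Function.Surjective (velocity (S.coadN n) lam m) := by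
  obtain ⟨K₀, hn, h⟩ := S.exists_res_injective lam n
  have := isDomain_coord (hconn n)
  exact (S.modelN lam hn (h K₀ le_rfl)).velocity_surjective m

theorem velocity_finOrbit_surjective (n : ℕ) (m : S.finOrbit lam n) :
    Function.Surjective (velocity (S.coadFin n) (S.res n lam) m) :=
  have := isDomain_coord (hconn n)
  (S.modelFin lam n).velocity_surjective m

/-- Both orbits embed in 𝔤_K* for K large, compatibly with the inclusion between them, so the
ambient embedding can be cancelled. -/
theorem isIndVarietyOrbit : S.IsIndVarietyOrbit lam := by
  refine ⟨fun n => ?_, fun m n h => ?_⟩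
  · obtain ⟨K, -, hK⟩ := S.exists_embedding lam hconn n
    exact isQuasiAffineVariety_of_embedding (hK K le_rfl)
  · obtain ⟨K, -, hK⟩ := S.exists_embedding lam hconn n
    obtain ⟨K', -, hK'⟩ := S.exists_embedding lam hconn m
    exact (hK (max K K') (le_max_left _ _)).of_comp (hK' (max K K') (le_max_right _ _))
      (S.isMorphism_orbitIncl lam m n h)

theorem isIrreducible_orbitN (n : ℕ) :
    @IrreducibleSpace (S.orbitN lam n) (S.orbitNSpace lam n).top := by
  let _ : TopologicalSpace (S.G n) := (groupVariety (S.G n)).top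
  let _ : TopologicalSpace (orb (S.coadN n) lam) := (S.orbitNSpace lam n).top
  have : IrreducibleSpace (S.G n) := irreducibleSpace (hconn n)
  have hc : Continuous (OrbitModel.baseMap (S.coadN n) lam) :=
    (isMorphism_orbMap (S.coadN n) lam ⟨lam, mem_orb_self _ lam⟩).continuous
  have hs : Set.range (OrbitModel.baseMap (S.coadN n) lam) = Set.univ := by
    rw [Set.range_eq_univ]
    rintro ⟨_, g, rfl⟩
    exact ⟨g, rfl⟩
  have h1 := (IrreducibleSpace.isIrreducible_univ (S.G n)).image _ hc.continuousOn
  rw [Set.image_univ, hs] at h1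
  exact (show IrreducibleSpace (orb (S.coadN n) lam) from
    { isPreirreducible_univ := h1.2, toNonempty := ⟨⟨lam, mem_orb_self _ lam⟩⟩ })

/-- Two nonempty open sets both meet Gₙ · λ for n large, which is irreducible as an image of Gₙ. -/
theorem irreducibleSpace_orbit : @IrreducibleSpace (S.orbit lam) (S.orbitSpace lam).top := by
  let _ : TopologicalSpace (S.orbit lam) := (S.orbitSpace lam).top
  have hpre : IsPreirreducible (Set.univ : Set (S.orbit lam)) := by
    rintro U V hU hV ⟨x, -, hx⟩ ⟨y, -, hy⟩
    obtain ⟨k, hk⟩ := S.exists_mem_orbitN lam x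
    obtain ⟨l, hl⟩ := S.exists_mem_orbitN lam y
    let n := max k l
    have hkn := S.orbitN_mono lam (le_max_left k l) hk
    have hln := S.orbitN_mono lam (le_max_right k l) hl
    let _ : TopologicalSpace (orb (S.coadN n) lam) := (S.orbitNSpace lam n).top
    have : IrreducibleSpace (orb (S.coadN n) lam) := S.isIrreducible_orbitN lam hconn n
    let i : orb (S.coadN n) lam → S.orbit lam := Set.inclusion (S.orbitN_subset lam n)
    have hc : Continuous i :=
      (isMorphism_coinduced (fun n => S.orbitNSpace lam n)
        (fun n => Set.inclusion (S.orbitN_subset lam n)) n).continuous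
    obtain ⟨z, hz1, hz2⟩ := nonempty_preirreducible_inter (hU.preimage hc) (hV.preimage hc)
      ⟨⟨x.1, hkn⟩, hx⟩ ⟨⟨y.1, hln⟩, hy⟩
    exact ⟨_, trivial, hz1, hz2⟩
  exact { isPreirreducible_univ := hpre, toNonempty := ⟨⟨lam, mem_orb_self _ lam⟩⟩ }

/-- The linear functions from 𝔤_K separate tangent vectors of Gₙ · λ, and they are restrictions of
linear functions on 𝔤*. -/
theorem differential_inclN_injective (n : ℕ) (m : S.orbitN lam n) :
    Function.Injective ((S.isMorphism_inclN lam n).differential (x := m) rfl) := by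
  obtain ⟨K, -, hK⟩ := S.exists_embedding lam hconn n
  intro ξ η h
  refine (hK K le_rfl).tangent_ext ?_
  rintro _ ⟨X, rfl⟩
  have h1 := LinearMap.congr_fun h (S.proVariety.diff m.1 (S.evalFn (S.toLie K X)))
  rw [(S.isMorphism_inclN lam n).differential_diff rfl _ (S.evalFn_reg _ _),
    (S.isMorphism_inclN lam n).differential_diff rfl _ (S.evalFn_reg _ _)] at h1
  exact h1

theorem dIncl_injective (μ : S.orbit lam) : Function.Injective (S.dIncl lam μ) := by
  have : Nonempty {l : ℕ // μ.1 ∈ S.orbitN lam l} := by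
    obtain ⟨n, hn⟩ := S.exists_mem_orbitN lam μ
    exact ⟨⟨n, hn⟩⟩
  exact Module.DirectLimit.lift_injective _ _
    fun l => S.differential_inclN_injective lam hconn l.1 ⟨μ.1, l.2⟩

end Connected

theorem isMorphism_incl : IsMorphism (S.orbitSpace lam) S.proVariety
    (fun μ : S.orbit lam => μ.1) :=
  isMorphism_of_coinduced _ _ _ _ fun n => S.isMorphism_inclN lam n

end AlgGroupSystem

/-! ## The derivative of the coadjoint action -/

namespace AffineAlgGroup

variable {G : Type u} [Group G] [AffineAlgGroup G]

/-- With f(xy) = Σ aᵢ(x) bᵢ(y), apply `X` to the constant function Σ aᵢ(x) bᵢ(x⁻¹) = f(1). -/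
theorem LieAlg.functional_comp_inv (X : LieAlg G) (f : coord (G := G)) :
    X.functional ⟨fun x => f.1 x⁻¹, inv_coord f.1 f.2⟩ = -X.functional f := by
  obtain ⟨k, a, b, h⟩ := mul_coord f.1 f.2
  let b' : Fin k → coord (G := G) := fun i => ⟨fun x => (b i).1 x⁻¹, inv_coord _ (b i).2⟩
  have e1 : ∑ i, a i * b' i = algebraMap ℂ _ (f.1 1) := by
    apply Subtype.ext
    funext x
    have := h x x⁻¹
    rw [mul_inv_cancel] at this
    simpa using this.symm
  have e2 : ∑ i, (a i).1 1 • b' i = ⟨fun x => f.1 x⁻¹, inv_coord f.1 f.2⟩ := by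
    apply Subtype.ext
    funext x
    have := h 1 x⁻¹
    rw [one_mul] at this
    simpa using this.symm
  have e3 : ∑ i, (b i).1 1 • a i = f := by
    apply Subtype.ext
    funext x
    have := h x 1
    rw [mul_one] at this
    simpa [mul_comm] using this.symm
  have e4 := congrArg X.functional e1
  rw [map_sum, X.functional_algebraMap] at e4
  simp only [X.leibniz, Finset.sum_add_distrib] at e4
  rw [← e2, ← congrArg X.functional e3]
  simp only [map_sum, map_smul, smul_eq_mul]
  have e5 : ∀ i, (b' i).1 1 = (b i).1 1 := fun i => congrArg (b i).1 inv_one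
  simp only [e5] at e4
  linear_combination e4

/-- The derivative at `1` of the coadjoint action. -/
theorem LieAlg.functional_coad (X Y : LieAlg G) (L : Dual ℂ (LieAlg G)) :
    X.functional ⟨fun g => L (Ad G g⁻¹ Y), coad_mem L Y⟩ = -L ⁅X, Y⁆ := by
  obtain ⟨f, hf⟩ := exists_eval L
  obtain ⟨k, a, b, h⟩ := mul_coord f.1 f.2
  choose k' a' b' h' using fun i => mul_coord (b i).1 (b i).2
  -- The decomposition of f(xyz) into products of functions of x, y, z. It expresses both the
  -- conjugation f(g⁻¹xg) and the two left-invariant derivatives in the bracket through the same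
  -- functions.
  have h3 : ∀ x y z : G, f.1 (x * y * z) =
      ∑ i, ∑ j, (a i).1 x * (b' i j).1 z * (a' i j).1 y := by
    intro x y z
    rw [mul_assoc, h]
    refine Finset.sum_congr rfl fun i _ => ?_
    rw [h', Finset.mul_sum]
    exact Finset.sum_congr rfl fun j _ => by ring
  let c : Fin k → coord (G := G) := fun i => ⟨fun x => (a i).1 x⁻¹, inv_coord _ (a i).2⟩
  have e0 : (⟨fun g => L (Ad G g⁻¹ Y), coad_mem L Y⟩ : coord (G := G)) =
      ∑ i, ∑ j, Y.functional (a' i j) • (c i * b' i j) := by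
    apply Subtype.ext
    funext g
    have e : (⟨fun x => f.1 (g⁻¹ * x * g⁻¹⁻¹), conj_mem g⁻¹ f.1 f.2⟩ : coord (G := G)) =
        ∑ i, ∑ j, ((a i).1 g⁻¹ * (b' i j).1 g) • a' i j := by
      apply Subtype.ext
      funext x
      simp only [h3, inv_inv, AddSubmonoidClass.coe_finsetSum, Finset.sum_apply,
        SetLike.val_smul, Pi.smul_apply, smul_eq_mul]
    change L (Ad G g⁻¹ Y) = _
    rw [hf, functional_Ad, e]
    simp only [map_sum, map_smul, smul_eq_mul, AddSubmonoidClass.coe_finsetSum, Finset.sum_apply,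
        SetLike.val_smul, Pi.smul_apply, MulMemClass.coe_mul, Pi.mul_apply]
    exact Finset.sum_congr rfl fun i _ => Finset.sum_congr rfl fun j _ => by ring
  have e1 : leftInv X.functional f =
      ∑ i, ∑ j, ((a i).1 1 * X.functional (b' i j)) • a' i j := by
    apply Subtype.ext
    funext x
    have e : leftTr x f = ∑ i, ∑ j, ((a i).1 1 * (a' i j).1 x) • b' i j := by
      apply Subtype.ext
      funext y
      have := h3 1 x y
      rw [one_mul] at this
      rw [leftTr_apply, this]
      simp only [AddSubmonoidClass.coe_finsetSum, Finset.sum_apply, SetLike.val_smul,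
        Pi.smul_apply, smul_eq_mul]
      exact Finset.sum_congr rfl fun i _ => Finset.sum_congr rfl fun j _ => by ring
    rw [leftInv_apply, e]
    simp only [map_sum, map_smul, smul_eq_mul, AddSubmonoidClass.coe_finsetSum, Finset.sum_apply,
        SetLike.val_smul, Pi.smul_apply]
    exact Finset.sum_congr rfl fun i _ => Finset.sum_congr rfl fun j _ => by ring
  have e2 : leftInv Y.functional f =
      ∑ i, ∑ j, ((b' i j).1 1 * Y.functional (a' i j)) • a i := by
    apply Subtype.ext
    funext x
    have e : leftTr x f = ∑ i, ∑ j, ((a i).1 x * (b' i j).1 1) • a' i j := by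
      apply Subtype.ext
      funext y
      have := h3 x y 1
      rw [mul_one] at this
      rw [leftTr_apply, this]
      simp only [AddSubmonoidClass.coe_finsetSum, Finset.sum_apply, SetLike.val_smul,
        Pi.smul_apply, smul_eq_mul]
    rw [leftInv_apply, e]
    simp only [map_sum, map_smul, smul_eq_mul, AddSubmonoidClass.coe_finsetSum, Finset.sum_apply,
        SetLike.val_smul, Pi.smul_apply]
    exact Finset.sum_congr rfl fun i _ => Finset.sum_congr rfl fun j _ => by ring
  -- Both sides become Σ Y(a'ᵢⱼ) (aᵢ(1) X(b'ᵢⱼ) - b'ᵢⱼ(1) X(aᵢ)); the minus sign on the left comes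
  -- from differentiating the inversion.
  rw [hf, functional_lie, e0, e1, e2]
  simp only [map_sum, map_smul, smul_eq_mul, X.leibniz, c, X.functional_comp_inv, inv_one,
    ← Finset.sum_sub_distrib, ← Finset.sum_neg_distrib]
  exact Finset.sum_congr rfl fun i _ => Finset.sum_congr rfl fun j _ => by ring

theorem Ad_lie (g : G) (X Y : LieAlg G) : Ad G g ⁅X, Y⁆ = ⁅Ad G g X, Ad G g Y⁆ :=
  (lieMap (MulAut.conj g).toMonoidHom (conj_mem g)).map_lie X Y

end AffineAlgGroup

/-! ### Velocity vectors and the characteristic distribution -/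

namespace AlgGroupSystem

variable (S : AlgGroupSystem.{u}) (lam : S.LieDual)

/-- The elements `X` and `x` may come from different levels; at a common level this is
`LieAlg.functional_coad`. -/
theorem functional_coadN (n : ℕ) (X : S.LieN n) (μ : S.LieDual) (x : S.LieInf) :
    X.functional ⟨fun g => S.coadN n g μ x, S.coadN_mem n μ x⟩ = -μ ⁅S.toLie n X, x⁆ := by
  induction x using S.lie_ind with | _ k Y =>
  let N := max n k
  have hn : n ≤ N := le_max_left n k
  have hk : k ≤ N := le_max_right n k
  have e : (⟨fun g => S.coadN n g μ (S.toLie k Y), S.coadN_mem n μ _⟩ : coord (G := S.G n)) =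
      comorphism (S.ι n N hn) (S.emb n N hn).pullback
        ⟨fun g => S.res N μ (Ad (S.G N) g⁻¹ (S.lieι k N hk Y)), coad_mem _ _⟩ := by
    apply Subtype.ext
    funext g
    change S.coadN n g μ (S.toLie k Y) =
      μ (S.toLie N (Ad (S.G N) (S.ι n N hn g)⁻¹ (S.lieι k N hk Y)))
    rw [← S.coadN_ι n N hn, ← S.toLie_lieι k N hk, coadN_apply]
  rw [e, ← functional_lieMap, LieAlg.functional_coad, ← S.toLie_lieι n N hn,
    ← S.toLie_lieι k N hk, toLie_lie]
  rfl

/-- The velocity vector of `X ∈ 𝔤ₙ` at a point of `Gₙ · λ`. -/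
noncomputable def velN (n : ℕ) (m : S.orbitN lam n) :
    S.LieN n →ₗ[ℂ] (S.orbitNSpace lam n).Tangent m :=
  velocity (S.coadN n) lam m

theorem velN_diff_evalFn (n : ℕ) (m : S.orbitN lam n) (X : S.LieN n) (x : S.LieInf) :
    S.velN lam n m X ((S.orbitNSpace lam n).diff m fun μ : S.orbitN lam n => μ.1 x) =
        -m.1 ⁅S.toLie n X, x⁆ := by
  rw [← S.functional_coadN]
  exact velocity_diff m X ((S.isMorphism_inclN lam n).pullback m _ (S.evalFn_reg m.1 x))
    (S.coadN_mem n m.1 x)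

theorem anchor_cotangentEquiv (μ : S.LieDual) (x y : S.LieInf) :
    S.anchor μ (S.cotangentEquiv μ x) (S.cotangentEquiv μ y) = μ ⁅x, y⁆ := by
  change μ ⁅(S.cotangentEquiv μ).symm _, (S.cotangentEquiv μ).symm _⁆ = _
  rw [LinearEquiv.symm_apply_apply, LinearEquiv.symm_apply_apply]

/-- The velocity vectors are the values of the anchor map. -/
theorem differential_inclN_velN (n : ℕ) (m : S.orbitN lam n) (X : S.LieN n) :
    (S.isMorphism_inclN lam n).differential (x := m) rfl (S.velN lam n m X) =
      S.anchor m.1 (S.cotangentEquiv m.1 (-S.toLie n X)) := by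
  apply LinearMap.ext
  intro c
  obtain ⟨x, rfl⟩ := (S.cotangentEquiv m.1).surjective c
  rw [anchor_cotangentEquiv, neg_lie, map_neg, ← velN_diff_evalFn]
  exact (S.isMorphism_inclN lam n).differential_diff rfl _ (S.evalFn_reg _ _)

theorem dIncl_tangentOf (μ : S.orbit lam) (n : ℕ) (hn : μ.1 ∈ S.orbitN lam n)
    (ξ : (S.orbitNSpace lam n).Tangent ⟨μ.1, hn⟩) :
    S.dIncl lam μ (S.tangentOf lam μ n hn ξ) =
      (S.isMorphism_inclN lam n).differential (x := ⟨μ.1, hn⟩) rfl ξ :=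
  Module.DirectLimit.lift_of ..

theorem exists_tangentOf (μ : S.orbit lam) (Y : S.OrbitTangent lam μ) :
    ∃ n hn ξ, S.tangentOf lam μ n hn ξ = Y := by
  have : Nonempty {l : ℕ // μ.1 ∈ S.orbitN lam l} := by
    obtain ⟨n, hn⟩ := S.exists_mem_orbitN lam μ
    exact ⟨⟨n, hn⟩⟩
  obtain ⟨l, ξ, h⟩ := Module.DirectLimit.exists_of Y
  exact ⟨l.1, l.2, ξ, h⟩

theorem tangentOf_trans (μ : S.orbit lam) {l m : ℕ} (h : l ≤ m) (hl : μ.1 ∈ S.orbitN lam l)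
    (ξ : (S.orbitNSpace lam l).Tangent ⟨μ.1, hl⟩) :
    S.tangentOf lam μ m (S.orbitN_mono lam h hl)
      (S.tangentTrans lam μ ⟨l, hl⟩ ⟨m, S.orbitN_mono lam h hl⟩ h ξ) =
        S.tangentOf lam μ l hl ξ :=
  Module.DirectLimit.of_f ..

/-- Two tangent vectors of the orbit come from a common `T_μ(Gₙ · λ)`. -/
theorem exists_tangentOf₂ (μ : S.orbit lam) (Y Z : S.OrbitTangent lam μ) :
    ∃ n hn ξ η, S.tangentOf lam μ n hn ξ = Y ∧ S.tangentOf lam μ n hn η = Z := by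
  obtain ⟨l, hl, ξ, rfl⟩ := S.exists_tangentOf lam μ Y
  obtain ⟨m, hm, η, rfl⟩ := S.exists_tangentOf lam μ Z
  exact ⟨max l m, S.orbitN_mono lam (le_max_left l m) hl, _, _,
    S.tangentOf_trans lam μ (le_max_left l m) hl ξ,
    S.tangentOf_trans lam μ (le_max_right l m) hm η⟩

section Connected

variable (hconn : ∀ n, @ConnectedSpace (S.G n) (groupVariety (S.G n)).top)

include hconn

theorem velN_surjective (n : ℕ) (m : S.orbitN lam n) : Function.Surjective (S.velN lam n m) :=
  S.velocity_orbitN_surjective lam hconn n m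

/-- Every tangent vector is a velocity, hence an anchor value. Conversely, x ∈ 𝔤 comes from some 𝔤ₖ,
and raising the level until μ ∈ Gₙ · λ realizes its anchor value as a velocity. -/
theorem range_dIncl (μ : S.orbit lam) : LinearMap.range (S.dIncl lam μ) = S.charDist μ.1 := by
  apply le_antisymm
  · rintro _ ⟨Y, rfl⟩
    obtain ⟨n, hn, ξ, rfl⟩ := S.exists_tangentOf lam μ Y
    obtain ⟨X, rfl⟩ := S.velN_surjective lam hconn n ⟨μ.1, hn⟩ ξ
    rw [dIncl_tangentOf, differential_inclN_velN]
    exact ⟨_, rfl⟩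
  · rintro _ ⟨c, rfl⟩
    obtain ⟨x, rfl⟩ := (S.cotangentEquiv μ.1).surjective c
    induction x using S.lie_ind with | _ k X =>
    obtain ⟨l, hl⟩ := S.exists_mem_orbitN lam μ
    have hn := S.orbitN_mono lam (le_max_left l k) hl
    refine ⟨S.tangentOf lam μ (max l k) hn
      -- The sign compensates for the velocity of X being the anchor value of -X.
      (S.velN lam (max l k) ⟨μ.1, hn⟩ (-S.lieι k _ (le_max_right l k) X)), ?_⟩
    rw [dIncl_tangentOf, differential_inclN_velN, map_neg (S.toLie _), neg_neg,
      toLie_lieι]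

end Connected

end AlgGroupSystem

/-! ## The form on the coadjoint orbit -/

namespace AlgGroupSystem

variable (S : AlgGroupSystem.{u}) (lam : S.LieDual)

/-- The form on `G · λ` that is induced by the Poisson bivector. -/
noncomputable def omegaInf
    (h : ∀ μ : S.orbit lam, LinearMap.range (S.dIncl lam μ) = S.charDist μ.1) :
    S.OrbitForm lam := fun μ =>
  let e := (S.anchorEquiv μ.1).symm.toLinearMap ∘ₗ
    (S.dIncl lam μ).codRestrict (S.charDist μ.1) fun Y => (h μ).le ⟨Y, rfl⟩
  (S.redBivector μ.1).compl₁₂ e e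

section Form

variable (h : ∀ μ : S.orbit lam, LinearMap.range (S.dIncl lam μ) = S.charDist μ.1)

theorem omegaInf_apply (μ : S.orbit lam) (Y Z : S.OrbitTangent lam μ) :
    S.omegaInf lam h μ Y Z = S.redBivector μ.1
      ((S.anchorEquiv μ.1).symm ⟨S.dIncl lam μ Y, (h μ).le ⟨Y, rfl⟩⟩)
      ((S.anchorEquiv μ.1).symm ⟨S.dIncl lam μ Z, (h μ).le ⟨Z, rfl⟩⟩) := rfl

/-- The form can be computed with any preimages under the anchor map; all later properties are read
off from this. -/
theorem omegaInf_eq_bivector (μ : S.orbit lam) {Y Z : S.OrbitTangent lam μ}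
    {α β : S.proVariety.Cotangent μ.1} (hα : S.anchor μ.1 α = S.dIncl lam μ Y)
    (hβ : S.anchor μ.1 β = S.dIncl lam μ Z) :
    S.omegaInf lam h μ Y Z = S.bivector μ.1 α β := by
  have key : ∀ {Y : S.OrbitTangent lam μ} {α : S.proVariety.Cotangent μ.1},
      S.anchor μ.1 α = S.dIncl lam μ Y → (S.anchorEquiv μ.1).symm
        ⟨S.dIncl lam μ Y, (h μ).le ⟨Y, rfl⟩⟩ = Submodule.Quotient.mk α := by
    intro Y α hα
    rw [LinearEquiv.symm_apply_eq]
    exact Subtype.ext hα.symm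
  rw [omegaInf_apply, key hα, key hβ, redBivector_mk]

theorem bivector_cotangentEquiv (μ : S.LieDual) (x y : S.LieInf) :
    S.bivector μ (S.cotangentEquiv μ x) (S.cotangentEquiv μ y) = μ ⁅x, y⁆ :=
  S.anchor_cotangentEquiv μ x y

theorem omegaInf_velN (μ : S.orbit lam) (n : ℕ) (hn : μ.1 ∈ S.orbitN lam n) (X Y : S.LieN n) :
    S.omegaInf lam h μ (S.tangentOf lam μ n hn (S.velN lam n ⟨μ.1, hn⟩ X))
      (S.tangentOf lam μ n hn (S.velN lam n ⟨μ.1, hn⟩ Y)) = μ.1 ⁅S.toLie n X, S.toLie n Y⁆ := by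
  rw [S.omegaInf_eq_bivector lam h μ (α := S.cotangentEquiv μ.1 (-S.toLie n X))
    (β := S.cotangentEquiv μ.1 (-S.toLie n Y)), bivector_cotangentEquiv, neg_lie, lie_neg, neg_neg]
  · rw [dIncl_tangentOf, differential_inclN_velN]
  · rw [dIncl_tangentOf, differential_inclN_velN]

theorem restrictForm_omegaInf_velN (n : ℕ) (m : S.orbitN lam n) (X Y : S.LieN n) :
    S.restrictForm lam (S.omegaInf lam h) n m (S.velN lam n m X) (S.velN lam n m Y) =
      m.1 ⁅S.toLie n X, S.toLie n Y⁆ :=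
  S.omegaInf_velN lam h ⟨m.1, S.orbitN_subset lam n m.2⟩ n m.2 X Y

theorem isAlt_omegaInf (μ : S.orbit lam) : (S.omegaInf lam h μ).IsAlt := by
  intro Y
  obtain ⟨α, hα⟩ := (h μ).le ⟨Y, rfl⟩
  obtain ⟨x, rfl⟩ := (S.cotangentEquiv μ.1).surjective α
  rw [S.omegaInf_eq_bivector lam h μ hα hα, bivector_cotangentEquiv, lie_self, map_zero]

/-- Write di(Y) as the anchor value of α. Every anchor value of a covector β is di(Z) for some Z, so
if ω(Y, ·) = 0, then π(α, β) = ω(Y, Z) = 0 for all β. Hence di(Y) = 0. -/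
theorem omegaInf_injective (hinj : ∀ μ : S.orbit lam, Function.Injective (S.dIncl lam μ))
    (μ : S.orbit lam) : Function.Injective (S.omegaInf lam h μ) := by
  rw [← LinearMap.ker_eq_bot, LinearMap.ker_eq_bot']
  intro Y hY
  obtain ⟨α, hα⟩ := (h μ).le ⟨Y, rfl⟩
  apply hinj μ
  rw [map_zero, ← hα]
  apply LinearMap.ext
  intro β
  obtain ⟨Z, hZ⟩ := (h μ).ge ⟨β, rfl⟩
  have := S.omegaInf_eq_bivector lam h μ hα hZ.symm
  rw [hY] at this
  exact this.symm

theorem isMorphism_omega (ω : S.OrbitForm lam) (μ : S.orbit lam) (l m : ℕ)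
    (hl : μ.1 ∈ S.orbitN lam l) (hm : μ.1 ∈ S.orbitN lam m) :
    IsMorphism (linVariety ((S.orbitNSpace lam l).Tangent ⟨μ.1, hl⟩))
      (dualVariety ((S.orbitNSpace lam m).Tangent ⟨μ.1, hm⟩))
      (fun ξ => ω μ (S.tangentOf lam μ l hl ξ) ∘ₗ S.tangentOf lam μ m hm) := by
  refine isMorphism_affine _ _ _ (comp_mem_of_adjoin _ ?_)
  rintro _ ⟨η, rfl⟩
  exact Algebra.subset_adjoin
    ⟨(ω μ).flip (S.tangentOf lam μ m hm η) ∘ₗ S.tangentOf lam μ l hl, rfl⟩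

/-- The velocity vector of `X ∈ 𝔤ₙ` at a point of `Gₙ · λₙ`. -/
noncomputable def velFin (n : ℕ) (m : S.finOrbit lam n) :
    S.LieN n →ₗ[ℂ] (S.finOrbitSpace lam n).Tangent m :=
  velocity (S.coadFin n) (S.res n lam) m

theorem velFin_diff_eval (n : ℕ) (m : S.finOrbit lam n) (X Y : S.LieN n) :
    S.velFin lam n m X ((S.finOrbitSpace lam n).diff m fun μ : S.finOrbit lam n => μ.1 Y) =
      -m.1 ⁅X, Y⁆ := by
  rw [← LieAlg.functional_coad]
  exact velocity_diff m X ((S.modelFin lam n).isRegAt_comp_toDual m (eval_mem_polyFns Y))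
    (coad_mem m.1 Y)

/-- This makes the Kostant-Kirillov form well defined. -/
theorem lie_eq_zero_of_velFin_eq_zero {n : ℕ} {m : S.finOrbit lam n} {X : S.LieN n}
    (hX : S.velFin lam n m X = 0) (Y : S.LieN n) : m.1 ⁅X, Y⁆ = 0 := by
  rw [← neg_eq_zero, ← velFin_diff_eval, hX, LinearMap.zero_apply]

/-- The projection is equivariant, so it carries orbit maps to orbit maps. -/
theorem differential_proj_velN (n : ℕ) (m : S.orbitN lam n) (X : S.LieN n) :
    (S.isMorphism_proj lam n).differential (x := m) rfl (S.velN lam n m X) =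
      S.velFin lam n (S.proj lam n m) X := by
  have e : S.proj lam n ∘ orbMap (S.coadN n) lam m =
      orbMap (S.coadFin n) (S.res n lam) (S.proj lam n m) :=
    funext fun g => Subtype.ext (S.res_coadN n g m.1)
  exact (S.isMorphism_proj lam n).differential_comp (isMorphism_orbMap (S.coadN n) lam m)
    (isMorphism_orbMap (S.coadFin n) (S.res n lam) (S.proj lam n m)) e
    (orbMap_one (S.coadN n) lam m) rfl
    (orbMap_one (S.coadFin n) (S.res n lam) (S.proj lam n m)) (LieAlg.toTangent X)

end Form

section Connected

variable (hconn : ∀ n, @ConnectedSpace (S.G n) (groupVariety (S.G n)).top)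

include hconn

theorem exists_isKostantKirillov (n : ℕ) : ∃ κ, S.IsKostantKirillov lam n κ := by
  choose s hs using fun m : S.finOrbit lam n =>
    (S.velFin lam n m).exists_rightInverse_of_surjective
      (LinearMap.range_eq_top.2 (S.velocity_finOrbit_surjective lam hconn n m))
  let B : ∀ m : S.finOrbit lam n, S.LieN n →ₗ[ℂ] S.LieN n →ₗ[ℂ] ℂ := fun m =>
    LinearMap.mk₂ ℂ (fun X Y => m.1 ⁅X, Y⁆) (fun X X' Y => by rw [add_lie, map_add])
      (fun c X Y => by rw [smul_lie, map_smul]) (fun X Y Y' => by rw [lie_add, map_add])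
      (fun c X Y => by rw [lie_smul, map_smul])
  refine ⟨fun m => (B m).compl₁₂ (s m) (s m), fun m X Y => ?_⟩
  -- The section `s` returns `X` up to an element with zero velocity, which lies in the radical of
  -- m[·, ·].
  have hd : ∀ X Y : S.LieN n, m.1 ⁅s m (S.velFin lam n m X), Y⁆ = m.1 ⁅X, Y⁆ := by
    intro X Y
    rw [← sub_eq_zero, ← map_sub, ← sub_lie]
    apply S.lie_eq_zero_of_velFin_eq_zero lam
    rw [map_sub, sub_eq_zero]
    exact LinearMap.congr_fun (hs m) _
  change m.1 ⁅s m (S.velFin lam n m X), s m (S.velFin lam n m Y)⁆ = _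
  rw [hd, ← lie_skew, map_neg, hd, ← map_neg, lie_skew]

theorem isOmegaInf_omegaInf
    (h : ∀ μ : S.orbit lam, LinearMap.range (S.dIncl lam μ) = S.charDist μ.1) :
    S.IsOmegaInf lam (S.omegaInf lam h) := by
  choose κ hκ using S.exists_isKostantKirillov lam hconn
  refine ⟨κ, hκ, fun n m ξ η => ?_⟩
  obtain ⟨X, rfl⟩ := S.velN_surjective lam hconn n m ξ
  obtain ⟨Y, rfl⟩ := S.velN_surjective lam hconn n m η
  rw [restrictForm_omegaInf_velN, differential_proj_velN, differential_proj_velN, toLie_lie]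
  exact (hκ n (S.proj lam n m) X Y).symm

/-- Two tangent vectors come from a common level and are velocities there, and on velocities the two
families κ and κ' are prescribed. -/
theorem isOmegaInf_unique {ω ω' : S.OrbitForm lam} (hω : S.IsOmegaInf lam ω)
    (hω' : S.IsOmegaInf lam ω') : ω' = ω := by
  obtain ⟨κ, hκ, hω⟩ := hω
  obtain ⟨κ', hκ', hω'⟩ := hω'
  funext μ
  apply LinearMap.ext
  intro Y
  apply LinearMap.ext
  intro Z
  obtain ⟨n, hn, ξ, η, rfl, rfl⟩ := S.exists_tangentOf₂ lam μ Y Z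
  obtain ⟨X, rfl⟩ := S.velN_surjective lam hconn n ⟨μ.1, hn⟩ ξ
  obtain ⟨Y, rfl⟩ := S.velN_surjective lam hconn n ⟨μ.1, hn⟩ η
  refine (hω' n ⟨μ.1, hn⟩ _ _).trans (Eq.trans ?_ (hω n ⟨μ.1, hn⟩ _ _).symm)
  rw [differential_proj_velN, differential_proj_velN]
  exact (hκ' n _ X Y).trans (hκ n _ X Y).symm

end Connected

end AlgGroupSystem

/-! ## Derivatives of vector-valued functions -/

namespace SpaceWithFunctions

section Derivative

variable {X : Type u} (S : SpaceWithFunctions X) (p : X) {W : Type v} [AddCommGroup W] [Module ℂ W]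

/-- The differential of regular functions as a linear map. -/
noncomputable def diffLin : S.regFns p →ₗ[ℂ] S.Cotangent p where
  toFun f := S.diff p f.1
  map_add' f g := S.diff_add f.2 g.2
  map_smul' c f := S.diff_smul c f.2

variable {S p}

/-- The derivative of a vector-valued function along a tangent vector. -/
noncomputable def Tangent.deriv [FiniteDimensional ℂ W] (t : S.Tangent p) (ξ : X → W) : W :=
  ∑ i, t (S.diff p fun x => (finBasis ℂ W).coord i (ξ x)) • finBasis ℂ W i

variable [FiniteDimensional ℂ W] {ξ : X → W} (hξ : ∀ L : Dual ℂ W, S.IsRegAt p fun x => L (ξ x))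
  (F : W →ₗ[ℂ] (X → ℂ)) (hF : ∀ w, S.IsRegAt p (F w))

include hξ hF

/-- Expand ξ in a basis of the finite-dimensional space `W`; the Leibniz rule below is proved in the
same way. -/
theorem isRegAt_pairing : S.IsRegAt p fun x => F (ξ x) x := by
  have e : (fun x => F (ξ x) x) =
      ∑ i, (fun x => (finBasis ℂ W).coord i (ξ x)) * F (finBasis ℂ W i) := by
    funext x
    conv_lhs => rw [← (finBasis ℂ W).sum_repr (ξ x), map_sum, Finset.sum_apply]
    simp only [map_smul, Pi.smul_apply, smul_eq_mul, Finset.sum_apply, Pi.mul_apply,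
      Basis.coord_apply]
  rw [e]
  exact (S.regFns p).sum_mem fun i _ => S.mul_mem p _ _ (hξ _) (hF _)

/-- The Leibniz rule for the pairing of a vector-valued function with a family of functions. -/
theorem Tangent.apply_diff_pairing (t : S.Tangent p) :
    t (S.diff p fun x => F (ξ x) x) = t (S.diff p (F (ξ p))) + F (Tangent.deriv t ξ) p := by
  let b := finBasis ℂ W
  let c : Fin (finrank ℂ W) → S.regFns p := fun i => ⟨fun x => b.coord i (ξ x), hξ _⟩
  let f : Fin (finrank ℂ W) → S.regFns p := fun i => ⟨F (b i), hF _⟩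
  have e1 : (fun x => F (ξ x) x) = (∑ i, c i * f i : S.regFns p).1 := by
    funext x
    conv_lhs => rw [← b.sum_repr (ξ x), map_sum, Finset.sum_apply]
    simp only [map_smul, Pi.smul_apply, smul_eq_mul, AddSubmonoidClass.coe_finsetSum,
      Finset.sum_apply, MulMemClass.coe_mul, Pi.mul_apply, Basis.coord_apply, c, f]
  have e2 : F (ξ p) = (∑ i, (c i).1 p • f i : S.regFns p).1 := by
    conv_lhs => rw [← b.sum_repr (ξ p), map_sum]
    simp only [map_smul, AddSubmonoidClass.coe_finsetSum, SetLike.val_smul, Basis.coord_apply, c, f]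
  have e3 : ∀ i, S.diffLin p (c i * f i) =
      (c i).1 p • S.diffLin p (f i) + (f i).1 p • S.diffLin p (c i) := fun i =>
    S.diff_mul (c i).2 (f i).2
  rw [e1, e2]
  change t (S.diffLin p (∑ i, c i * f i)) = t (S.diffLin p (∑ i, (c i).1 p • f i)) + _
  simp only [map_sum, map_smul, e3, map_add, Finset.sum_add_distrib, smul_eq_mul]
  congr 1
  rw [Tangent.deriv]
  simp only [map_sum, map_smul, Finset.sum_apply, Pi.smul_apply, smul_eq_mul]
  exact Finset.sum_congr rfl fun i _ => mul_comm _ _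

end Derivative

section Derivative

variable {X : Type u} {S : SpaceWithFunctions X} {p : X} {W : Type v} [AddCommGroup W] [Module ℂ W]
  [FiniteDimensional ℂ W] {ξ η : X → W}

theorem Tangent.apply_diff_linear (hξ : ∀ L : Dual ℂ W, S.IsRegAt p fun x => L (ξ x))
    (L : Dual ℂ W) (t : S.Tangent p) :
    t (S.diff p fun x => L (ξ x)) = L (Tangent.deriv t ξ) := by
  let F : W →ₗ[ℂ] (X → ℂ) := LinearMap.pi fun _ => L
  have h := Tangent.apply_diff_pairing hξ F (fun w => S.const_mem p (L w)) t
  have h0 : S.diff p (F (ξ p)) = 0 := S.diff_const p _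
  rw [h0, map_zero, zero_add] at h
  exact h

theorem isRegAt_bilinear (hξ : ∀ L : Dual ℂ W, S.IsRegAt p fun x => L (ξ x))
    (hη : ∀ L : Dual ℂ W, S.IsRegAt p fun x => L (η x)) (B : W →ₗ[ℂ] W →ₗ[ℂ] ℂ) :
    S.IsRegAt p fun x => B (ξ x) (η x) :=
  isRegAt_pairing hξ (LinearMap.pi fun x => B.flip (η x)) fun w => hη (B w)

theorem Tangent.apply_diff_bilinear (hξ : ∀ L : Dual ℂ W, S.IsRegAt p fun x => L (ξ x))
    (hη : ∀ L : Dual ℂ W, S.IsRegAt p fun x => L (η x)) (B : W →ₗ[ℂ] W →ₗ[ℂ] ℂ)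
    (t : S.Tangent p) : t (S.diff p fun x => B (ξ x) (η x)) =
      B (ξ p) (Tangent.deriv t η) + B (Tangent.deriv t ξ) (η p) := by
  rw [← Tangent.apply_diff_linear hη]
  exact Tangent.apply_diff_pairing hξ (LinearMap.pi fun x => B.flip (η x)) (fun w => hη (B w)) t

end Derivative

end SpaceWithFunctions

/-- A section over the range, extended to the whole target. It solves f(x) = y linearly in y, so the
solution depends regularly on y; this is how lifts of vector fields are made regular. -/
theorem LinearMap.exists_quasi_inverse {K V W : Type*} [Field K] [AddCommGroup V] [Module K V]
    [AddCommGroup W] [Module K W] (f : V →ₗ[K] W) :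
    ∃ g : W →ₗ[K] V, ∀ x, f (g (f x)) = f x := by
  obtain ⟨s, hs⟩ := f.rangeRestrict.exists_rightInverse_of_surjective f.range_rangeRestrict
  obtain ⟨g, hg⟩ := LinearMap.exists_extend s
  refine ⟨g, fun x => ?_⟩
  have h1 : g (f x) = s (f.rangeRestrict x) := LinearMap.congr_fun hg (f.rangeRestrict x)
  rw [h1]
  exact congrArg Subtype.val (LinearMap.congr_fun hs (f.rangeRestrict x))

/-! ## Left translates of tangent vectors -/

namespace AffineAlgGroup

variable {G : Type u} [Group G] [AffineAlgGroup G]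

theorem isMorphism_mul_left (g : G) :
    IsMorphism (groupVariety G) (groupVariety G) fun h => g * h :=
  isMorphism_affine _ _ _ fun _ hf => left_mem hf g

/-- The value at `g` of the left-invariant vector field of `X`. -/
noncomputable def leftTangent (g : G) : LieAlg G →ₗ[ℂ] (groupVariety G).Tangent g :=
  (isMorphism_mul_left g).differential (mul_one g) ∘ₗ LieAlg.toTangent

theorem leftTangent_diff (g : G) (X : LieAlg G) {f : G → ℂ} (hf : f ∈ coord (G := G)) :
    leftTangent g X ((groupVariety G).diff g f) = X.functional ⟨fun h => f (g * h), left_mem hf g⟩ := by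
  refine ((isMorphism_mul_left g).differential_diff (mul_one g) (LieAlg.toTangent X)
    (affine_isRegAt _ hf g)).trans ?_
  exact tangentOfPointDer_diff (A := coord (G := G)) X ⟨_, left_mem hf g⟩

theorem Ad_apply_mem (L : Dual ℂ (LieAlg G)) (X : LieAlg G) :
    (fun g => L (Ad G g X)) ∈ coord (G := G) := by
  have := inv_coord _ (coad_mem L X)
  simpa only [inv_inv] using this

end AffineAlgGroup

/-! ## Vector fields on coadjoint orbits -/

namespace AlgGroupSystem

variable (S : AlgGroupSystem.{u}) (lam : S.LieDual)

theorem AdInf_lie (g : S.GInf) (x y : S.LieInf) :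
    S.AdInf g ⁅x, y⁆ = ⁅S.AdInf g x, S.AdInf g y⁆ :=
  S.group_ind_lie₂ (C := fun g x y => S.AdInf g ⁅x, y⁆ = ⁅S.AdInf g x, S.AdInf g y⁆)
    (fun n g X Y => by rw [toLie_lie, AdInf_mk, AdInf_mk, AdInf_mk, toLie_lie, Ad_lie]) g x y

/-- The action of `g⁻¹` on `𝔤`, for `g ∈ Gₙ`. -/
noncomputable def adInv (n : ℕ) (g : S.G n) : S.LieInf →ₗ[ℂ] S.LieInf := S.AdInf (S.toGInf n g)⁻¹

theorem adInv_toLie {n K : ℕ} (h : n ≤ K) (g : S.G n) (X : S.LieN K) :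
    S.adInv n g (S.toLie K X) = S.toLie K (Ad (S.G K) (S.ι n K h g)⁻¹ X) := by
  rw [adInv, ← S.toGInf_ι n K h, ← map_inv, AdInf_mk]

theorem adInv_lie (n : ℕ) (g : S.G n) (x y : S.LieInf) :
    S.adInv n g ⁅x, y⁆ = ⁅S.adInv n g x, S.adInv n g y⁆ := S.AdInf_lie _ x y

theorem adInv_toLie_Ad (n : ℕ) (g : S.G n) (X : S.LieN n) :
    S.adInv n g (S.toLie n (Ad (S.G n) g X)) = S.toLie n X := by
  rw [adInv, ← map_inv, AdInf_mk, ← Module.End.mul_apply, ← map_mul, inv_mul_cancel, map_one]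
  rfl

/-- The orbit map `Gₙ → Gₙ · λ`. -/
noncomputable def baseN (n : ℕ) : S.G n → S.orbitN lam n := orbMap (S.coadN n) lam ⟨lam, mem_orb_self _ lam⟩

theorem isMorphism_baseN (n : ℕ) :
    IsMorphism (groupVariety (S.G n)) (S.orbitNSpace lam n) (S.baseN lam n) :=
  isMorphism_orbMap (S.coadN n) lam ⟨lam, mem_orb_self _ lam⟩

theorem exists_baseN (n : ℕ) (m : S.orbitN lam n) : ∃ g, S.baseN lam n g = m := by
  obtain ⟨_, g, rfl⟩ := m
  exact ⟨g, rfl⟩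

/-- By the definition of the quotient structure, regularity on an open set can be tested on the
group. -/
theorem isRegAt_orbitN {n : ℕ} {U : Set (S.orbitN lam n)} (hU : @IsOpen _ (S.orbitNSpace lam n).top U)
    {f : S.orbitN lam n → ℂ}
    (hf : ∀ g, S.baseN lam n g ∈ U → (groupVariety (S.G n)).IsRegAt g (f ∘ S.baseN lam n))
    {m : S.orbitN lam n} (hm : m ∈ U) : (S.orbitNSpace lam n).IsRegAt m f := by
  have h : ∀ᶠ m' in (S.orbitNSpace lam n).nbhd m, m' ∈ U :=
    let _ : TopologicalSpace (S.orbitN lam n) := (S.orbitNSpace lam n).top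
    hU.mem_nhds hm
  refine h.mono fun m' hm' _ g hg => hf g ?_
  have e : S.baseN lam n g = m' := hg
  rwa [e]

/-- The image in `T_{gλ}(Gₙ · λ)` of the left-invariant vector field of `X` at `g`. -/
noncomputable def leftVel (n : ℕ) (g : S.G n) :
    S.LieN n →ₗ[ℂ] (S.orbitNSpace lam n).Tangent (S.baseN lam n g) :=
  (S.isMorphism_baseN lam n).differential rfl ∘ₗ leftTangent g

theorem leftVel_diff (n : ℕ) (g : S.G n) (X : S.LieN n) {f : S.orbitN lam n → ℂ}
    (hf : (S.orbitNSpace lam n).IsRegAt (S.baseN lam n g) f) :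
    S.leftVel lam n g X ((S.orbitNSpace lam n).diff (S.baseN lam n g) f) =
      leftTangent g X ((groupVariety (S.G n)).diff g (f ∘ S.baseN lam n)) := by
  rw [leftVel, LinearMap.comp_apply]
  exact (S.isMorphism_baseN lam n).differential_diff rfl _ hf

/-- The linear function on `Gₙ · λ` defined by `x ∈ 𝔤`. -/
noncomputable def evalN (n : ℕ) (x : S.LieInf) : S.orbitN lam n → ℂ := fun μ => μ.1 x

theorem evalN_reg (n : ℕ) (m : S.orbitN lam n) (x : S.LieInf) :
    (S.orbitNSpace lam n).IsRegAt m (S.evalN lam n x) :=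
  (S.isMorphism_inclN lam n).pullback m _ (S.evalFn_reg m.1 x)

/-- The linear map `x ↦ d x` from `𝔤` to the cotangent space of `Gₙ · λ`. -/
noncomputable def evalDiff (n : ℕ) (m : S.orbitN lam n) :
    S.LieInf →ₗ[ℂ] (S.orbitNSpace lam n).Cotangent m where
  toFun x := (S.orbitNSpace lam n).diff m (S.evalN lam n x)
  map_add' x y := by
    rw [← (S.orbitNSpace lam n).diff_add (S.evalN_reg lam n m x) (S.evalN_reg lam n m y)]
    congr 1
    funext ν
    exact map_add ν.1 x y
  map_smul' c x := by
    rw [RingHom.id_apply, ← (S.orbitNSpace lam n).diff_smul c (S.evalN_reg lam n m x)]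
    congr 1
    funext ν
    exact map_smul ν.1 c x

theorem leftTangent_coadN (n : ℕ) (g : S.G n) (X : S.LieN n) (μ : S.LieDual) (x : S.LieInf) :
    leftTangent g X ((groupVariety (S.G n)).diff g fun h => S.coadN n h μ x) =
      -μ ⁅S.toLie n X, S.adInv n g x⁆ := by
  rw [leftTangent_diff g X (S.coadN_mem n μ x), ← functional_coadN]
  congr 1
  apply Subtype.ext
  funext h
  change S.coadN n (g * h) μ x = S.coadN n h μ (S.adInv n g x)
  rw [map_mul]
  rfl

theorem leftVel_evalN (n : ℕ) (g : S.G n) (X : S.LieN n) (x : S.LieInf) :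
    S.leftVel lam n g X ((S.orbitNSpace lam n).diff (S.baseN lam n g) (S.evalN lam n x)) =
      -lam ⁅S.toLie n X, S.adInv n g x⁆ := by
  rw [leftVel_diff _ _ _ _ _ (S.evalN_reg lam n _ x), ← leftTangent_coadN]
  rfl

/-- The values of a tangent vector of `Gₙ · λ` at `g · λ` on the functions `Ad g X`, for `X ∈ 𝔤_K`. -/
noncomputable def translatedValues {n K : ℕ} (h : n ≤ K)
    (g : S.G n) (t : (S.orbitNSpace lam n).Tangent (S.baseN lam n g)) : Dual ℂ (S.LieN K) :=
  t ∘ₗ S.evalDiff lam n (S.baseN lam n g) ∘ₗ S.toLie K ∘ₗ Ad (S.G K) (S.ι n K h g)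

theorem translatedValues_apply {n K : ℕ} (h : n ≤ K)
    (g : S.G n) (t : (S.orbitNSpace lam n).Tangent (S.baseN lam n g)) (X : S.LieN K) :
    S.translatedValues lam h g t X = t ((S.orbitNSpace lam n).diff _
      (S.evalN lam n (S.toLie K (Ad (S.G K) (S.ι n K h g) X)))) := rfl

theorem translatedValues_Ad_inv {n K : ℕ} (h : n ≤ K)
    (g : S.G n) (t : (S.orbitNSpace lam n).Tangent (S.baseN lam n g)) (X : S.LieN K) :
    S.translatedValues lam h g t (Ad (S.G K) (S.ι n K h g)⁻¹ X) =
      t ((S.orbitNSpace lam n).diff _ (S.evalN lam n (S.toLie K X))) := by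
  rw [translatedValues_apply, ← Module.End.mul_apply, ← map_mul, mul_inv_cancel, map_one]
  rfl

/-- The coefficients of Ad(g)X in a fixed basis of 𝔤_K are regular functions of g, and a vector
field has regular values on the basis elements. -/
theorem isRegAt_translatedValues {n K : ℕ} (h : n ≤ K) {U : Set (S.orbitN lam n)}
    {v : ∀ m, (S.orbitNSpace lam n).Tangent m} (hv : (S.orbitNSpace lam n).IsVectorFieldOn U v)
    {g : S.G n} (hg : S.baseN lam n g ∈ U) (X : S.LieN K) :
    (groupVariety (S.G n)).IsRegAt g fun y => S.translatedValues lam h y (v (S.baseN lam n y)) X := by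
  let b := finBasis ℂ (S.LieN K)
  have e : (fun y => S.translatedValues lam h y (v (S.baseN lam n y)) X) =
      ∑ i, (fun y => b.coord i (Ad (S.G K) (S.ι n K h y) X)) *
        ((fun m => v m ((S.orbitNSpace lam n).diff m (S.evalN lam n (S.toLie K (b i))))) ∘
          S.baseN lam n) := by
    funext y
    change (v (S.baseN lam n y) ∘ₗ S.evalDiff lam n (S.baseN lam n y) ∘ₗ S.toLie K)
      (Ad (S.G K) (S.ι n K h y) X) = _
    conv_lhs => rw [← b.sum_repr (Ad (S.G K) (S.ι n K h y) X), map_sum]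
    rw [Finset.sum_apply]
    refine Finset.sum_congr rfl fun i _ => ?_
    rw [map_smul]
    rfl
  rw [e]
  refine ((groupVariety (S.G n)).regFns g).sum_mem fun i _ =>
    (groupVariety (S.G n)).mul_mem g _ _ ?_ ?_
  · exact affine_isRegAt _ ((S.emb n K h).pullback _ (Ad_apply_mem (b.coord i) X)) g
  · exact (S.isMorphism_baseN lam n).pullback g _ (hv _ hg _ (S.evalN_reg lam n _ _))

/-- The values of left-invariant vector fields on the functions `Ad g X`. -/
noncomputable def bracketDual (n K : ℕ) : S.LieN n →ₗ[ℂ] Dual ℂ (S.LieN K) :=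
  LinearMap.mk₂ ℂ (fun X Y => -lam ⁅S.toLie n X, S.toLie K Y⁆)
    (fun X X' Y => by rw [map_add, add_lie, map_add, neg_add])
    (fun c X Y => by rw [map_smul, smul_lie, map_smul, smul_neg])
    (fun X Y Y' => by rw [map_add, lie_add, map_add, neg_add])
    (fun c X Y => by rw [map_smul, lie_smul, map_smul, smul_neg])

/-- The twist by Ad(g) is chosen to make the right-hand side independent of `g`: finding the
coefficients of a tangent vector in the left-invariant frame becomes one linear problem for all `g`.
-/
theorem translatedValues_leftVel {n K : ℕ} (h : n ≤ K) (g : S.G n) (X : S.LieN n) :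
    S.translatedValues lam h g (S.leftVel lam n g X) = S.bracketDual lam n K X := by
  apply LinearMap.ext
  intro Y
  rw [translatedValues_apply, leftVel_evalN, S.adInv_toLie h, ← Module.End.mul_apply,
    ← map_mul, inv_mul_cancel, map_one]
  rfl

section Connected

variable (hconn : ∀ n, @ConnectedSpace (S.G n) (groupVariety (S.G n)).top)

include hconn

theorem tangentN_ext (n : ℕ) {m : S.orbitN lam n} {ξ η : (S.orbitNSpace lam n).Tangent m}
    (h : ∀ x, ξ ((S.orbitNSpace lam n).diff m (S.evalN lam n x)) =
      η ((S.orbitNSpace lam n).diff m (S.evalN lam n x))) : ξ = η := by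
  obtain ⟨K, -, hK⟩ := S.exists_embedding lam hconn n
  refine (hK K le_rfl).tangent_ext ?_
  rintro _ ⟨X, rfl⟩
  exact h (S.toLie K X)

/-- Infinitesimally, gh = (ghg⁻¹)g: moving on the right of g by X is moving on the left by Ad(g)X.
-/
theorem leftVel_eq_velN (n : ℕ) (g : S.G n) (X : S.LieN n) :
    S.leftVel lam n g X = S.velN lam n (S.baseN lam n g) (Ad (S.G n) g X) := by
  refine S.tangentN_ext lam hconn n fun x => ?_
  rw [leftVel_evalN]
  refine Eq.trans ?_ (S.velN_diff_evalFn lam n (S.baseN lam n g) _ x).symm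
  change _ = -lam (S.adInv n g _)
  rw [adInv_lie, adInv_toLie_Ad]

theorem leftVel_surjective (n : ℕ) (g : S.G n) : Function.Surjective (S.leftVel lam n g) := by
  intro ξ
  obtain ⟨X, rfl⟩ := S.velN_surjective lam hconn n _ ξ
  refine ⟨Ad (S.G n) g⁻¹ X, ?_⟩
  rw [leftVel_eq_velN S lam hconn, ← Module.End.mul_apply, ← map_mul, mul_inv_cancel, map_one]
  rfl

/-- The form is invariant under the group, so its coefficients in the left-invariant frame do not
depend on `g`. -/
theorem restrictForm_omegaInf_leftVel
    (h : ∀ μ : S.orbit lam, LinearMap.range (S.dIncl lam μ) = S.charDist μ.1) (n : ℕ) (g : S.G n)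
    (X Y : S.LieN n) :
    S.restrictForm lam (S.omegaInf lam h) n (S.baseN lam n g) (S.leftVel lam n g X)
      (S.leftVel lam n g Y) = S.res n lam ⁅X, Y⁆ := by
  rw [leftVel_eq_velN S lam hconn, leftVel_eq_velN S lam hconn, restrictForm_omegaInf_velN]
  change lam (S.adInv n g _) = lam (S.toLie n _)
  rw [adInv_lie, adInv_toLie_Ad, adInv_toLie_Ad, toLie_lie]

/-- Vector fields on `Gₙ · λ` lift to vector fields on `Gₙ`. -/
theorem exists_lift_vectorField (n : ℕ) {U : Set (S.orbitN lam n)}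
    {v : ∀ m, (S.orbitNSpace lam n).Tangent m} (hv : (S.orbitNSpace lam n).IsVectorFieldOn U v) :
    ∃ ξ : S.G n → S.LieN n, ∀ g, S.baseN lam n g ∈ U →
      (∀ L : Dual ℂ (S.LieN n), (groupVariety (S.G n)).IsRegAt g fun h => L (ξ h)) ∧
        v (S.baseN lam n g) = S.leftVel lam n g (ξ g) := by
  obtain ⟨K, hnK, hK⟩ := S.exists_embedding lam hconn n
  obtain ⟨Ψ, hΨ⟩ := (S.bracketDual lam n K).exists_quasi_inverse
  let A : S.G n → Dual ℂ (S.LieN K) := fun g => S.translatedValues lam hnK g (v (S.baseN lam n g))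
  refine ⟨fun g => Ψ (A g), fun g hg => ⟨fun L => ?_, ?_⟩⟩
  -- By biduality L ∘ Ψ is the evaluation at an element of 𝔤_K, so this is a translated value of v,
  -- which is regular.
  · obtain ⟨X, hX⟩ := (evalEquiv ℂ (S.LieN K)).surjective (L ∘ₗ Ψ)
    have e : (fun h => L (Ψ (A h))) = fun h => A h X :=
      funext fun h => (LinearMap.congr_fun hX (A h)).symm
    rw [e]
    exact S.isRegAt_translatedValues lam hnK hv hg X
  · obtain ⟨X, hX⟩ := S.leftVel_surjective lam hconn n g (v (S.baseN lam n g))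
    -- Since v(g · λ) is a left velocity, `A g` lies in the range of `bracketDual`, where `Ψ` is a
    -- right inverse.
    have h1 : A g = S.bracketDual lam n K X := by
      rw [← S.translatedValues_leftVel lam hnK g, hX]
    have h2 : A g = S.translatedValues lam hnK g (S.leftVel lam n g (Ψ (A g))) := by
      rw [translatedValues_leftVel, h1, hΨ]
    refine (hK K le_rfl).tangent_ext ?_
    rintro _ ⟨Y, rfl⟩
    refine (S.translatedValues_Ad_inv lam hnK g _ Y).symm.trans (Eq.trans ?_
      (S.translatedValues_Ad_inv lam hnK g _ Y))
    exact LinearMap.congr_fun h2 _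

end Connected

end AlgGroupSystem

/-! ## The form is closed -/

namespace AlgGroupSystem

variable (S : AlgGroupSystem.{u}) (lam : S.LieDual)

/-- `ξ` is a lift of the vector field `v` near `g`. -/
structure IsLiftAt {n : ℕ} (v : ∀ m, (S.orbitNSpace lam n).Tangent m) (ξ : S.G n → S.LieN n)
    (g : S.G n) : Prop where
  regular : ∀ L : Dual ℂ (S.LieN n), (groupVariety (S.G n)).IsRegAt g fun h => L (ξ h)
  eq : ∀ᶠ h in (groupVariety (S.G n)).nbhd g, v (S.baseN lam n h) = S.leftVel lam n h (ξ h)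

variable {S lam}

theorem IsLiftAt.eq_self {n : ℕ} {v : ∀ m, (S.orbitNSpace lam n).Tangent m}
    {ξ : S.G n → S.LieN n} {g : S.G n} (h : S.IsLiftAt lam v ξ g) :
    v (S.baseN lam n g) = S.leftVel lam n g (ξ g) :=
  (groupVariety (S.G n)).self_of_nbhd h.eq

/-- The form `μ ⁅X, Y⁆` on `𝔤ₙ`. -/
noncomputable def lieForm {n : ℕ} (μ : Dual ℂ (S.LieN n)) : S.LieN n →ₗ[ℂ] S.LieN n →ₗ[ℂ] ℂ :=
  LinearMap.mk₂ ℂ (fun X Y => μ ⁅X, Y⁆) (fun X X' Y => by rw [add_lie, map_add])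
    (fun c X Y => by rw [smul_lie, map_smul]) (fun X Y Y' => by rw [lie_add, map_add])
    (fun c X Y => by rw [lie_smul, map_smul])

/-- The functions `h ↦ -λ ⁅X, h⁻¹ x⁆`. -/
noncomputable def bracketFn (S : AlgGroupSystem.{u}) (lam : S.LieDual) (n : ℕ) (x : S.LieInf) :
    S.LieN n →ₗ[ℂ] (S.G n → ℂ) :=
  LinearMap.pi fun h => -(lam ∘ₗ (LinearMap.mk₂ ℂ (fun (X : S.LieN n) (y : S.LieInf) =>
    ⁅S.toLie n X, y⁆) (fun X X' Y => by rw [map_add, add_lie])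
    (fun c X Y => by rw [map_smul, smul_lie]) (fun X Y Y' => by rw [lie_add])
    (fun c X Y => by rw [lie_smul])).flip (S.adInv n h x))

theorem bracketFn_apply (n : ℕ) (x : S.LieInf) (X : S.LieN n) (h : S.G n) :
    bracketFn S lam n x X h = -lam ⁅S.toLie n X, S.adInv n h x⁆ := rfl

/-- The functional `y ↦ -λ ⁅X, y⁆`. -/
noncomputable def coadDual (lam : S.LieDual) (x : S.LieInf) : S.LieDual where
  toFun y := -lam ⁅x, y⁆
  map_add' y z := by rw [lie_add, map_add, neg_add]
  map_smul' c y := by rw [lie_smul, map_smul, smul_neg, RingHom.id_apply]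

theorem bracketFn_eq (n : ℕ) (x : S.LieInf) (X : S.LieN n) :
    bracketFn S lam n x X = fun h => S.coadN n h (coadDual lam (S.toLie n X)) x := rfl

theorem isRegAt_bracketFn (n : ℕ) (g : S.G n) (x : S.LieInf) (X : S.LieN n) :
    (groupVariety (S.G n)).IsRegAt g (bracketFn S lam n x X) :=
  affine_isRegAt _ (S.coadN_mem n (coadDual lam (S.toLie n X)) x) g

theorem leftTangent_bracketFn (n : ℕ) (g : S.G n) (x : S.LieInf) (X Y : S.LieN n) :
    leftTangent g Y ((groupVariety (S.G n)).diff g (bracketFn S lam n x X)) =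
      lam ⁅S.toLie n X, ⁅S.toLie n Y, S.adInv n g x⁆⁆ := by
  rw [bracketFn_eq, leftTangent_coadN]
  exact neg_neg _

section Lift

variable {n : ℕ} {v w z : ∀ m, (S.orbitNSpace lam n).Tangent m} {ξ η : S.G n → S.LieN n}
  {g : S.G n}

theorem IsLiftAt.eventually_evalN (h : S.IsLiftAt lam v ξ g) (x : S.LieInf) :
    ∀ᶠ k in (groupVariety (S.G n)).nbhd g, bracketFn S lam n x (ξ k) k =
      v (S.baseN lam n k) ((S.orbitNSpace lam n).diff (S.baseN lam n k) (S.evalN lam n x)) := by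
  filter_upwards [h.eq] with k hk
  rw [hk, leftVel_evalN, bracketFn_apply]

/-- On the group, w(x) is the function h ↦ -λ[η(h), h⁻¹x]. The first term differentiates h⁻¹x with η
frozen, the second differentiates η. -/
theorem IsLiftAt.apply_evalN (hv : S.IsLiftAt lam v ξ g) (hw : S.IsLiftAt lam w η g)
    (x : S.LieInf) (hreg : (S.orbitNSpace lam n).IsRegAt (S.baseN lam n g)
      fun m => w m ((S.orbitNSpace lam n).diff m (S.evalN lam n x))) :
    v (S.baseN lam n g) ((S.orbitNSpace lam n).diff (S.baseN lam n g)
      fun m => w m ((S.orbitNSpace lam n).diff m (S.evalN lam n x))) =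
      lam ⁅S.toLie n (η g), ⁅S.toLie n (ξ g), S.adInv n g x⁆⁆ -
        lam ⁅S.toLie n (Tangent.deriv (leftTangent g (ξ g)) η), S.adInv n g x⁆ := by
  have h1 := isRegAt_pairing hw.regular (bracketFn S lam n x) (isRegAt_bracketFn n g x)
  have h2 := Tangent.apply_diff_pairing hw.regular (bracketFn S lam n x) (isRegAt_bracketFn n g x)
    (leftTangent g (ξ g))
  rw [(groupVariety (S.G n)).diff_congr h1 (hw.eventually_evalN x), leftTangent_bracketFn,
    bracketFn_apply, ← sub_eq_add_neg] at h2
  rw [hv.eq_self, S.leftVel_diff lam n g _ hreg]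
  exact h2

end Lift

section Connected

variable (hconn : ∀ n, @ConnectedSpace (S.G n) (groupVariety (S.G n)).top)

include hconn

theorem exists_isLiftAt {n : ℕ} {U : Set (S.orbitN lam n)}
    (hU : @IsOpen _ (S.orbitNSpace lam n).top U)
    {v : ∀ m, (S.orbitNSpace lam n).Tangent m} (hv : (S.orbitNSpace lam n).IsVectorFieldOn U v) :
    ∃ ξ : S.G n → S.LieN n, ∀ g, S.baseN lam n g ∈ U → S.IsLiftAt lam v ξ g := by
  obtain ⟨ξ, hξ⟩ := S.exists_lift_vectorField lam hconn n hv
  refine ⟨ξ, fun g hg => ⟨(hξ g hg).1, ?_⟩⟩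
  have h : ∀ᶠ m in (S.orbitNSpace lam n).nbhd (S.baseN lam n g), m ∈ U :=
    let _ : TopologicalSpace (S.orbitN lam n) := (S.orbitNSpace lam n).top
    hU.mem_nhds hg
  exact (((S.isMorphism_baseN lam n).tendsto g).eventually h).mono fun k hk => (hξ k hk).2

variable {n : ℕ} {u v w z : ∀ m, (S.orbitNSpace lam n).Tangent m} {ξ η ζ : S.G n → S.LieN n}
  {g : S.G n}

/-- The bracket of vector fields in the left-invariant frame: the derivatives of the coefficients
plus the bracket of 𝔤ₙ. It is tested on linear functions, where the double brackets combine by the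
Jacobi identity; lifts are not unique, so the formula holds only after projection to the orbit. -/
theorem IsLiftAt.lie {U : Set (S.orbitN lam n)} (hg : S.baseN lam n g ∈ U)
    (hv : S.IsLiftAt lam v ξ g) (hw : S.IsLiftAt lam w η g)
    (hv' : (S.orbitNSpace lam n).IsVectorFieldOn U v)
    (hw' : (S.orbitNSpace lam n).IsVectorFieldOn U w)
    (hz : (S.orbitNSpace lam n).IsLieBracketOn U v w z) :
    z (S.baseN lam n g) = S.leftVel lam n g (Tangent.deriv (leftTangent g (ξ g)) η -
      Tangent.deriv (leftTangent g (η g)) ξ + ⁅ξ g, η g⁆) := by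
  refine S.tangentN_ext lam hconn n fun x => ?_
  have hx := S.evalN_reg lam n (S.baseN lam n g) x
  rw [hz _ hg _ hx, hv.apply_evalN hw x (hw' _ hg _ hx), hw.apply_evalN hv x (hv' _ hg _ hx),
    leftVel_evalN, map_add, map_sub, ← toLie_lie, add_lie, sub_lie, lie_lie]
  simp only [map_add, map_sub]
  ring

variable (h : ∀ μ : S.orbit lam, LinearMap.range (S.dIncl lam μ) = S.charDist μ.1)

theorem IsLiftAt.eventually_omega (hv : S.IsLiftAt lam v ξ g) (hw : S.IsLiftAt lam w η g) :
    ∀ᶠ k in (groupVariety (S.G n)).nbhd g, lieForm (S.res n lam) (ξ k) (η k) =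
      S.restrictForm lam (S.omegaInf lam h) n (S.baseN lam n k) (v (S.baseN lam n k))
        (w (S.baseN lam n k)) := by
  filter_upwards [hv.eq, hw.eq] with k h1 h2
  rw [h1, h2, S.restrictForm_omegaInf_leftVel lam hconn]
  rfl

theorem isRegAt_omega {U : Set (S.orbitN lam n)} (hU : @IsOpen _ (S.orbitNSpace lam n).top U)
    (hv : (S.orbitNSpace lam n).IsVectorFieldOn U v)
    (hw : (S.orbitNSpace lam n).IsVectorFieldOn U w) {m : S.orbitN lam n} (hm : m ∈ U) :
    (S.orbitNSpace lam n).IsRegAt m fun y =>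
      S.restrictForm lam (S.omegaInf lam h) n y (v y) (w y) := by
  obtain ⟨ξ, hξ⟩ := exists_isLiftAt hconn hU hv
  obtain ⟨η, hη⟩ := exists_isLiftAt hconn hU hw
  refine S.isRegAt_orbitN lam hU (fun g hg => ?_) hm
  exact (groupVariety (S.G n)).congr_germ g _ _ ((hξ g hg).eventually_omega hconn h (hη g hg))
    (isRegAt_bilinear (hξ g hg).regular (hη g hg).regular (lieForm (S.res n lam)))

/-- On the group the form is the constant bilinear form λ[·, ·], so only the coefficients of the
vector fields are differentiated. -/
theorem IsLiftAt.apply_omega (hu : S.IsLiftAt lam u ζ g) (hv : S.IsLiftAt lam v ξ g)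
    (hw : S.IsLiftAt lam w η g) (hreg : (S.orbitNSpace lam n).IsRegAt (S.baseN lam n g) fun y =>
      S.restrictForm lam (S.omegaInf lam h) n y (v y) (w y)) :
    u (S.baseN lam n g) ((S.orbitNSpace lam n).diff (S.baseN lam n g) fun y =>
      S.restrictForm lam (S.omegaInf lam h) n y (v y) (w y)) =
      S.res n lam ⁅ξ g, Tangent.deriv (leftTangent g (ζ g)) η⁆ +
        S.res n lam ⁅Tangent.deriv (leftTangent g (ζ g)) ξ, η g⁆ := by
  have h1 := isRegAt_bilinear hv.regular hw.regular (lieForm (S.res n lam))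
  have h2 := Tangent.apply_diff_bilinear hv.regular hw.regular (lieForm (S.res n lam))
    (leftTangent g (ζ g))
  rw [(groupVariety (S.G n)).diff_congr h1 (hv.eventually_omega hconn h hw)] at h2
  rw [hu.eq_self, S.leftVel_diff lam n g _ hreg]
  exact h2

theorem isClosedTwoForm_omegaInf (n : ℕ) : (S.orbitNSpace lam n).IsClosedTwoForm
    (S.restrictForm lam (S.omegaInf lam h) n) where
  alternating m ξ := S.isAlt_omegaInf lam h ⟨m.1, S.orbitN_subset lam n m.2⟩ _
  regular U hU v w hv hw m hm := isRegAt_omega hconn h hU hv hw hm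
  closed := by
    intro U hU u v w uv uw vw hu hv hw huv huw hvw m hm
    obtain ⟨ξ, hξ⟩ := exists_isLiftAt hconn hU hu
    obtain ⟨η, hη⟩ := exists_isLiftAt hconn hU hv
    obtain ⟨ζ, hζ⟩ := exists_isLiftAt hconn hU hw
    obtain ⟨g, rfl⟩ := S.exists_baseN lam n m
    have lu := hξ g hm
    have lv := hη g hm
    have lw := hζ g hm
    rw [lu.apply_omega hconn h lv lw (isRegAt_omega hconn h hU hv hw hm),
      lv.apply_omega hconn h lu lw (isRegAt_omega hconn h hU hu hw hm),
      lw.apply_omega hconn h lu lv (isRegAt_omega hconn h hU hu hv hm),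
      lu.lie hconn hm lv hu hv huv, lu.lie hconn hm lw hu hw huw, lv.lie hconn hm lw hv hw hvw,
      lu.eq_self, lv.eq_self, lw.eq_self]
    simp only [S.restrictForm_omegaInf_leftVel lam hconn h]
    -- The six derivatives may be arbitrary elements of 𝔤ₙ: those from the derivatives of ω cancel
    -- against those from the brackets of fields. What remains is -[[x, y], z] + [[x, z], y] - [[y,
    -- z], x] = 0.
    generalize Tangent.deriv (leftTangent g (ξ g)) η = a
    generalize Tangent.deriv (leftTangent g (ξ g)) ζ = b
    generalize Tangent.deriv (leftTangent g (η g)) ξ = c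
    generalize Tangent.deriv (leftTangent g (η g)) ζ = d
    generalize Tangent.deriv (leftTangent g (ζ g)) ξ = e
    generalize Tangent.deriv (leftTangent g (ζ g)) η = f
    generalize ξ g = x
    generalize η g = y
    generalize ζ g = z
    rw [← map_add, ← map_add, ← map_add, ← map_sub, ← map_add, ← map_sub, ← map_add, ← map_sub]
    convert map_zero (S.res n lam)
    simp only [add_lie, sub_lie]
    rw [lie_lie x y z, ← lie_skew ⁅x, z⁆ y, ← lie_skew ⁅y, z⁆ x, ← lie_skew b y, ← lie_skew d x,
      ← lie_skew f x]
    abel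

end Connected

end AlgGroupSystem

theorem theorem4p3 (S : AlgGroupSystem.{u})
    (hconn : ∀ n, @ConnectedSpace (S.G n) (groupVariety (S.G n)).top) (lam : S.LieDual) :
    (S.IsIndVarietyOrbit lam ∧
      @IrreducibleSpace (S.orbit lam) (S.orbitSpace lam).top ∧
      SpaceWithFunctions.IsMorphism (S.orbitSpace lam) S.proVariety
        (fun μ : S.orbit lam => μ.1) ∧
      Function.Injective (fun μ : S.orbit lam => μ.1) ∧
      ∀ μ : S.orbit lam, Function.Injective (S.dIncl lam μ)) ∧
    (∀ μ : S.orbit lam, LinearMap.range (S.dIncl lam μ) = S.charDist μ.1) ∧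
    ∃ ω : S.OrbitForm lam, S.IsOmegaInf lam ω ∧ (∀ ω', S.IsOmegaInf lam ω' → ω' = ω) ∧
      S.IsWeakSymplectic lam ω ∧
      ∀ (μ : S.orbit lam) (Y Z : S.OrbitTangent lam μ),
        ∃ (hY : S.dIncl lam μ Y ∈ S.charDist μ.1) (hZ : S.dIncl lam μ Z ∈ S.charDist μ.1),
          ω μ Y Z = S.redBivector μ.1 ((S.anchorEquiv μ.1).symm ⟨S.dIncl lam μ Y, hY⟩)
            ((S.anchorEquiv μ.1).symm ⟨S.dIncl lam μ Z, hZ⟩) := by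
  have hrange := fun μ => S.range_dIncl lam hconn μ
  refine ⟨⟨S.isIndVarietyOrbit lam hconn, S.irreducibleSpace_orbit lam hconn, S.isMorphism_incl lam,
    Subtype.val_injective, S.dIncl_injective lam hconn⟩, hrange, S.omegaInf lam hrange,
    S.isOmegaInf_omegaInf lam hconn hrange, fun ω' hω' =>
      S.isOmegaInf_unique lam hconn (S.isOmegaInf_omegaInf lam hconn hrange) hω',
    { alternating := S.isAlt_omegaInf lam hrange
      closed := AlgGroupSystem.isClosedTwoForm_omegaInf hconn hrange
      injective := S.omegaInf_injective lam hrange (S.dIncl_injective lam hconn)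
      regular := S.isMorphism_omega lam (S.omegaInf lam hrange) }, fun μ Y Z => ?_⟩
  exact ⟨(hrange μ).le ⟨Y, rfl⟩, (hrange μ).le ⟨Z, rfl⟩, S.omegaInf_apply lam hrange μ Y Z⟩
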